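/- Let $d\ge 0$ be an integer and $T>0$, and let $V_b:\mathbb R^d\to\mathbb R$ be $C^\infty$ with all derivatives (including $V_b$ itself) bounded. For $\varepsilon>0$ and a Schwartz function $f:\mathbb R^{2d}\to\mathbb C$ of $(x,k)$ put $$D^\varepsilon f(x,k,p)=\tfrac1\varepsilon\big[f(x,k+\tfrac{\varepsilon}{2}p)-f(x,k-\tfrac{\varepsilon}{2}p)\big],\qquad \delta^\varepsilon[V_b](x,y)=\tfrac1\varepsilon\big[V_b(x+\tfrac{\varepsilon}{2}y)-V_b(x-\tfrac{\varepsilon}{2}y)\big],$$ $$\mathcal L^\varepsilon_{V_b}[f](x,k)=\frac{i}{(2\pi)^d}\int_{\mathbb R^d}\delta^\varepsilon[V_b](x,y)\int_{\mathbb R^d}f(x,p)\,e^{iy\cdot(k-p)}\,dp\,dy .$$ A solution (of the Wigner or of the Liouville equation) on $[0,T]$ means a continuous map from $[0,T]$ to the Schwartz space $\mathcal S(\mathbb R^{2d})$ satisfying the equation pointwise on $[0,T]\times\mathbb R^{2d}$, with one-sided time derivatives at $t=0,T$. Let $f_I^\varepsilon,g_T^\varepsilon$ $(\varepsilon>0)$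 and $f_I,g_T$ be Schwartz functions on $\mathbb R^{2d}$ such that, as $\varepsilon\to0^+$, $f_I^\varepsilon\to f_I$ and $g_T^\varepsilon\to g_T$ in $L^2(\mathbb R^{2d})$, and such that for every order $m$ the $m$-th order derivatives of $f_I^\varepsilon$ and of $g_T^\varepsilon$ are bounded in $L^2(\mathbb R^{2d})$ uniformly for all sufficiently small $\varepsilon>0$. For each $\varepsilon>0$ let $f_b^\varepsilon$ and $g^\varepsilon$ be solutions of the background and the adjoint Wigner equation $$\partial_tf_b^\varepsilon+k\cdot\nabla_xf_b^\varepsilon=\mathcal L^\varepsilon_{V_b}[f_b^\varepsilon],\quad f_b^\varepsilon|_{t=0}=f_I^\varepsilon;\qquad \partial_tg^\varepsilon+k\cdot\nabla_xg^\varepsilon=\mathcal L^\varepsilon_{V_b}[g^\varepsilon],\quad g^\varepsilon|_{t=T}=g_T^\varepsilon,$$ and let $f_b$ and $g$ be solutions of the background and the adjoint Liouville equation $$\partial_tf_b+k\cdot\nabla_xf_b-\nabla_xV_b\cdot\nabla_kf_b=0,\quad f_b|_{t=0}=f_I;\qquad \partial_tg+k\cdot\nabla_xg-\nabla_xV_b\cdot\nabla_kg=0,\quad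 g|_{t=T}=g_T.$$ Define the Wigner and the Liouville representatives $$R_W^\varepsilon[f_I^\varepsilon,g_T^\varepsilon](x)=\frac{i}{(2\pi)^d}\int_{\mathbb R^{3d}\times[0,T]}e^{ip\cdot(z-x)}\,\overline{g^\varepsilon}(t,z,k)\,D^\varepsilon f_b^\varepsilon(t,z,k,p)\,dp\,dz\,dk\,dt,$$ $$R_L[f_I,g_T](x)=-\nabla_x\cdot\int_{\mathbb R^d\times[0,T]}\overline g(t,x,k)\,\nabla_kf_b(t,x,k)\,dk\,dt .$$ Then both integrals converge absolutely for every $x\in\mathbb R^d$ (the first one for every $\varepsilon>0$), the vector field under the divergence in $R_L$ is differentiable, and $$\lim_{\varepsilon\to0^+}R_W^\varepsilon[f_I^\varepsilon,g_T^\varepsilon]=R_L[f_I,g_T]$$ uniformly on $\mathbb R^d$ and also in $L^2(\mathbb R^d)$. -/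

import Mathlib

open Filter Topology MeasureTheory
open scoped ContDiff InnerProductSpace ENNReal NNReal

noncomputable section

namespace WignerLiouville

/-- Position space (and momentum space) `ℝᵈ` with its Euclidean structure. -/
abbrev Space (d : ℕ) : Type := EuclideanSpace ℝ (Fin d)

/-- Complex-valued Schwartz functions on the phase space `ℝᵈ × ℝᵈ` of pairs `(x, k)`. -/
abbrev PhaseFun (d : ℕ) : Type := SchwartzMap (Space d × Space d) ℂ

/-- The potential is smooth and all its derivatives, including the one of order `0`,
are bounded on `ℝᵈ`. -/
def IsAdmissiblePotential {d : ℕ} (V : Space d → ℝ) : Prop :=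
  ContDiff ℝ ∞ V ∧ ∀ n : ℕ, ∃ C : ℝ, ∀ x : Space d, ‖iteratedFDeriv ℝ n V x‖ ≤ C

/-- `δ^ε[V](x, y) = ε⁻¹ (V (x + ε y / 2) - V (x - ε y / 2))`. -/
def potentialDiff {d : ℕ} (V : Space d → ℝ) (ε : ℝ) (x y : Space d) : ℝ :=
  (V (x + (ε / 2) • y) - V (x - (ε / 2) • y)) / ε

/-- `D^ε f (x, k, p) = ε⁻¹ (f (x, k + ε p / 2) - f (x, k - ε p / 2))`. -/
def momentumDiff {d : ℕ} (ε : ℝ) (f : PhaseFun d) (x k p : Space d) : ℂ :=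
  (f (x, k + (ε / 2) • p) - f (x, k - (ε / 2) • p)) / (ε : ℂ)

/-- The operator `L_V^ε`,
`L_V^ε[f](x, k) = i (2π)⁻ᵈ ∫∫ δ^ε[V](x, y) f(x, p) e^{i y·(k - p)} dp dy`.
As always for such oscillatory integrals the `p`-integration is carried out first: for a Schwartz
function `f` both iterated integrals then converge absolutely. -/
def wignerOp {d : ℕ} (V : Space d → ℝ) (ε : ℝ) (f : PhaseFun d) (x k : Space d) : ℂ :=
  Complex.I / (2 * (Real.pi : ℂ)) ^ d *
    ∫ y : Space d, (potentialDiff V ε x y : ℂ) *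
      ∫ p : Space d, f (x, p) * Complex.exp (Complex.I * (⟪y, k - p⟫_ℝ : ℂ))

/-- `f` solves the Wigner equation `∂ₜ f + k·∇ₓ f = L_V^ε[f]` on `[0, T] × ℝ²ᵈ`
(with one-sided time derivatives at the end points), as a continuous curve of Schwartz functions. -/
structure SolvesWigner {d : ℕ} (V : Space d → ℝ) (ε T : ℝ) (f : ℝ → PhaseFun d) : Prop where
  continuousOn : ContinuousOn f (Set.Icc 0 T)
  equation : ∀ t ∈ Set.Icc 0 T, ∀ x k : Space d,
    HasDerivWithinAt (fun s : ℝ => f s (x, k))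
      (-(fderiv ℝ (f t) (x, k) (k, 0)) + wignerOp V ε (f t) x k) (Set.Icc 0 T) t

/-- `f` solves the Liouville equation `∂ₜ f + k·∇ₓ f - ∇V·∇ₖ f = 0` on `[0, T] × ℝ²ᵈ`
(with one-sided time derivatives at the end points), as a continuous curve of Schwartz functions. -/
structure SolvesLiouville {d : ℕ} (V : Space d → ℝ) (T : ℝ) (f : ℝ → PhaseFun d) : Prop where
  continuousOn : ContinuousOn f (Set.Icc 0 T)
  equation : ∀ t ∈ Set.Icc 0 T, ∀ x k : Space d,
    HasDerivWithinAt (fun s : ℝ => f s (x, k))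
      (-(fderiv ℝ (f t) (x, k) (k, 0)) + fderiv ℝ (f t) (x, k) (0, gradient V x))
      (Set.Icc 0 T) t

/-- The measure `dp dz dk dt` on `ℝ³ᵈ × [0, T]`. -/
def wignerMeasure (d : ℕ) (T : ℝ) : Measure ((Space d × Space d × Space d) × ℝ) :=
  (volume : Measure (Space d × Space d × Space d)).prod (volume.restrict (Set.Icc 0 T))

/-- The integrand `e^{i p·(z - x)} conj(g(t, z, k)) D^ε f(t, z, k, p)` of the Wigner representative,
as a function of `((p, z, k), t)`. -/
def wignerIntegrand {d : ℕ} (ε : ℝ) (f g : ℝ → PhaseFun d) (x : Space d) :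
    (Space d × Space d × Space d) × ℝ → ℂ :=
  fun ⟨⟨p, z, k⟩, t⟩ =>
    Complex.exp (Complex.I * (⟪p, z - x⟫_ℝ : ℂ)) * (starRingEnd ℂ) (g t (z, k)) *
      momentumDiff ε (f t) z k p

/-- The Wigner representative, built from the background solution `f` and the adjoint
solution `g`:
`R_W^ε(x) = i (2π)⁻ᵈ ∫_{ℝ³ᵈ × [0, T]} e^{i p·(z - x)} conj(g(z, k)) D^ε f(z, k, p) dp dz dk dt`. -/
def wignerRep {d : ℕ} (ε T : ℝ) (f g : ℝ → PhaseFun d) (x : Space d) : ℂ :=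
  Complex.I / (2 * (Real.pi : ℂ)) ^ d * ∫ q, wignerIntegrand ε f g x q ∂(wignerMeasure d T)

/-- The measure `dk dt` on `ℝᵈ × [0, T]`. -/
def liouvilleMeasure (d : ℕ) (T : ℝ) : Measure (Space d × ℝ) :=
  (volume : Measure (Space d)).prod (volume.restrict (Set.Icc 0 T))

/-- The `j`-th component of the vector `conj(g(t, x, k)) ∇ₖ f(t, x, k)`, as a function
of `(k, t)`. -/
def liouvilleIntegrand {d : ℕ} (f g : ℝ → PhaseFun d) (j : Fin d) (x : Space d) :
    Space d × ℝ → ℂ :=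
  fun ⟨k, t⟩ => (starRingEnd ℂ) (g t (x, k)) *
    fderiv ℝ (f t) (x, k) (0, EuclideanSpace.single j (1 : ℝ))

/-- The `j`-th component of the vector field `x ↦ ∫_{ℝᵈ × [0, T]} conj(g) ∇ₖ f dk dt`. -/
def liouvilleFlux {d : ℕ} (T : ℝ) (f g : ℝ → PhaseFun d) (j : Fin d) (x : Space d) : ℂ :=
  ∫ q, liouvilleIntegrand f g j x q ∂(liouvilleMeasure d T)

/-- The Liouville representative, built from the background solution `f` and the adjoint
solution `g`: `R_L(x) = - ∇ₓ · ∫_{ℝᵈ × [0, T]} conj(g) ∇ₖ f dk dt`. -/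
def liouvilleRep {d : ℕ} (T : ℝ) (f g : ℝ → PhaseFun d) (x : Space d) : ℂ :=
  -∑ j : Fin d, fderiv ℝ (liouvilleFlux T f g j) x (EuclideanSpace.single j (1 : ℝ))

/-- As `ε → 0⁺`, the family `u^ε` converges strongly in `L²(ℝ²ᵈ)` to `u`, and it is regular
uniformly in `ε`: for every order `m` the derivatives of order `m` of `u^ε` are bounded
in `L²(ℝ²ᵈ)` for all small `ε > 0`. -/
structure ConvergesRegularly {d : ℕ} (u : ℝ → PhaseFun d) (u₀ : PhaseFun d) : Prop where
  tendsto_L2 : Tendsto (fun ε : ℝ => eLpNorm (fun w => u ε w - u₀ w) 2 volume) (𝓝[>] 0) (𝓝 0)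
  bounded : ∀ m : ℕ, ∃ C : ℝ≥0, ∀ᶠ ε in 𝓝[>] (0 : ℝ),
    eLpNorm (fun w => iteratedFDeriv ℝ m (u ε) w) 2 volume ≤ C

end WignerLiouville

end

/-! The position variable is moved to the Fourier side. For a plane wave `e_p(x) = e^{ip·x}`, the
Wigner operator with `e_p` as its potential acts as `f ↦ i e_p(x) D^ε f(x,k,p)`
(`wignerCLM_planeWave_apply`). With `p = 2πq`, the Wigner representative is therefore the Fourier
transform of `A^ε(q) = ∫₀ᵀ ⟨g^ε, L^ε_{e_p} f^ε⟩ dt`. In the same way the Liouville representative is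
the Fourier transform of `A⁰(q) = ∫₀ᵀ ⟨g, ∇e_p·∇ₖ f⟩ dt`. If `A^ε → A⁰` pointwise and both are at
most `C (1+|q|)^{-N}` with `N` large and `C` independent of small `ε`, then the convergence holds in
`L¹` and in `L²`. This gives uniform convergence of the transforms, and `L²` convergence by
Plancherel (`tendsto_fourier_of_dominated`).

Both inputs rest on a description of `L^ε_W`: after Fourier transform in `k` it is multiplication by
`i` times a central difference quotient of `W`. Three facts follow. It is controlled in `L²` by
first momentum derivatives, with constant `sup |∇W|` and uniformly in `ε`. It differs from `∇W·∇ₖ`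
by `O(ε)` on functions with two momentum derivatives in `L²`. It is skew-adjoint for real `W`, and
its commutator with `∂ₓ` is `L^ε_{∂W}`.

Pointwise convergence needs `f^ε → f` and `g^ε → g` in `L²`, uniformly in time. The difference
solves the Wigner equation with the source `(L^ε_V - ∇V·∇ₖ) f`, which is `O(ε)` because `f` is a
fixed continuous curve of Schwartz functions, so Grönwall applies
(`exists_l2norm_wigner_sub_liouville_le`).

Domination comes from integration by parts in `x` against `e_p`: each power of `|p|` costs one
derivative of `f^ε` or `g^ε` (`one_add_norm_pow_mul_le`). The required uniform Sobolev bounds are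
propagated from the data. Skew-adjointness removes the leading term of the energy identity, and the
commutators with the generator lose no derivative (`exists_energyDot_wignerGen_le`). -/

noncomputable section

set_option linter.unusedSectionVars false

namespace WignerLiouville

open scoped FourierTransform SchwartzMap LineDeriv
open SchwartzMap

universe u

/-! ### Partial Fourier transform on Schwartz functions of two variables -/

section PartialFourier

variable {E F : Type u} [NormedAddCommGroup E] [NormedSpace ℝ E]
  [NormedAddCommGroup F] [InnerProductSpace ℝ F] [FiniteDimensional ℝ F]
  [MeasurableSpace F] [BorelSpace F]
  {G : Type u} [NormedAddCommGroup G] [NormedSpace ℂ G]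

omit [FiniteDimensional ℝ F] [MeasurableSpace F] [BorelSpace F] in
theorem hasTemperateGrowth_prodMk_left (x : E) :
    (fun p : F => (x, p)).HasTemperateGrowth := by
  have h : (fun p : F => (x, p)) =
      (fun _ : F => ((x, 0) : E × F)) + ⇑(ContinuousLinearMap.inr ℝ E F) := by
    ext p <;> simp
  rw [h]
  exact (Function.HasTemperateGrowth.const _).add (ContinuousLinearMap.hasTemperateGrowth _)

/-- The restriction of a Schwartz function on `E × F` to the fibre `{x} × F`. -/
def slice (x : E) : 𝓢(E × F, G) →L[ℂ] 𝓢(F, G) :=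
  compCLM ℂ (hasTemperateGrowth_prodMk_left x)
    ⟨1, 1, fun p => by
      have : ‖p‖ ≤ ‖(x, p)‖ := le_max_right _ _
      rw [one_mul, pow_one]
      exact this.trans (le_add_of_nonneg_left zero_le_one)⟩

theorem slice_apply (x : E) (f : 𝓢(E × F, G)) (p : F) : slice x f p = f (x, p) := rfl

theorem norm_iteratedFDeriv_slice_le (x : E) (f : 𝓢(E × F, G)) (n : ℕ) (p : F) :
    ‖iteratedFDeriv ℝ n (slice x f) p‖ ≤ ‖iteratedFDeriv ℝ n f (x, p)‖ := by
  have h : (slice x f : F → G) =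
      (fun w => f ((x, 0) + w)) ∘ ⇑(ContinuousLinearMap.inr ℝ E F) := by
    ext p; simp [slice_apply]
  have hs : ContDiff ℝ ∞ (fun w => f ((x, 0) + w)) :=
    (f.smooth ⊤).comp (contDiff_const.add contDiff_id)
  rw [h, ContinuousLinearMap.iteratedFDeriv_comp_right _ hs p (i := n) (mod_cast le_top),
    iteratedFDeriv_comp_add_left]
  refine (ContinuousMultilinearMap.norm_compContinuousLinearMap_le _ _).trans ?_
  have h1 : ‖ContinuousLinearMap.inr ℝ E F‖ ≤ 1 := ContinuousLinearMap.norm_inr_le_one ℝ E F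
  have h2 : ∏ _i : Fin n, ‖ContinuousLinearMap.inr ℝ E F‖ ≤ 1 :=
    Finset.prod_le_one (fun _ _ => ContinuousLinearMap.opNorm_nonneg _) (fun _ _ => h1)
  calc _ ≤ ‖iteratedFDeriv ℝ n f ((x, 0) + ContinuousLinearMap.inr ℝ E F p)‖ * 1 := by gcongr
    _ = _ := by simp

/-- Both `‖x‖` and `‖p‖` are at most `‖(x, p)‖`, so a weight in the frozen variable is absorbed by
the full Schwartz weight. This is the source of decay in `x` of the fibrewise transform. -/
theorem pow_norm_mul_seminorm_slice_le (x : E) (f : 𝓢(E × F, G)) (i a b : ℕ) :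
    ‖x‖ ^ i * SchwartzMap.seminorm ℝ a b (slice x f) ≤ SchwartzMap.seminorm ℝ (i + a) b f := by
  have h : SchwartzMap.seminorm ℝ a b (((‖x‖ ^ i : ℝ)) • slice x f) ≤
      SchwartzMap.seminorm ℝ (i + a) b f := by
    refine seminorm_le_bound ℝ a b _ (apply_nonneg _ _) fun p => ?_
    have hsm : ContDiffAt ℝ b (slice x f) p := (slice x f).contDiffAt b
    have he : iteratedFDeriv ℝ b (⇑((‖x‖ ^ i : ℝ) • slice x f)) p =
        (‖x‖ ^ i : ℝ) • iteratedFDeriv ℝ b (slice x f) p :=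
      iteratedFDeriv_const_smul_apply hsm
    rw [he, norm_smul, Real.norm_of_nonneg (by positivity)]
    have h1 : ‖x‖ ≤ ‖(x, p)‖ := le_max_left _ _
    have h2 : ‖p‖ ≤ ‖(x, p)‖ := le_max_right _ _
    calc _ ≤ ‖(x, p)‖ ^ a * (‖(x, p)‖ ^ i * ‖iteratedFDeriv ℝ b f (x, p)‖) := by
            gcongr; exact norm_iteratedFDeriv_slice_le x f b p
      _ = ‖(x, p)‖ ^ (i + a) * ‖iteratedFDeriv ℝ b f (x, p)‖ := by ring
      _ ≤ _ := le_seminorm ℝ _ _ f _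
  simpa [map_smul_eq_mul] using h

/-- The fibrewise Fourier transform, as a function. -/
def partialFourierFun (f : 𝓢(E × F, G)) (w : E × F) : G := 𝓕 (slice w.1 f) w.2

theorem partialFourierFun_eq (f : 𝓢(E × F, G)) (w : E × F) :
    partialFourierFun f w = ∫ p, 𝐞 (-⟪p, w.2⟫_ℝ) • f (w.1, p) := by
  rw [partialFourierFun, SchwartzMap.fourier_coe, Real.fourier_eq]; rfl

/-- Continuity of the Fourier transform on each fibre bounds the decay in `w.2` by finitely many
seminorms of the slice; powers of `‖w.1‖` are then absorbed into those seminorms. The cases `(k, 0)`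
and `(0, k)` suffice because `‖w‖` is the maximum of the two norms. -/
theorem exists_seminorm_partialFourierFun_le (k : ℕ) :
    ∃ q : Seminorm ℝ 𝓢(E × F, G), Continuous q ∧
      ∀ f w, ‖w‖ ^ k * ‖partialFourierFun f w‖ ≤ q f := by
  have key : ∀ i j : ℕ, ∃ q : Seminorm ℝ 𝓢(E × F, G), Continuous q ∧
      ∀ f w, ‖w.1‖ ^ i * (‖w.2‖ ^ j * ‖partialFourierFun f w‖) ≤ q f := by
    intro i j
    let T : 𝓢(F, G) →L[ℝ] 𝓢(F, G) := fourierTransformCLM ℝ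
    have hc : Continuous ((SchwartzMap.seminorm ℝ j 0).comp T.toLinearMap) :=
      ((schwartz_withSeminorms ℝ F G).continuous_seminorm (j, 0)).comp T.continuous
    obtain ⟨s, C, -, hC⟩ := Seminorm.bound_of_continuous (schwartz_withSeminorms ℝ F G) _ hc
    refine ⟨C • ∑ m ∈ s, SchwartzMap.seminorm ℝ (i + m.1) m.2, ?_, fun f w => ?_⟩
    · have : Continuous fun f : 𝓢(E × F, G) =>
          (C : ℝ) * ∑ m ∈ s, SchwartzMap.seminorm ℝ (i + m.1) m.2 f :=
        continuous_const.mul (continuous_finsetSum _ fun m _ =>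
          (schwartz_withSeminorms ℝ (E × F) G).continuous_seminorm (i + m.1, m.2))
      convert this using 2 with f
      simp [NNReal.smul_def]
    · have h1 : ‖w.2‖ ^ j * ‖partialFourierFun f w‖ ≤
          SchwartzMap.seminorm ℝ j 0 (𝓕 (slice w.1 f)) := norm_pow_mul_le_seminorm ℝ _ j w.2
      have h2 : SchwartzMap.seminorm ℝ j 0 (𝓕 (slice w.1 f)) ≤
          C * (s.sup (schwartzSeminormFamily ℝ F G)) (slice w.1 f) := hC (slice w.1 f)
      have h3 : (s.sup (schwartzSeminormFamily ℝ F G)) (slice w.1 f) ≤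
          ∑ m ∈ s, SchwartzMap.seminorm ℝ m.1 m.2 (slice w.1 f) := by
        have := Seminorm.finset_sup_le_sum (schwartzSeminormFamily ℝ F G) s (slice w.1 f)
        rw [_root_.sum_apply] at this
        exact this
      calc _ ≤ ‖w.1‖ ^ i * (C * ∑ m ∈ s, SchwartzMap.seminorm ℝ m.1 m.2 (slice w.1 f)) :=
            mul_le_mul_of_nonneg_left
              (h1.trans (h2.trans (mul_le_mul_of_nonneg_left h3 C.coe_nonneg))) (by positivity)
        _ = C * ∑ m ∈ s, ‖w.1‖ ^ i * SchwartzMap.seminorm ℝ m.1 m.2 (slice w.1 f) := by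
              rw [Finset.mul_sum, Finset.mul_sum, Finset.mul_sum]
              exact Finset.sum_congr rfl fun m _ => by ring
        _ ≤ C * ∑ m ∈ s, SchwartzMap.seminorm ℝ (i + m.1) m.2 f := by
              gcongr with m _; exact pow_norm_mul_seminorm_slice_le _ _ _ _ _
        _ = _ := by simp [NNReal.smul_def]
  obtain ⟨q₁, hq₁, h₁⟩ := key k 0
  obtain ⟨q₂, hq₂, h₂⟩ := key 0 k
  refine ⟨q₁ + q₂, hq₁.add hq₂, fun f w => ?_⟩
  have h3 : ‖w‖ ^ k ≤ ‖w.1‖ ^ k + ‖w.2‖ ^ k := by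
    rcases max_choice ‖w.1‖ ‖w.2‖ with h | h
    · rw [Prod.norm_def, h]; linarith [pow_nonneg (norm_nonneg w.2) k]
    · rw [Prod.norm_def, h]; linarith [pow_nonneg (norm_nonneg w.1) k]
  have := h₁ f w
  have := h₂ f w
  simp only [pow_zero, one_mul] at *
  calc _ ≤ (‖w.1‖ ^ k + ‖w.2‖ ^ k) * ‖partialFourierFun f w‖ := by gcongr
    _ ≤ q₁ f + q₂ f := by rw [add_mul]; linarith

theorem exists_norm_fibre_le {G' : Type*} [NormedAddCommGroup G'] [NormedSpace ℝ G']
    (f : 𝓢(E × F, G')) (k : ℕ) :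
    ∃ C : ℝ, ∀ x p, ‖f (x, p)‖ ≤ C * (1 + ‖p‖) ^ (-(k : ℝ)) := by
  refine ⟨2 ^ k * (Finset.Iic (k, 0)).sup (fun m => SchwartzMap.seminorm ℝ m.1 m.2) f,
    fun x p => ?_⟩
  have h := one_add_le_sup_seminorm_apply (𝕜 := ℝ) (m := (k, 0)) le_rfl le_rfl f (x, p)
  simp only [norm_iteratedFDeriv_zero] at h
  have h2 : ‖p‖ ≤ ‖(x, p)‖ := le_max_right _ _
  rw [Real.rpow_neg (by positivity), Real.rpow_natCast, ← div_eq_mul_inv, le_div_iff₀ (by positivity),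
    mul_comm]
  exact le_trans (by gcongr) h

/-- The derivative of the integrand of the partial Fourier transform, without the phase. -/
def partialFourierDeriv : 𝓢(E × F, G) →L[ℝ] 𝓢(E × F, E × F →L[ℝ] G) :=
  (postcompCLM (𝕜 := ℝ) ((ContinuousLinearMap.compL ℝ (E × F) (E × F) G).flip
    ((ContinuousLinearMap.inl ℝ E F).comp (ContinuousLinearMap.fst ℝ E F)))).comp
      (fderivCLM ℝ (E × F) G) -
  (2 * Real.pi * Complex.I) • smulRightCLM ℝ G
    ((((innerSL ℝ (E := F)).comp (ContinuousLinearMap.snd ℝ E F)).flip.comp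
      (ContinuousLinearMap.snd ℝ E F)).flip)

theorem partialFourierDeriv_apply (f : 𝓢(E × F, G)) (w v : E × F) :
    partialFourierDeriv f w v =
      fderiv ℝ f w (v.1, 0) - (2 * Real.pi * Complex.I) • (⟪w.2, v.2⟫_ℝ • f w) := by
  simp [partialFourierDeriv]

theorem hasFDerivAt_fourierChar_smul_fibre (f : 𝓢(E × F, G)) (p : F) (w : E × F) :
    HasFDerivAt (fun w : E × F => 𝐞 (-⟪p, w.2⟫_ℝ) • f (w.1, p))
      (𝐞 (-⟪p, w.2⟫_ℝ) • partialFourierDeriv f (w.1, p)) w := by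
  have h1 : HasFDerivAt (fun w : E × F => f (w.1, p))
      ((fderiv ℝ f (w.1, p)).comp ((ContinuousLinearMap.inl ℝ E F).comp
        (ContinuousLinearMap.fst ℝ E F))) w := by
    have h2 : HasFDerivAt (fun w : E × F => (w.1, p)) ((ContinuousLinearMap.inl ℝ E F).comp
        (ContinuousLinearMap.fst ℝ E F)) w := by
      refine (HasFDerivAt.prodMk hasFDerivAt_fst (hasFDerivAt_const p w)).congr_fderiv ?_
      ext v <;> simp
    exact HasFDerivAt.comp w (f.hasFDerivAt (w.1, p)) h2
  have h4 : HasFDerivAt (fun w : E × F => -⟪p, w.2⟫_ℝ)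
      (-((innerSL ℝ p).comp (ContinuousLinearMap.snd ℝ E F))) w :=
    (((innerSL ℝ p).comp (ContinuousLinearMap.snd ℝ E F)).hasFDerivAt).neg
  have h6 := ((Real.hasDerivAt_fourierChar (-⟪p, w.2⟫_ℝ)).hasFDerivAt.comp w h4).smul h1
  refine h6.congr_fderiv ?_
  refine ContinuousLinearMap.ext fun v => ?_
  have h7 : (𝐞 (-⟪p, w.2⟫_ℝ) • partialFourierDeriv f (w.1, p)) v =
      𝐞 (-⟪p, w.2⟫_ℝ) • partialFourierDeriv f (w.1, p) v := rfl
  rw [h7, partialFourierDeriv_apply, Circle.smul_def]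
  simp only [_root_.add_apply, _root_.smul_apply, ContinuousLinearMap.comp_apply,
    ContinuousLinearMap.smulRight_apply]
  have h8 : ((innerSL ℝ p).comp (ContinuousLinearMap.snd ℝ E F)) v = ⟪p, v.2⟫_ℝ := rfl
  simp only [Function.comp_apply, ContinuousLinearMap.coe_fst', ContinuousLinearMap.inl_apply,
    ContinuousLinearMap.toSpanSingleton_apply, _root_.neg_apply, h8, Complex.real_smul, neg_smul,
    smul_sub, ← sub_eq_add_neg, ← Complex.coe_smul (⟪p, v.2⟫_ℝ) (f (w.1, p)), smul_smul]
  congr 2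
  ring

theorem continuous_fourierChar_smul_fibre (f : 𝓢(E × F, G)) (w : E × F) :
    Continuous fun p : F => 𝐞 (-⟪p, w.2⟫_ℝ) • f (w.1, p) := by
  have := Real.continuous_fourierChar
  fun_prop

/-- Differentiation under the integral, dominated by the decay of Schwartz functions along fibres.
The derivative is again a partial Fourier transform, now of a Schwartz function with values in `E ×
F →L[ℝ] G`, which is what makes the smoothness argument inductive. -/
theorem hasFDerivAt_partialFourierFun [CompleteSpace G] (f : 𝓢(E × F, G)) (w : E × F) :
    HasFDerivAt (partialFourierFun f)
      (partialFourierFun (G := E × F →L[ℝ] G) (partialFourierDeriv f) w) w := by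
  have h0 : partialFourierFun f = fun w => ∫ p, 𝐞 (-⟪p, w.2⟫_ℝ) • f (w.1, p) :=
    funext (partialFourierFun_eq f)
  rw [h0, partialFourierFun_eq (G := E × F →L[ℝ] G) (partialFourierDeriv f) w]
  obtain ⟨C₀, hC₀⟩ := exists_norm_fibre_le f (volume : Measure F).integrablePower
  obtain ⟨C, hC⟩ := exists_norm_fibre_le (partialFourierDeriv f) (volume : Measure F).integrablePower
  have hint := Measure.integrable_pow_neg_integrablePower (volume : Measure F)
  have hm := continuous_fourierChar_smul_fibre (G := E × F →L[ℝ] G) (partialFourierDeriv f) w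
  have hi : Integrable fun p : F => 𝐞 (-⟪p, w.2⟫_ℝ) • f (w.1, p) := by
    refine (hint.const_mul C₀).mono' (continuous_fourierChar_smul_fibre f w).aestronglyMeasurable
      (.of_forall fun p => ?_)
    rw [Circle.norm_smul]; exact hC₀ _ _
  have hb : ∀ (p : F) (w : E × F), ‖𝐞 (-⟪p, w.2⟫_ℝ) • partialFourierDeriv f (w.1, p)‖ ≤
      C * (1 + ‖p‖) ^ (-((volume : Measure F).integrablePower : ℝ)) := fun p w => by
    exact (Circle.norm_smul (E := E × F →L[ℝ] G) _ _).trans_le (hC _ _)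
  exact hasFDerivAt_integral_of_dominated_of_fderiv_le (𝕜 := ℝ) (s := Set.univ) Filter.univ_mem
    (F := fun (w : E × F) (p : F) => 𝐞 (-⟪p, w.2⟫_ℝ) • f (w.1, p))
    (F' := fun w p => 𝐞 (-⟪p, w.2⟫_ℝ) • partialFourierDeriv f (w.1, p))
    (.of_forall fun w => (continuous_fourierChar_smul_fibre f w).aestronglyMeasurable) hi
    hm.aestronglyMeasurable (.of_forall fun p w _ => hb p w) (hint.const_mul C)
    (.of_forall fun p w _ => hasFDerivAt_fourierChar_smul_fibre f p w)

/-- The induction is over all targets `G` at once, since one differentiation replaces `G` by `E × F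
→L[ℝ] G`. Keeping `E`, `F` and `G` in one universe makes this target admissible again. -/
theorem partialFourierFun_smooth_and_bound (n : ℕ) :
    ∀ {G : Type u} [NormedAddCommGroup G] [NormedSpace ℂ G] [CompleteSpace G],
      (∀ f : 𝓢(E × F, G), ContDiff ℝ n (partialFourierFun f)) ∧
      ∀ k : ℕ, ∃ q : Seminorm ℝ 𝓢(E × F, G), Continuous q ∧
        ∀ f w, ‖w‖ ^ k * ‖iteratedFDeriv ℝ n (partialFourierFun f) w‖ ≤ q f := by
  induction n with
  | zero =>
    intro G _ _ _
    refine ⟨fun f => contDiff_zero.2 (continuous_iff_continuousAt.2 fun w =>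
      (hasFDerivAt_partialFourierFun f w).continuousAt), fun k => ?_⟩
    simpa using exists_seminorm_partialFourierFun_le k
  | succ n ih =>
    intro G _ _ _
    have hd : ∀ f : 𝓢(E × F, G),
        fderiv ℝ (partialFourierFun f) = partialFourierFun (G := E × F →L[ℝ] G) (partialFourierDeriv f) :=
      fun f => funext fun w => (hasFDerivAt_partialFourierFun f w).fderiv
    obtain ⟨ih1, ih2⟩ := ih (G := E × F →L[ℝ] G)
    refine ⟨fun f => ?_, fun k => ?_⟩
    · rw [Nat.cast_add, Nat.cast_one, contDiff_succ_iff_fderiv]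
      refine ⟨fun w => (hasFDerivAt_partialFourierFun f w).differentiableAt, by simp, ?_⟩
      rw [hd]; exact ih1 _
    · obtain ⟨q, hq, h⟩ := ih2 k
      refine ⟨q.comp (partialFourierDeriv (E := E) (F := F) (G := G)).toLinearMap, ?_,
        fun f w => ?_⟩
      · exact hq.comp (partialFourierDeriv (E := E) (F := F) (G := G)).continuous
      rw [← norm_iteratedFDeriv_fderiv, hd]
      exact h _ w

/-- The partial Fourier transform in the second variable, on Schwartz functions. -/
def partialFourier [CompleteSpace G] : 𝓢(E × F, G) →L[ℂ] 𝓢(E × F, G) :=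
  mkCLM (𝕜 := ℂ) (𝕜' := ℂ) (σ := RingHom.id ℂ) partialFourierFun
    (fun f g w => by simp [partialFourierFun, FourierTransform.fourier_add])
    (fun a f w => by simp [partialFourierFun, FourierTransform.fourier_smul])
    (fun f => contDiff_infty.2 fun n => (partialFourierFun_smooth_and_bound n).1 f)
    (fun m => by
      obtain ⟨q, hq, h⟩ := (partialFourierFun_smooth_and_bound (E := E) (F := F) (G := G) m.2).2 m.1
      obtain ⟨s, C, -, hC⟩ := Seminorm.bound_of_continuous
        (schwartz_withSeminorms ℝ (E × F) G) q hq
      refine ⟨s, C, C.coe_nonneg, fun f w => (h f w).trans ((hC f).trans ?_)⟩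
      exact mul_le_mul_of_nonneg_left (Seminorm.finset_sup_apply_le (apply_nonneg _ _)
        fun i hi => Seminorm.le_finset_sup_apply (p := schwartzSeminormFamily ℂ (E × F) G)
          (x := f) hi) C.coe_nonneg)

theorem partialFourier_apply [CompleteSpace G] (f : 𝓢(E × F, G)) (w : E × F) :
    partialFourier f w = 𝓕 (slice w.1 f) w.2 := rfl

theorem fderiv_partialFourier_apply [CompleteSpace G] (f : 𝓢(E × F, G)) (w v : E × F) :
    fderiv ℝ (partialFourier f) w v = partialFourierFun (G := E × F →L[ℝ] G) (partialFourierDeriv f) w v := by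
  have : (partialFourier f : E × F → G) = partialFourierFun f := rfl
  rw [this, (hasFDerivAt_partialFourierFun f w).fderiv]

end PartialFourier

/-! ### The `L²` norm and pairing on phase space -/

variable {d : ℕ}

instance isAddHaarMeasure_volume_phaseSpace :
    (volume : Measure (Space d × Space d)).IsAddHaarMeasure :=
  Measure.prod.instIsAddHaarMeasure volume volume

/-- The `L²` norm of a function on phase space. -/
def l2norm (f : PhaseFun d) : ℝ := ‖f.toLp 2 volume‖

theorem l2norm_nonneg (f : PhaseFun d) : 0 ≤ l2norm f := norm_nonneg _

/-- The `L²` inner product of functions on phase space, conjugate linear in the first argument. -/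
def l2inner (f g : PhaseFun d) : ℂ := ⟪f.toLp 2 volume, g.toLp 2 volume⟫_ℂ

theorem l2inner_eq (f g : PhaseFun d) : l2inner f g = ∫ w, (starRingEnd ℂ) (f w) * g w := by
  rw [l2inner, inner_toL2_toL2_eq f g volume]
  simp [mul_comm]

/-- Fubini splits the pairing over the fibres `{x} × ℝᵈ`, so Plancherel in momentum follows from
Plancherel on each fibre. -/
theorem l2inner_eq_iterated (f g : PhaseFun d) :
    l2inner f g = ∫ x, ⟪(slice x f).toLp 2 volume, (slice x g).toLp 2 volume⟫_ℂ := by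
  rw [l2inner, inner_toL2_toL2_eq f g volume, Measure.volume_eq_prod, integral_prod]
  · simp only [inner_toL2_toL2_eq, slice_apply]
  · have := L2.integrable_inner (𝕜 := ℂ) (f.toLp 2 volume) (g.toLp 2 volume)
    refine this.congr ?_
    filter_upwards [f.coeFn_toLp 2 volume, g.coeFn_toLp 2 volume] with w h1 h2
    rw [h1, h2]

theorem norm_l2inner_le (f g : PhaseFun d) : ‖l2inner f g‖ ≤ l2norm f * l2norm g :=
  norm_inner_le_norm _ _

theorem l2norm_sq (f : PhaseFun d) : l2norm f ^ 2 = (l2inner f f).re := by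
  rw [l2norm, l2inner, inner_self_eq_norm_sq_to_K]
  norm_cast

theorem l2norm_add_le (f g : PhaseFun d) : l2norm (f + g) ≤ l2norm f + l2norm g :=
  norm_add_le (f.toLp 2 volume) (g.toLp 2 volume)

theorem l2norm_neg (f : PhaseFun d) : l2norm (-f) = l2norm f :=
  norm_neg (f.toLp 2 volume)

theorem l2inner_add_right (f g h : PhaseFun d) : l2inner f (g + h) = l2inner f g + l2inner f h :=
  inner_add_right _ (g.toLp 2 volume) (h.toLp 2 volume)

theorem l2inner_sub_left (f g h : PhaseFun d) : l2inner (f - g) h = l2inner f h - l2inner g h :=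
  inner_sub_left (f.toLp 2 volume) (g.toLp 2 volume) _

theorem l2inner_sub_right (f g h : PhaseFun d) : l2inner f (g - h) = l2inner f g - l2inner f h :=
  inner_sub_right _ (g.toLp 2 volume) (h.toLp 2 volume)

theorem l2inner_smul_right (c : ℂ) (f g : PhaseFun d) : l2inner f (c • g) = c * l2inner f g :=
  inner_smul_right _ (g.toLp 2 volume) c

/-- Used on the Fourier side, where it turns pointwise bounds on symbols into `L²` bounds on
operators. -/
theorem l2norm_le_sum {ι : Type*} (s : Finset ι) (f : PhaseFun d) (g : ι → PhaseFun d) (C : ℝ)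
    (hC : 0 ≤ C) (h : ∀ w, ‖f w‖ ≤ C * ∑ i ∈ s, ‖g i w‖) :
    l2norm f ≤ C * ∑ i ∈ s, l2norm (g i) := by
  have h1 : eLpNorm f 2 volume ≤
      ENNReal.ofReal C * ∑ i ∈ s, eLpNorm (g i) 2 volume := by
    calc eLpNorm f 2 volume ≤ eLpNorm (C • ∑ i ∈ s, fun w => ‖g i w‖) 2 volume := by
          refine eLpNorm_mono_real fun w => ?_
          simpa using h w
      _ ≤ ENNReal.ofReal C * eLpNorm (∑ i ∈ s, fun w => ‖g i w‖) 2 volume := by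
          rw [eLpNorm_const_smul, Real.enorm_of_nonneg hC]
      _ ≤ ENNReal.ofReal C * ∑ i ∈ s, eLpNorm (g i) 2 volume := by
          gcongr
          refine (eLpNorm_sum_le (fun i _ => (g i).continuous.norm.aestronglyMeasurable)
            (by norm_num)).trans (Finset.sum_le_sum fun i _ => ?_)
          rw [eLpNorm_norm]
  have h2 : ∀ i, eLpNorm (g i) 2 volume ≠ ⊤ := fun i => ((g i).eLpNorm_lt_top 2 volume).ne
  have h3 := ENNReal.toReal_mono
    (ENNReal.mul_ne_top ENNReal.ofReal_ne_top (ENNReal.sum_ne_top.2 fun i _ => h2 i)) h1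
  rw [ENNReal.toReal_mul, ENNReal.toReal_ofReal hC, ENNReal.toReal_sum fun i _ => h2 i] at h3
  simpa [l2norm, norm_toLp] using h3

/-! ### Fourier transform in momentum and multiplication operators -/

/-- Reflection of the momentum variable. -/
def momentumNeg : (Space d × Space d) ≃L[ℝ] (Space d × Space d) :=
  (ContinuousLinearEquiv.refl ℝ (Space d)).prodCongr (ContinuousLinearEquiv.neg ℝ)

/-- The Fourier transform in the momentum variable. -/
def fourierK : PhaseFun d →L[ℂ] PhaseFun d := partialFourier

/-- The inverse Fourier transform in the momentum variable. -/
def fourierKInv : PhaseFun d →L[ℂ] PhaseFun d :=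
  (compCLMOfContinuousLinearEquiv ℂ momentumNeg).comp partialFourier

theorem slice_fourierK (x : Space d) (f : PhaseFun d) : slice x (fourierK f) = 𝓕 (slice x f) := rfl

theorem slice_fourierKInv (x : Space d) (f : PhaseFun d) :
    slice x (fourierKInv f) = 𝓕⁻ (slice x f) := rfl

theorem phaseFun_ext_slice {f g : PhaseFun d} (h : ∀ x, slice x f = slice x g) : f = g := by
  ext w
  exact DFunLike.congr_fun (h w.1) w.2

@[simp]
theorem fourierKInv_fourierK (f : PhaseFun d) : fourierKInv (fourierK f) = f :=
  phaseFun_ext_slice fun x => by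
    rw [slice_fourierKInv, slice_fourierK, FourierTransform.fourierInv_fourier_eq]

@[simp]
theorem fourierK_fourierKInv (f : PhaseFun d) : fourierK (fourierKInv f) = f :=
  phaseFun_ext_slice fun x => by
    rw [slice_fourierK, slice_fourierKInv, FourierTransform.fourier_fourierInv_eq]

theorem l2inner_fourierK (f g : PhaseFun d) : l2inner (fourierK f) (fourierK g) = l2inner f g := by
  simp only [l2inner_eq_iterated, slice_fourierK, inner_fourier_toL2_eq]

theorem l2norm_fourierK (f : PhaseFun d) : l2norm (fourierK f) = l2norm f := by
  rw [← sq_eq_sq₀ (l2norm_nonneg _) (l2norm_nonneg _), l2norm_sq, l2norm_sq, l2inner_fourierK]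

/-- Multiplication of a function on phase space by a function of temperate growth. -/
abbrev mulOp (g : Space d × Space d → ℂ) : PhaseFun d →L[ℂ] PhaseFun d := smulLeftCLM ℂ g

theorem mulOp_apply {g : Space d × Space d → ℂ} (hg : g.HasTemperateGrowth) (f : PhaseFun d)
    (w : Space d × Space d) : mulOp g f w = g w * f w :=
  smulLeftCLM_apply_apply hg f w

theorem lineDeriv_mulOp {g g' : Space d × Space d → ℂ} (hg : g.HasTemperateGrowth)
    (hg' : g'.HasTemperateGrowth) (v : Space d × Space d) (h : ∀ w, fderiv ℝ g w v = g' w)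
    (f : PhaseFun d) : ∂_{v} (mulOp g f) = mulOp g (∂_{v} f) + mulOp g' f := by
  ext w
  have h1 : (mulOp g f : Space d × Space d → ℂ) = fun w => g w * f w :=
    funext (mulOp_apply hg f)
  have h2 : DifferentiableAt ℝ g w := (hg.1.differentiable (by simp)) w
  rw [_root_.add_apply, mulOp_apply hg, mulOp_apply hg', lineDerivOp_apply_eq_fderiv,
    lineDerivOp_apply_eq_fderiv, h1, fderiv_fun_mul h2 f.differentiableAt]
  simp [h w]
  ring

theorem lineDeriv_fst_fourierK (v : Space d) (f : PhaseFun d) :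
    ∂_{((v, 0) : Space d × Space d)} (fourierK f) =
      fourierK (∂_{((v, 0) : Space d × Space d)} f) := by
  ext w
  rw [lineDerivOp_apply_eq_fderiv, fourierK, fderiv_partialFourier_apply,
    partialFourierFun_eq, partialFourier_apply, SchwartzMap.fourier_coe, Real.fourier_eq,
    ContinuousLinearMap.integral_apply]
  · refine integral_congr_ae (.of_forall fun p => ?_)
    have : (𝐞 (-⟪p, w.2⟫_ℝ) • partialFourierDeriv f (w.1, p)) (v, 0) =
      𝐞 (-⟪p, w.2⟫_ℝ) • partialFourierDeriv f (w.1, p) (v, 0) := rfl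
    beta_reduce
    rw [this, partialFourierDeriv_apply]
    simp [slice_apply, lineDerivOp_apply_eq_fderiv]
  · obtain ⟨C, hC⟩ := exists_norm_fibre_le (partialFourierDeriv f)
      (volume : Measure (Space d)).integrablePower
    refine ((Measure.integrable_pow_neg_integrablePower (volume : Measure (Space d))).const_mul
      C).mono' (continuous_fourierChar_smul_fibre (G := Space d × Space d →L[ℝ] ℂ)
        (partialFourierDeriv f) w).aestronglyMeasurable (.of_forall fun p => ?_)
    exact (Circle.norm_smul (E := Space d × Space d →L[ℝ] ℂ) _ _).trans_le (hC _ _)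

theorem hasTemperateGrowth_inner_snd (v : Space d) :
    (fun w : Space d × Space d => (⟪w.2, v⟫_ℝ : ℂ)).HasTemperateGrowth :=
  (Complex.ofRealCLM.comp (((innerSL ℝ).flip v).comp
    (ContinuousLinearMap.snd ℝ (Space d) (Space d)))).hasTemperateGrowth

theorem fourierK_lineDeriv_snd (v : Space d) (f : PhaseFun d) :
    fourierK (∂_{((0, v) : Space d × Space d)} f) =
      (2 * Real.pi * Complex.I) • mulOp (fun w => (⟪w.2, v⟫_ℝ : ℂ)) (fourierK f) := by
  refine phaseFun_ext_slice fun x => ?_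
  have h1 : slice x (∂_{((0, v) : Space d × Space d)} f) = ∂_{v} (slice x f) := by
    ext p
    have h : (slice x f : Space d → ℂ) = f ∘ fun p => (x, p) := rfl
    have h2 : HasFDerivAt (fun p : Space d => (x, p)) (ContinuousLinearMap.inr ℝ (Space d) (Space d)) p := by
      exact hasFDerivAt_prodMk_right x p
    rw [slice_apply, lineDerivOp_apply_eq_fderiv, lineDerivOp_apply_eq_fderiv, h,
      (HasFDerivAt.comp p (f.hasFDerivAt (x, p)) h2).fderiv]
    simp
  rw [slice_fourierK, h1, fourier_lineDerivOp_eq]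
  ext p
  have hg : (fun p : Space d => ⟪p, v⟫_ℝ).HasTemperateGrowth := by fun_prop
  rw [slice_apply, _root_.smul_apply, _root_.smul_apply, mulOp_apply (hasTemperateGrowth_inner_snd v),
    smulLeftCLM_apply_apply hg, ← slice_fourierK, slice_apply]
  simp

theorem fourierK_mulOp_fst {a : Space d → ℂ} (ha : (fun w : Space d × Space d => a w.1).HasTemperateGrowth)
    (f : PhaseFun d) : fourierK (mulOp (fun w => a w.1) f) = mulOp (fun w => a w.1) (fourierK f) := by
  refine phaseFun_ext_slice fun x => ?_
  have h : ∀ g : PhaseFun d, slice x (mulOp (fun w => a w.1) g) = a x • slice x g := by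
    intro g; ext p; rw [slice_apply, mulOp_apply ha]; rfl
  rw [slice_fourierK, h, h, FourierTransform.fourier_smul, slice_fourierK]

theorem fourierKInv_apply (f : PhaseFun d) (x k : Space d) :
    fourierKInv f (x, k) = ∫ p, 𝐞 ⟪p, k⟫_ℝ • f (x, p) := by
  rw [← slice_apply, slice_fourierKInv, fourierInv_coe, Real.fourierInv_eq]
  rfl

theorem fourierK_apply (f : PhaseFun d) (x y : Space d) :
    fourierK f (x, y) = ∫ p, 𝐞 (-⟪p, y⟫_ℝ) • f (x, p) := by
  rw [← slice_apply, slice_fourierK, fourier_coe, Real.fourier_eq]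
  rfl

/-! ### The Wigner operator through its symbol -/

/-- The `j`-th position direction in phase space. -/
def posDir (j : Fin d) : Space d × Space d := (EuclideanSpace.single j 1, 0)

/-- The `j`-th momentum direction in phase space. -/
def momDir (j : Fin d) : Space d × Space d := (0, EuclideanSpace.single j 1)

/-- The symbol of the Wigner operator of the potential `W` on the side of the momentum Fourier
transform. -/
def wignerSymbol (W : Space d → ℂ) (ε : ℝ) (w : Space d × Space d) : ℂ :=
  (W (w.1 + (ε / 2) • ((2 * Real.pi) • w.2)) - W (w.1 - (ε / 2) • ((2 * Real.pi) • w.2))) / ε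

theorem _root_.Function.HasTemperateGrowth.wignerSymbol {W : Space d → ℂ}
    (hW : W.HasTemperateGrowth) (ε : ℝ) : (wignerSymbol W ε).HasTemperateGrowth := by
  let A : ℝ → (Space d × Space d) →L[ℝ] Space d := fun c =>
    ContinuousLinearMap.fst ℝ (Space d) (Space d) + c • ContinuousLinearMap.snd ℝ (Space d) (Space d)
  have h : ∀ c, (fun w => W (A c w)).HasTemperateGrowth := fun c =>
    hW.comp (A c).hasTemperateGrowth
  have h2 := ((h (ε / 2 * (2 * Real.pi))).sub (h (-(ε / 2 * (2 * Real.pi))))).mul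
    (Function.HasTemperateGrowth.const (E := Space d × Space d) ((ε : ℂ)⁻¹))
  refine (congrArg Function.HasTemperateGrowth (funext fun w => ?_)).mpr h2
  simp [WignerLiouville.wignerSymbol, A, smul_smul, div_eq_mul_inv, sub_eq_add_neg]

theorem fderiv_wignerSymbol {W : Space d → ℂ} (hW : Differentiable ℝ W) (ε : ℝ) (v : Space d)
    (w : Space d × Space d) :
    fderiv ℝ (wignerSymbol W ε) w (v, 0) = wignerSymbol (fun x => fderiv ℝ W x v) ε w := by
  let A : ℝ → (Space d × Space d) →L[ℝ] Space d := fun c =>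
    ContinuousLinearMap.fst ℝ (Space d) (Space d) + c • ContinuousLinearMap.snd ℝ (Space d) (Space d)
  have h : ∀ c, HasFDerivAt (fun w => W (A c w)) ((fderiv ℝ W (A c w)).comp (A c)) w := fun c =>
    HasFDerivAt.comp w (hW _).hasFDerivAt (A c).hasFDerivAt
  have h2 := ((h (ε / 2 * (2 * Real.pi))).sub (h (-(ε / 2 * (2 * Real.pi))))).mul_const ((ε : ℂ)⁻¹)
  have h3 : wignerSymbol W ε = fun w => (W (A (ε / 2 * (2 * Real.pi)) w) -
      W (A (-(ε / 2 * (2 * Real.pi))) w)) * (ε : ℂ)⁻¹ := by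
    ext w
    simp [WignerLiouville.wignerSymbol, A, smul_smul, div_eq_mul_inv, sub_eq_add_neg]
  rw [h3]
  erw [h2.fderiv]
  simp only [WignerLiouville.wignerSymbol, A, smul_smul, div_eq_mul_inv, sub_eq_add_neg]
  simp
  ring

/-- The Wigner operator of a potential `W` of temperate growth, as an operator on Schwartz
functions. -/
def wignerCLM (W : Space d → ℂ) (ε : ℝ) : PhaseFun d →L[ℂ] PhaseFun d :=
  Complex.I • fourierKInv.comp ((mulOp (wignerSymbol W ε)).comp fourierK)

theorem wignerCLM_apply (W : Space d → ℂ) (ε : ℝ) (f : PhaseFun d) :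
    wignerCLM W ε f = Complex.I • fourierKInv (mulOp (wignerSymbol W ε) (fourierK f)) := rfl

theorem fourierK_wignerCLM {W : Space d → ℂ} (ε : ℝ)
    (f : PhaseFun d) :
    fourierK (wignerCLM W ε f) = Complex.I • mulOp (wignerSymbol W ε) (fourierK f) := by
  rw [wignerCLM_apply, map_smul, fourierK_fourierKInv]

theorem fourierK_injective : Function.Injective (fourierK : PhaseFun d → PhaseFun d) :=
  Function.LeftInverse.injective fourierKInv_fourierK

/-- Position derivatives commute with the momentum Fourier transform, so this is the Leibniz rule
for the symbol: differentiating the symbol of `W` in `x` gives the symbol of the derivative of `W`.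
-/
theorem lineDeriv_fst_wignerCLM {W : Space d → ℂ} (hW : W.HasTemperateGrowth) (ε : ℝ) (v : Space d)
    (hW' : (fun x => fderiv ℝ W x v).HasTemperateGrowth) (f : PhaseFun d) :
    ∂_{((v, 0) : Space d × Space d)} (wignerCLM W ε f) =
      wignerCLM W ε (∂_{((v, 0) : Space d × Space d)} f) +
        wignerCLM (fun x => fderiv ℝ W x v) ε f := by
  apply fourierK_injective
  rw [map_add, ← lineDeriv_fst_fourierK, fourierK_wignerCLM, fourierK_wignerCLM,
    fourierK_wignerCLM, LineDeriv.lineDerivOp_smul, lineDeriv_mulOp (hW.wignerSymbol ε)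
      (hW'.wignerSymbol ε) _ (fderiv_wignerSymbol (hW.1.differentiable (by simp)) ε v),
    smul_add, lineDeriv_fst_fourierK]

/-- On the Fourier side a momentum derivative is a multiplication, and multiplications commute. -/
theorem lineDeriv_snd_wignerCLM {W : Space d → ℂ} (hW : W.HasTemperateGrowth) (ε : ℝ) (v : Space d)
    (f : PhaseFun d) :
    ∂_{((0, v) : Space d × Space d)} (wignerCLM W ε f) =
      wignerCLM W ε (∂_{((0, v) : Space d × Space d)} f) := by
  apply fourierK_injective
  have h := hasTemperateGrowth_inner_snd (d := d) v
  rw [fourierK_lineDeriv_snd, fourierK_wignerCLM, fourierK_wignerCLM, fourierK_lineDeriv_snd]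
  ext w
  simp only [_root_.smul_apply, map_smul, mulOp_apply h, mulOp_apply (hW.wignerSymbol ε), smul_eq_mul]
  ring

theorem _root_.Function.HasTemperateGrowth.conj {W : Space d → ℂ} (hW : W.HasTemperateGrowth) :
    (fun x => (starRingEnd ℂ) (W x)).HasTemperateGrowth :=
  Function.HasTemperateGrowth.comp
    (Complex.conjCLE.toContinuousLinearMap.hasTemperateGrowth (E := ℂ) (F := ℂ)) hW

/-- By Plancherel only the multiplier `i σ_W` matters; conjugating the potential conjugates its
symbol `σ_W`, and the factor `i` supplies the sign. -/
theorem l2inner_wignerCLM_right {W : Space d → ℂ} (hW : W.HasTemperateGrowth) (ε : ℝ)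
    (f g : PhaseFun d) :
    l2inner g (wignerCLM W ε f) = -l2inner (wignerCLM (fun x => (starRingEnd ℂ) (W x)) ε g) f := by
  rw [← l2inner_fourierK, ← l2inner_fourierK (wignerCLM _ _ _), fourierK_wignerCLM,
    fourierK_wignerCLM, l2inner_eq, l2inner_eq, ← integral_neg]
  refine integral_congr_ae (.of_forall fun w => ?_)
  simp only [_root_.smul_apply, mulOp_apply (hW.wignerSymbol ε), mulOp_apply (hW.conj.wignerSymbol ε),
    smul_eq_mul, map_mul, Complex.conj_I]
  have : (starRingEnd ℂ) (wignerSymbol (fun x => (starRingEnd ℂ) (W x)) ε w) = wignerSymbol W ε w := by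
    simp [wignerSymbol]
  rw [this]; ring

theorem re_l2inner_wignerCLM_self {V : Space d → ℝ} (hV : (fun x => (V x : ℂ)).HasTemperateGrowth)
    (ε : ℝ) (f : PhaseFun d) : (l2inner f (wignerCLM (fun x => (V x : ℂ)) ε f)).re = 0 := by
  have h := l2inner_wignerCLM_right hV ε f f
  simp only [Complex.conj_ofReal] at h
  have h2 : l2inner (wignerCLM (fun x => (V x : ℂ)) ε f) f =
      (starRingEnd ℂ) (l2inner f (wignerCLM (fun x => (V x : ℂ)) ε f)) :=
    (inner_conj_symm _ _).symm
  rw [h2] at h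
  have := congrArg Complex.re h
  simp at this
  linarith

/-- Mean value inequality between the points `x ± (ε/2) y` with `y = 2π w.2`: their distance `ε ‖y‖`
cancels the division by `ε`, so the bound does not depend on `ε`. -/
theorem norm_wignerSymbol_le {W : Space d → ℂ} (hW : Differentiable ℝ W) {C : ℝ}
    (hC : ∀ x, ‖fderiv ℝ W x‖ ≤ C) {ε : ℝ} (hε : 0 < ε) (w : Space d × Space d) :
    ‖wignerSymbol W ε w‖ ≤ C * ‖(2 * Real.pi) • w.2‖ := by
  have h := convex_univ.norm_image_sub_le_of_norm_fderiv_le (𝕜 := ℝ) (f := W) (C := C)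
    (fun x _ => hW x) (fun x _ => hC x) (Set.mem_univ (w.1 - (ε / 2) • ((2 * Real.pi) • w.2)))
    (Set.mem_univ (w.1 + (ε / 2) • ((2 * Real.pi) • w.2)))
  rw [wignerSymbol, norm_div, Complex.norm_real, Real.norm_of_nonneg hε.le, div_le_iff₀ hε]
  refine h.trans_eq ?_
  have : w.1 + (ε / 2) • ((2 * Real.pi) • w.2) - (w.1 - (ε / 2) • ((2 * Real.pi) • w.2)) =
      ε • ((2 * Real.pi) • w.2) := by module
  rw [this, norm_smul, Real.norm_of_nonneg hε.le]; ring

/-- On the ball of radius `‖h‖`, `h = (ε/2) y`, the derivative of `W` stays within `C ‖h‖` of its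
value at the centre. The mean value inequality over the segment of length `ε ‖y‖` then gives the
bound, even with an extra factor `1/2` that is discarded. -/
theorem norm_wignerSymbol_sub_le {W : Space d → ℂ} (hW : Differentiable ℝ W) {C : ℝ} (hC0 : 0 ≤ C)
    (hC : ∀ x y, ‖fderiv ℝ W x - fderiv ℝ W y‖ ≤ C * ‖x - y‖) {ε : ℝ} (hε : 0 < ε)
    (w : Space d × Space d) :
    ‖wignerSymbol W ε w - fderiv ℝ W w.1 ((2 * Real.pi) • w.2)‖ ≤
      C * ε * ‖(2 * Real.pi) • w.2‖ ^ 2 := by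
  set y := (2 * Real.pi) • w.2 with hy
  set h := (ε / 2) • y with hh
  have hb : ∀ z ∈ Metric.closedBall w.1 ‖h‖, ‖fderiv ℝ W z - fderiv ℝ W w.1‖ ≤ C * ‖h‖ :=
    fun z hz => (hC z w.1).trans (by
      rw [Metric.mem_closedBall, dist_eq_norm] at hz; gcongr)
  have key := (convex_closedBall w.1 ‖h‖).norm_image_sub_le_of_norm_fderiv_le' (𝕜 := ℝ)
    (fun x _ => hW x) hb (x := w.1 - h) (y := w.1 + h) (by simp) (by simp)
  have h1 : w.1 + h - (w.1 - h) = ε • y := by rw [hh]; module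
  rw [h1, map_smul] at key
  have h2 : wignerSymbol W ε w - fderiv ℝ W w.1 y =
      (W (w.1 + h) - W (w.1 - h) - ε • fderiv ℝ W w.1 y) / ε := by
    have : (ε : ℂ) ≠ 0 := by exact_mod_cast hε.ne'
    rw [wignerSymbol, ← hy, ← hh]
    field_simp
    simp
  rw [h2, norm_div, Complex.norm_real, Real.norm_of_nonneg hε.le, div_le_iff₀ hε]
  refine key.trans ?_
  rw [hh, norm_smul (ε / 2) y, norm_smul ε y, Real.norm_of_nonneg hε.le,
    Real.norm_of_nonneg (by positivity : 0 ≤ ε / 2)]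
  have : 0 ≤ C * (ε ^ 2 * ‖y‖ ^ 2) := by positivity
  nlinarith

theorem norm_le_sum_coord (y : Space d) : ‖y‖ ≤ ∑ j, |y j| := by
  have h : y = ∑ j, y j • EuclideanSpace.single j (1 : ℝ) := by
    ext i
    simp [Finset.sum_apply, Pi.single_apply]
  calc ‖y‖ = ‖∑ j, y j • EuclideanSpace.single j (1 : ℝ)‖ := by rw [← h]
    _ ≤ ∑ j, ‖y j • EuclideanSpace.single j (1 : ℝ)‖ := norm_sum_le _ _
    _ = ∑ j, |y j| := by simp [norm_smul]

theorem norm_fourierK_momDir (j : Fin d) (f : PhaseFun d) (w : Space d × Space d) :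
    ‖fourierK (∂_{momDir j} f) w‖ = |2 * Real.pi * w.2 j| * ‖fourierK f w‖ := by
  rw [momDir, fourierK_lineDeriv_snd, _root_.smul_apply, mulOp_apply (hasTemperateGrowth_inner_snd _)]
  simp [abs_mul, abs_of_pos Real.pi_pos, EuclideanSpace.inner_single_right]
  ring

/-- The symbol is at most `C |2πη| ≤ C ∑ⱼ |2πηⱼ|`, and `2πηⱼ` is, up to `i`, the Fourier multiplier
of `∂_{kⱼ}`. -/
theorem l2norm_wignerCLM_le {W : Space d → ℂ} (hW : W.HasTemperateGrowth) {C : ℝ}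
    (hC : ∀ x, ‖fderiv ℝ W x‖ ≤ C) {ε : ℝ} (hε : 0 < ε) (f : PhaseFun d) :
    l2norm (wignerCLM W ε f) ≤ C * ∑ j : Fin d, l2norm (∂_{momDir j} f) := by
  have hC0 : 0 ≤ C := (norm_nonneg _).trans (hC 0)
  rw [← l2norm_fourierK, fourierK_wignerCLM]
  have h := l2norm_le_sum Finset.univ (Complex.I • mulOp (wignerSymbol W ε) (fourierK f))
    (fun j => fourierK (∂_{momDir j} f)) C hC0 fun w => by
      rw [_root_.smul_apply, mulOp_apply (hW.wignerSymbol ε)]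
      rw [Finset.sum_congr rfl fun j _ => norm_fourierK_momDir j f w]
      simp only [smul_eq_mul, norm_mul, Complex.norm_I, one_mul]
      rw [← Finset.sum_mul, ← mul_assoc]
      gcongr
      refine (norm_wignerSymbol_le (hW.1.differentiable (by simp)) hC hε w).trans ?_
      gcongr
      exact (norm_le_sum_coord _).trans_eq (by simp)
  simpa only [l2norm_fourierK] using h

/-! ### The classical limit of the Wigner operator -/

/-- The transport operator `∇W · ∇ₖ`, the classical limit of the Wigner operator. -/
def forceCLM (W : Space d → ℂ) : PhaseFun d →L[ℂ] PhaseFun d :=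
  ∑ j, (mulOp fun w => fderiv ℝ W w.1 (EuclideanSpace.single j 1)).comp
    (LineDeriv.lineDerivOpCLM ℂ (PhaseFun d) (momDir j))

theorem forceCLM_apply (W : Space d → ℂ) (f : PhaseFun d) :
    forceCLM W f = ∑ j, mulOp (fun w => fderiv ℝ W w.1 (EuclideanSpace.single j 1))
      (∂_{momDir j} f) := by
  simp [forceCLM]

theorem hasTemperateGrowth_comp_fst {a : Space d → ℂ} (ha : a.HasTemperateGrowth) :
    (fun w : Space d × Space d => a w.1).HasTemperateGrowth :=
  ha.comp (ContinuousLinearMap.fst ℝ (Space d) (Space d)).hasTemperateGrowth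

theorem fourierK_forceCLM_apply {W : Space d → ℂ}
    (hW' : ∀ v, (fun x => fderiv ℝ W x v).HasTemperateGrowth) (f : PhaseFun d)
    (w : Space d × Space d) :
    fourierK (forceCLM W f) w =
      Complex.I * fderiv ℝ W w.1 ((2 * Real.pi) • w.2) * fourierK f w := by
  have h : (2 * Real.pi) • w.2 =
      ∑ j, (2 * Real.pi * w.2 j) • EuclideanSpace.single j (1 : ℝ) := by
    ext i
    simp [Finset.sum_apply, Pi.single_apply]
  rw [forceCLM_apply, map_sum, _root_.sum_apply, h, map_sum, Finset.mul_sum, Finset.sum_mul]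
  refine Finset.sum_congr rfl fun j _ => ?_
  have h1 := hasTemperateGrowth_comp_fst (hW' (EuclideanSpace.single j 1))
  rw [fourierK_mulOp_fst (a := fun x => fderiv ℝ W x (EuclideanSpace.single j 1)) h1, mulOp_apply h1, momDir, fourierK_lineDeriv_snd, _root_.smul_apply,
    mulOp_apply (hasTemperateGrowth_inner_snd _)]
  simp [EuclideanSpace.inner_single_right]
  ring

/-- The difference of symbols is at most `C ε |2πη|²`, and `|2πη|² = ∑ⱼ (2πηⱼ)²` is a sum of
multipliers of second momentum derivatives up to sign. -/
theorem l2norm_wignerCLM_sub_forceCLM_le {W : Space d → ℂ} (hW : W.HasTemperateGrowth)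
    (hW' : ∀ v, (fun x => fderiv ℝ W x v).HasTemperateGrowth) {C : ℝ} (hC0 : 0 ≤ C)
    (hC : ∀ x y, ‖fderiv ℝ W x - fderiv ℝ W y‖ ≤ C * ‖x - y‖) {ε : ℝ} (hε : 0 < ε)
    (f : PhaseFun d) :
    l2norm (wignerCLM W ε f - forceCLM W f) ≤
      C * ε * ∑ j : Fin d, l2norm (∂_{momDir j} (∂_{momDir j} f)) := by
  rw [← l2norm_fourierK, map_sub, fourierK_wignerCLM]
  have h := l2norm_le_sum Finset.univ
    (Complex.I • mulOp (wignerSymbol W ε) (fourierK f) - fourierK (forceCLM W f))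
    (fun j => fourierK (∂_{momDir j} (∂_{momDir j} f))) (C * ε) (by positivity) fun w => by
      rw [_root_.sub_apply, _root_.smul_apply, mulOp_apply (hW.wignerSymbol ε),
        fourierK_forceCLM_apply hW']
      rw [Finset.sum_congr rfl fun j _ => (norm_fourierK_momDir j (∂_{momDir j} f) w).trans
        (congrArg _ (norm_fourierK_momDir j f w))]
      simp only [smul_eq_mul]
      have h1 : Complex.I * (wignerSymbol W ε w * fourierK f w) -
          Complex.I * fderiv ℝ W w.1 ((2 * Real.pi) • w.2) * fourierK f w =
          Complex.I * (wignerSymbol W ε w - fderiv ℝ W w.1 ((2 * Real.pi) • w.2)) *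
            fourierK f w := by ring
      rw [h1]
      simp only [← mul_assoc, abs_mul_abs_self]
      rw [ norm_mul, norm_mul, Complex.norm_I, one_mul, ← Finset.sum_mul, ← mul_assoc]
      gcongr
      refine (norm_wignerSymbol_sub_le (hW.1.differentiable (by simp)) hC0 hC hε w).trans_eq ?_
      rw [EuclideanSpace.norm_sq_eq]
      congr 1
      refine Finset.sum_congr rfl fun j _ => ?_
      rw [Real.norm_eq_abs, sq_abs, PiLp.smul_apply, smul_eq_mul]
      ring
  simpa only [l2norm_fourierK] using h

/-- The substitution `y = 2πη` passes to the normalisation `e^{2πi⟨·,·⟩}` of the Fourier transform;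
its Jacobian cancels the prefactor `(2π)⁻ᵈ`. -/
theorem wignerOp_eq_wignerCLM (V : Space d → ℝ) (hV : (fun x => (V x : ℂ)).HasTemperateGrowth)
    (ε : ℝ) (f : PhaseFun d) (x k : Space d) :
    wignerOp V ε f x k = wignerCLM (fun x => (V x : ℂ)) ε f (x, k) := by
  have hpi : (0 : ℝ) < 2 * Real.pi := by positivity
  have h1 := Measure.integral_comp_smul (volume : Measure (Space d))
    (fun y : Space d => (potentialDiff V ε x y : ℂ) *
      ∫ p : Space d, f (x, p) * Complex.exp (Complex.I * (⟪y, k - p⟫_ℝ : ℂ))) (2 * Real.pi)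
  rw [finrank_euclideanSpace, Fintype.card_fin, abs_of_pos (by positivity)] at h1
  have h2 : ∫ y : Space d, (potentialDiff V ε x y : ℂ) *
      ∫ p : Space d, f (x, p) * Complex.exp (Complex.I * (⟪y, k - p⟫_ℝ : ℂ)) =
      (2 * (Real.pi : ℂ)) ^ d * ∫ y : Space d, (potentialDiff V ε x ((2 * Real.pi) • y) : ℂ) *
      ∫ p : Space d, f (x, p) * Complex.exp (Complex.I * (⟪(2 * Real.pi) • y, k - p⟫_ℝ : ℂ)) := by
    rw [h1, Complex.real_smul, ← mul_assoc]
    have : (2 * (Real.pi : ℂ)) ^ d ≠ 0 := by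
      simp [Real.pi_ne_zero]
    push_cast
    rw [mul_inv_cancel₀ this, one_mul]
  have hne : (2 * (Real.pi : ℂ)) ^ d ≠ 0 := by simp [Real.pi_ne_zero]
  rw [wignerOp, h2, ← mul_assoc, div_mul_cancel₀ _ hne, wignerCLM_apply, _root_.smul_apply,
    fourierKInv_apply, smul_eq_mul]
  congr 1
  refine integral_congr_ae (.of_forall fun y => ?_)
  beta_reduce
  rw [mulOp_apply (hV.wignerSymbol ε), fourierK_apply, ← integral_const_mul, Circle.smul_def,
    smul_eq_mul, ← integral_const_mul, ← integral_const_mul]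
  refine integral_congr_ae (.of_forall fun p => ?_)
  have h3 : wignerSymbol (fun x => (V x : ℂ)) ε (x, y) =
      (potentialDiff V ε x ((2 * Real.pi) • y) : ℂ) := by
    simp [wignerSymbol, potentialDiff]
  have h4 : Complex.exp (Complex.I * (⟪(2 * Real.pi) • y, k - p⟫_ℝ : ℂ)) =
      (𝐞 ⟪y, k⟫_ℝ : ℂ) * (𝐞 (-⟪p, y⟫_ℝ) : ℂ) := by
    rw [Real.fourierChar_apply, Real.fourierChar_apply, ← Complex.exp_add]
    congr 1
    rw [real_inner_smul_left, inner_sub_right, real_inner_comm p y]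
    push_cast; ring
  beta_reduce
  rw [h3, h4, Circle.smul_def, smul_eq_mul]
  ring

/-! ### Integration by parts and free transport -/

theorem lineDeriv_comm (u v : Space d × Space d) (f : PhaseFun d) :
    ∂_{u} (∂_{v} f) = ∂_{v} (∂_{u} f) := by
  ext w
  have h : ∀ a b : Space d × Space d, ∂_{a} (∂_{b} f) w = fderiv ℝ (fderiv ℝ f) w a b := by
    intro a b
    have h1 : ((∂_{b} f : PhaseFun d) : Space d × Space d → ℂ) = fun w => fderiv ℝ f w b := rfl
    have h2 : DifferentiableAt ℝ (fderiv ℝ f) w :=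
      ((contDiff_infty_iff_fderiv.1 (f.smooth ⊤)).2.differentiable (by simp)) w
    rw [lineDerivOp_apply_eq_fderiv, h1, fderiv_clm_apply h2 (differentiableAt_const b)]
    simp
  rw [h, h]
  have hs : IsSymmSndFDerivAt ℝ f w :=
    (f.contDiffAt 2).isSymmSndFDerivAt (by simp)
  exact hs u v

theorem l2inner_lineDeriv_right (v : Space d × Space d) (f g : PhaseFun d) :
    l2inner f (∂_{v} g) = -l2inner (∂_{v} f) g := by
  rw [l2inner_eq, l2inner_eq]
  exact integral_bilinear_lineDerivOp_right_eq_neg_left f g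
    ((ContinuousLinearMap.mul ℝ ℂ).comp Complex.conjCLE.toContinuousLinearMap) v

theorem l2inner_mulOp_right {a : Space d × Space d → ℂ} (ha : a.HasTemperateGrowth)
    (hr : ∀ w, (starRingEnd ℂ) (a w) = a w) (f g : PhaseFun d) :
    l2inner f (mulOp a g) = l2inner (mulOp a f) g := by
  rw [l2inner_eq, l2inner_eq]
  refine integral_congr_ae (.of_forall fun w => ?_)
  simp only [mulOp_apply ha, map_mul, hr]
  ring

theorem l2inner_conj_symm (f g : PhaseFun d) : (starRingEnd ℂ) (l2inner g f) = l2inner f g :=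
  inner_conj_symm _ _

theorem hasTemperateGrowth_momCoord (j : Fin d) :
    (fun w : Space d × Space d => (w.2 j : ℂ)).HasTemperateGrowth :=
  (Complex.ofRealCLM.comp ((EuclideanSpace.proj j).comp
    (ContinuousLinearMap.snd ℝ (Space d) (Space d)))).hasTemperateGrowth

/-- The free transport operator `k · ∇ₓ`. -/
def transportCLM : PhaseFun d →L[ℂ] PhaseFun d :=
  ∑ j, (mulOp fun w => (w.2 j : ℂ)).comp (LineDeriv.lineDerivOpCLM ℂ (PhaseFun d) (posDir j))

theorem transportCLM_eq (f : PhaseFun d) :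
    transportCLM f = ∑ j, mulOp (fun w => (w.2 j : ℂ)) (∂_{posDir j} f) := by
  simp [transportCLM]

theorem sum_smul_single (y : Space d) : ∑ j, y j • EuclideanSpace.single j (1 : ℝ) = y := by
  ext i
  simp [Finset.sum_apply, Pi.single_apply]

theorem transportCLM_apply (f : PhaseFun d) (x k : Space d) :
    transportCLM f (x, k) = fderiv ℝ f (x, k) (k, 0) := by
  have h : ((k, 0) : Space d × Space d) = ∑ j, k j • posDir j := by
    refine Prod.ext ?_ ?_
    · simp only [posDir, Prod.fst_sum, Prod.smul_mk]
      exact (sum_smul_single k).symm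
    · simp [posDir, Prod.snd_sum]
  rw [transportCLM_eq, _root_.sum_apply, h, map_sum]
  refine Finset.sum_congr rfl fun j _ => ?_
  rw [mulOp_apply (hasTemperateGrowth_momCoord j), lineDerivOp_apply_eq_fderiv, map_smul,
    Complex.real_smul]

/-- The coefficient `kⱼ` is real and does not depend on `xⱼ`, so integration by parts identifies
each term with minus its conjugate. -/
theorem re_l2inner_transportCLM_self (f : PhaseFun d) : (l2inner f (transportCLM f)).re = 0 := by
  have h1 : ∀ j : Fin d, (l2inner f (mulOp (fun w => (w.2 j : ℂ)) (∂_{posDir j} f))).re = 0 := by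
    intro j
    have ht := hasTemperateGrowth_momCoord j
    have hz : ∀ w : Space d × Space d,
        fderiv ℝ (fun w : Space d × Space d => (w.2 j : ℂ)) w (posDir j) = (fun _ => 0) w := by
      intro w
      have : fderiv ℝ (fun w : Space d × Space d => (w.2 j : ℂ)) w =
        (Complex.ofRealCLM.comp ((EuclideanSpace.proj j).comp
          (ContinuousLinearMap.snd ℝ (Space d) (Space d)))) :=
        (Complex.ofRealCLM.comp ((EuclideanSpace.proj j).comp
          (ContinuousLinearMap.snd ℝ (Space d) (Space d)))).fderiv
      rw [this]; simp [posDir]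
    have h2 : ∂_{posDir j} (mulOp (fun w => (w.2 j : ℂ)) f) =
        mulOp (fun w => (w.2 j : ℂ)) (∂_{posDir j} f) := by
      rw [lineDeriv_mulOp ht (Function.HasTemperateGrowth.const 0) _ hz]
      ext w
      simp
    have h3 : l2inner f (mulOp (fun w => (w.2 j : ℂ)) (∂_{posDir j} f)) =
        -(starRingEnd ℂ) (l2inner f (mulOp (fun w => (w.2 j : ℂ)) (∂_{posDir j} f))) := by
      conv_lhs => rw [l2inner_mulOp_right ht (fun w => Complex.conj_ofReal _),
        l2inner_lineDeriv_right, h2, ← l2inner_conj_symm]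
    have := congrArg Complex.re h3
    simp at this
    linarith
  have h2 : l2inner f (transportCLM f) =
      ∑ j, l2inner f (mulOp (fun w => (w.2 j : ℂ)) (∂_{posDir j} f)) := by
    have h3 : ∀ g, l2inner f g = innerSL ℂ (f.toLp 2 volume) (toLpCLM ℂ ℂ 2 volume g) :=
      fun g => rfl
    rw [transportCLM_eq, h3, map_sum, map_sum]
    rfl
  rw [h2, Complex.re_sum]
  exact Finset.sum_eq_zero fun j _ => h1 j

theorem lineDeriv_mulOp_momCoord (v : Space d × Space d) (i : Fin d) (f : PhaseFun d) :
    ∂_{v} (mulOp (fun w => (w.2 i : ℂ)) f) =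
      mulOp (fun w => (w.2 i : ℂ)) (∂_{v} f) + (v.2 i : ℂ) • f := by
  have ht := hasTemperateGrowth_momCoord i
  have hz : ∀ w : Space d × Space d,
      fderiv ℝ (fun w : Space d × Space d => (w.2 i : ℂ)) w v = (fun _ => (v.2 i : ℂ)) w := by
    intro w
    have : fderiv ℝ (fun w : Space d × Space d => (w.2 i : ℂ)) w =
      (Complex.ofRealCLM.comp ((EuclideanSpace.proj i).comp
        (ContinuousLinearMap.snd ℝ (Space d) (Space d)))) :=
      (Complex.ofRealCLM.comp ((EuclideanSpace.proj i).comp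
        (ContinuousLinearMap.snd ℝ (Space d) (Space d)))).fderiv
    rw [this]; simp
  rw [lineDeriv_mulOp ht (Function.HasTemperateGrowth.const _) _ hz, mulOp, mulOp,
    smulLeftCLM_const]
  rfl

/-- The extra term comes from differentiating the coefficient `k`. Position derivatives thus commute
with transport, while `∂_{kⱼ}` produces `∂_{xⱼ}`, which has the same order. -/
theorem lineDeriv_transportCLM (v : Space d × Space d) (f : PhaseFun d) :
    ∂_{v} (transportCLM f) = transportCLM (∂_{v} f) + ∂_{((v.2, 0) : Space d × Space d)} f := by
  have h1 : ∀ g : PhaseFun d, ∂_{v} g = LineDeriv.lineDerivOpCLM ℂ (PhaseFun d) v g :=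
    fun g => rfl
  have h2 : (∑ i, (v.2 i : ℂ) • ∂_{posDir i} f) = ∂_{((v.2, 0) : Space d × Space d)} f := by
    ext w
    have h : ((v.2, 0) : Space d × Space d) = ∑ j, v.2 j • posDir j := by
      refine Prod.ext ?_ ?_
      · simp only [posDir, Prod.fst_sum, Prod.smul_mk]
        exact (sum_smul_single v.2).symm
      · simp [posDir, Prod.snd_sum]
    rw [lineDerivOp_apply_eq_fderiv, h, map_sum, _root_.sum_apply]
    simp [lineDerivOp_apply_eq_fderiv]
  rw [transportCLM_eq, h1, map_sum, transportCLM_eq, ← h2, ← Finset.sum_add_distrib]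
  refine Finset.sum_congr rfl fun i _ => ?_
  rw [← h1, lineDeriv_mulOp_momCoord, lineDeriv_comm]

/-! ### Potentials with bounded derivatives -/

/-- Smooth complex-valued functions all of whose derivatives are bounded. -/
structure IsBoundedSmooth (W : Space d → ℂ) : Prop where
  contDiff : ContDiff ℝ ∞ W
  bounded : ∀ n : ℕ, ∃ C : ℝ, ∀ x, ‖iteratedFDeriv ℝ n W x‖ ≤ C

namespace IsBoundedSmooth

variable {W : Space d → ℂ}

theorem hasTemperateGrowth (hW : IsBoundedSmooth W) : W.HasTemperateGrowth :=
  ⟨hW.contDiff, fun n => by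
    obtain ⟨C, hC⟩ := hW.bounded n
    exact ⟨0, C, fun x => by simpa using hC x⟩⟩

theorem fderiv_apply (hW : IsBoundedSmooth W) (v : Space d) :
    IsBoundedSmooth fun x => fderiv ℝ W x v := by
  have h := (contDiff_infty_iff_fderiv.1 hW.contDiff).2
  refine ⟨h.clm_apply contDiff_const, fun n => ?_⟩
  obtain ⟨C, hC⟩ := hW.bounded (n + 1)
  refine ⟨‖v‖ * C, fun x => ?_⟩
  refine (norm_iteratedFDeriv_clm_apply_const (n := n) (N := ∞) h.contDiffAt
    (mod_cast le_top)).trans ?_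
  rw [norm_iteratedFDeriv_fderiv]
  gcongr
  exact hC x

theorem exists_norm_fderiv_le (hW : IsBoundedSmooth W) : ∃ C, 0 ≤ C ∧ ∀ x, ‖fderiv ℝ W x‖ ≤ C := by
  obtain ⟨C, hC⟩ := hW.bounded 1
  have h : ∀ x, ‖fderiv ℝ W x‖ ≤ C := fun x => by
    rw [← norm_iteratedFDeriv_one]; exact hC x
  exact ⟨C, (norm_nonneg _).trans (h 0), h⟩

theorem exists_lipschitz_fderiv (hW : IsBoundedSmooth W) :
    ∃ C, 0 ≤ C ∧ ∀ x y, ‖fderiv ℝ W x - fderiv ℝ W y‖ ≤ C * ‖x - y‖ := by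
  obtain ⟨C, hC⟩ := hW.bounded 2
  have h := (contDiff_infty_iff_fderiv.1 hW.contDiff).2.differentiable (by simp)
  have hb : ∀ x, ‖fderiv ℝ (fderiv ℝ W) x‖ ≤ C := fun x => by
    rw [← norm_iteratedFDeriv_one, norm_iteratedFDeriv_fderiv]; exact hC x
  exact ⟨C, (ContinuousLinearMap.opNorm_nonneg _).trans (hb 0), fun x y =>
    convex_univ.norm_image_sub_le_of_norm_fderiv_le (𝕜 := ℝ) (fun x _ => h x) (fun x _ => hb x)
      (Set.mem_univ y) (Set.mem_univ x)⟩

end IsBoundedSmooth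

theorem IsAdmissiblePotential.isBoundedSmooth {V : Space d → ℝ} (hV : IsAdmissiblePotential V) :
    IsBoundedSmooth fun x => (V x : ℂ) := by
  refine ⟨Complex.ofRealCLM.contDiff.comp hV.1, fun n => ?_⟩
  obtain ⟨C, hC⟩ := hV.2 n
  refine ⟨C, fun x => ?_⟩
  have := Complex.ofRealLI.norm_iteratedFDeriv_comp_left (hV.1.contDiffAt (x := x)) (i := n)
    (mod_cast le_top)
  exact this.trans_le (hC x)

/-! ### Sobolev energies and the Wigner operator -/

/-- The coordinate directions of phase space. -/
def dir : Fin d ⊕ Fin d → Space d × Space d := Sum.elim posDir momDir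

/-- The sum of the squared `L²` norms of all iterated coordinate derivatives of order at
most `m`. -/
def energy : ℕ → PhaseFun d → ℝ
  | 0, f => l2norm f ^ 2
  | m + 1, f => l2norm f ^ 2 + ∑ a : Fin d ⊕ Fin d, energy m (∂_{dir a} f)

/-- The polar form of `energy`, i.e. the derivative of `energy m` at `f` in direction `g`. -/
def energyDot : ℕ → PhaseFun d → PhaseFun d → ℝ
  | 0, f, g => 2 * (l2inner f g).re
  | m + 1, f, g => 2 * (l2inner f g).re + ∑ a : Fin d ⊕ Fin d, energyDot m (∂_{dir a} f) (∂_{dir a} g)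

theorem energy_nonneg (m : ℕ) : ∀ f : PhaseFun d, 0 ≤ energy m f := by
  induction m with
  | zero => intro f; exact sq_nonneg _
  | succ m ih => intro f; exact add_nonneg (sq_nonneg _) (Finset.sum_nonneg fun a _ => ih _)

theorem l2norm_sq_le_energy (m : ℕ) (f : PhaseFun d) : l2norm f ^ 2 ≤ energy m f := by
  cases m with
  | zero => exact le_rfl
  | succ m => exact le_add_of_nonneg_right (Finset.sum_nonneg fun a _ => energy_nonneg _ _)

theorem energy_lineDeriv_le (m : ℕ) (a : Fin d ⊕ Fin d) (f : PhaseFun d) :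
    energy m (∂_{dir a} f) ≤ energy (m + 1) f := by
  have := Finset.single_le_sum (f := fun a => energy m (∂_{dir a} f))
    (fun a _ => energy_nonneg _ _) (Finset.mem_univ a)
  simp only [energy]
  linarith [sq_nonneg (l2norm f)]

theorem energy_le_succ (m : ℕ) : ∀ f : PhaseFun d, energy m f ≤ energy (m + 1) f := by
  induction m with
  | zero => intro f; exact l2norm_sq_le_energy 1 f
  | succ m ih =>
    intro f
    exact add_le_add le_rfl (Finset.sum_le_sum fun a _ => ih _)

theorem energy_add_le (m : ℕ) : ∀ f g : PhaseFun d,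
    energy m (f + g) ≤ 2 * energy m f + 2 * energy m g := by
  have h0 : ∀ f g : PhaseFun d, l2norm (f + g) ^ 2 ≤ 2 * l2norm f ^ 2 + 2 * l2norm g ^ 2 := by
    intro f g
    have h1 := l2norm_add_le f g
    have h2 := l2norm_nonneg (f + g)
    nlinarith [sq_nonneg (l2norm f - l2norm g)]
  induction m with
  | zero => exact h0
  | succ m ih =>
    intro f g
    have h1 : ∑ a : Fin d ⊕ Fin d, energy m (∂_{dir a} (f + g)) ≤
        ∑ a : Fin d ⊕ Fin d, (2 * energy m (∂_{dir a} f) + 2 * energy m (∂_{dir a} g)) :=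
      Finset.sum_le_sum fun a _ => by rw [LineDeriv.lineDerivOp_add]; exact ih _ _
    rw [Finset.sum_add_distrib, ← Finset.mul_sum, ← Finset.mul_sum] at h1
    simp only [energy]
    linarith [h0 f g]

theorem energy_neg (m : ℕ) : ∀ f : PhaseFun d, energy m (-f) = energy m f := by
  induction m with
  | zero => intro f; simp only [energy, l2norm_neg]
  | succ m ih =>
    intro f
    have h : ∀ v : Space d × Space d, ∂_{v} (-f) = -∂_{v} f := fun v =>
      map_neg (LineDeriv.lineDerivOpCLM ℂ (PhaseFun d) v) f
    simp only [energy, l2norm_neg, h, ih]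

theorem abs_energyDot_le (m : ℕ) : ∀ f g : PhaseFun d,
    |energyDot m f g| ≤ energy m f + energy m g := by
  have h0 : ∀ f g : PhaseFun d, |2 * (l2inner f g).re| ≤ l2norm f ^ 2 + l2norm g ^ 2 := by
    intro f g
    have h1 := (Complex.abs_re_le_norm (l2inner f g)).trans (norm_l2inner_le f g)
    rw [abs_mul, abs_two]
    nlinarith [sq_nonneg (l2norm f - l2norm g)]
  induction m with
  | zero => exact h0
  | succ m ih =>
    intro f g
    have h1 := (Finset.abs_sum_le_sum_abs (fun a : Fin d ⊕ Fin d =>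
      energyDot m (∂_{dir a} f) (∂_{dir a} g)) Finset.univ).trans (Finset.sum_le_sum fun a _ => ih (∂_{dir a} f) (∂_{dir a} g))
    rw [Finset.sum_add_distrib] at h1
    simp only [energy, energyDot]
    linarith [abs_add_le (2 * (l2inner f g).re)
      (∑ a : Fin d ⊕ Fin d, energyDot m (∂_{dir a} f) (∂_{dir a} g)), h0 f g]

theorem energyDot_add_right (m : ℕ) : ∀ f g h : PhaseFun d,
    energyDot m f (g + h) = energyDot m f g + energyDot m f h := by
  induction m with
  | zero => intro f g h; simp only [energyDot, l2inner_add_right, Complex.add_re]; ring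
  | succ m ih =>
    intro f g h
    simp only [energyDot, l2inner_add_right, Complex.add_re, LineDeriv.lineDerivOp_add, ih,
      Finset.sum_add_distrib]
    ring

theorem sum_l2norm_momDir_sq_le (f : PhaseFun d) :
    (∑ j : Fin d, l2norm (∂_{momDir j} f)) ^ 2 ≤ d * energy 1 f := by
  have h1 := sq_sum_le_card_mul_sum_sq (s := Finset.univ) (f := fun j : Fin d => l2norm (∂_{momDir j} f))
  have h2 : ∑ j : Fin d, l2norm (∂_{momDir j} f) ^ 2 ≤ energy 1 f := by
    simp only [energy, Fintype.sum_sum_type]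
    have h3 : 0 ≤ ∑ j : Fin d, l2norm (∂_{dir (Sum.inl j)} f) ^ 2 :=
      Finset.sum_nonneg fun _ _ => sq_nonneg _
    have h4 := sq_nonneg (l2norm f)
    have h5 : ∑ j : Fin d, l2norm (∂_{momDir j} f) ^ 2 = ∑ j : Fin d, l2norm (∂_{dir (Sum.inr j)} f) ^ 2 := rfl
    linarith
  simp only [Finset.card_univ, Fintype.card_fin] at h1
  exact h1.trans (by gcongr)

/-- One derivative is lost, uniformly in `ε`. The induction must run over all `W` together, because
differentiating in position replaces `W` by its partial derivatives. -/
theorem exists_energy_wignerCLM_le (m : ℕ) : ∀ {W : Space d → ℂ}, IsBoundedSmooth W →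
    ∃ C, 0 ≤ C ∧ ∀ ε, 0 < ε → ∀ f, energy m (wignerCLM W ε f) ≤ C * energy (m + 1) f := by
  have h0 : ∀ {W : Space d → ℂ}, IsBoundedSmooth W →
      ∃ C, 0 ≤ C ∧ ∀ ε, 0 < ε → ∀ f, l2norm (wignerCLM W ε f) ^ 2 ≤ C * energy 1 f := by
    intro W hW
    obtain ⟨C, hC0, hC⟩ := hW.exists_norm_fderiv_le
    refine ⟨C ^ 2 * d, by positivity, fun ε hε f => ?_⟩
    calc _ ≤ (C * ∑ j : Fin d, l2norm (∂_{momDir j} f)) ^ 2 := by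
          gcongr
          · exact l2norm_nonneg _
          · exact l2norm_wignerCLM_le hW.hasTemperateGrowth hC hε f
      _ = C ^ 2 * (∑ j : Fin d, l2norm (∂_{momDir j} f)) ^ 2 := mul_pow _ _ _
      _ ≤ C ^ 2 * (d * energy 1 f) := by gcongr; exact sum_l2norm_momDir_sq_le f
      _ = _ := by ring
  induction m with
  | zero => exact h0
  | succ m ih =>
    intro W hW
    obtain ⟨C₀, hC₀, h₀⟩ := h0 hW
    obtain ⟨C₁, hC₁, h₁⟩ := ih hW
    choose D hD0 hD using fun j : Fin d => ih (hW.fderiv_apply (EuclideanSpace.single j 1))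
    have hmono : ∀ f : PhaseFun d, energy 1 f ≤ energy (m + 1 + 1) f := fun f => by
      have : ∀ n, energy 1 f ≤ energy (n + 1) f := by
        intro n
        induction n with
        | zero => exact le_rfl
        | succ n ihn => exact ihn.trans (energy_le_succ _ _)
      exact this (m + 1)
    have hpos : ∀ ε, 0 < ε → ∀ f, ∀ j : Fin d, energy m (∂_{posDir j} (wignerCLM W ε f)) ≤
        (2 * C₁ + 2 * D j) * energy (m + 1 + 1) f := by
      intro ε hε f j
      rw [posDir, lineDeriv_fst_wignerCLM hW.hasTemperateGrowth ε _
        (hW.fderiv_apply _).hasTemperateGrowth]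
      have h2 := h₁ ε hε (∂_{posDir j} f)
      have h3 := energy_lineDeriv_le (m + 1) (Sum.inl j) f
      have h4 := hD j ε hε f
      have h5 := energy_le_succ (m + 1) f
      have h6 := energy_add_le m (wignerCLM W ε (∂_{posDir j} f))
        (wignerCLM (fun x => fderiv ℝ W x (EuclideanSpace.single j 1)) ε f)
      have h7 := mul_le_mul_of_nonneg_left h3 hC₁
      have h8 := mul_le_mul_of_nonneg_left h5 (hD0 j)
      have h9 : energy (m + 1) (∂_{dir (Sum.inl j)} f) = energy (m + 1) (∂_{posDir j} f) := rfl
      rw [h9] at h7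
      simp only [posDir] at *
      linarith
    have hmom : ∀ ε, 0 < ε → ∀ f, ∀ j : Fin d, energy m (∂_{momDir j} (wignerCLM W ε f)) ≤
        C₁ * energy (m + 1 + 1) f := by
      intro ε hε f j
      rw [momDir, lineDeriv_snd_wignerCLM hW.hasTemperateGrowth]
      exact (h₁ ε hε _).trans
        (mul_le_mul_of_nonneg_left (energy_lineDeriv_le (m + 1) (Sum.inr j) f) hC₁)
    refine ⟨C₀ + (∑ j : Fin d, (2 * C₁ + 2 * D j) + ∑ _j : Fin d, C₁), ?_, fun ε hε f => ?_⟩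
    · exact add_nonneg hC₀ (add_nonneg (Finset.sum_nonneg fun j _ => by linarith [hD0 j])
        (Finset.sum_nonneg fun _ _ => hC₁))
    · rw [energy, Fintype.sum_sum_type, add_mul, add_mul, Finset.sum_mul, Finset.sum_mul]
      gcongr with j _ j _
      · exact (h₀ ε hε f).trans (mul_le_mul_of_nonneg_left (hmono f) hC₀)
      · exact hpos ε hε f j
      · exact hmom ε hε f j

/-! ### Generators and the energy estimate -/

/-- The generator `-k · ∇ₓ + L_W^ε` of the Wigner evolution. -/
def wignerGen (W : Space d → ℂ) (ε : ℝ) : PhaseFun d →L[ℂ] PhaseFun d :=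
  -transportCLM + wignerCLM W ε

/-- The generator `-k · ∇ₓ + ∇W · ∇ₖ` of the Liouville evolution. -/
def liouvilleGen (W : Space d → ℂ) : PhaseFun d →L[ℂ] PhaseFun d :=
  -transportCLM + forceCLM W

theorem wignerGen_apply (W : Space d → ℂ) (ε : ℝ) (f : PhaseFun d) :
    wignerGen W ε f = -transportCLM f + wignerCLM W ε f := rfl

theorem liouvilleGen_apply (W : Space d → ℂ) (f : PhaseFun d) :
    liouvilleGen W f = -transportCLM f + forceCLM W f := rfl

theorem re_l2inner_wignerGen_self {V : Space d → ℝ} (hV : IsAdmissiblePotential V) (ε : ℝ)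
    (f : PhaseFun d) : (l2inner f (wignerGen (fun x => (V x : ℂ)) ε f)).re = 0 := by
  have h : l2inner f (-transportCLM f) = -l2inner f (transportCLM f) :=
    inner_neg_right _ ((transportCLM f).toLp 2 volume)
  rw [wignerGen_apply, l2inner_add_right, h, Complex.add_re, Complex.neg_re,
    re_l2inner_transportCLM_self, re_l2inner_wignerCLM_self hV.isBoundedSmooth.hasTemperateGrowth]
  simp

/-- No derivative is lost here. The undifferentiated pairing vanishes by skew-adjointness. After one
differentiation the induction hypothesis handles the generator acting on the derivative, and the
commutators `L^ε_{∂ⱼV} f` and `-∂_{xⱼ} f` have order-`m` energy controlled by `energy (m + 1) f`,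
with constants free of `ε`. -/
theorem exists_energyDot_wignerGen_le {V : Space d → ℝ} (hV : IsAdmissiblePotential V) (m : ℕ) :
    ∃ C, 0 ≤ C ∧ ∀ ε, 0 < ε → ∀ f,
      |energyDot m f (wignerGen (fun x => (V x : ℂ)) ε f)| ≤ C * energy m f := by
  have hW := hV.isBoundedSmooth
  set W : Space d → ℂ := fun x => (V x : ℂ) with hWdef
  induction m with
  | zero =>
    exact ⟨0, le_rfl, fun ε hε f => by
      simp [energyDot, re_l2inner_wignerGen_self hV ε f, hWdef]⟩
  | succ m ih =>
    obtain ⟨C, hC0, hC⟩ := ih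
    choose D hD0 hD using fun j : Fin d =>
      exists_energy_wignerCLM_le m (hW.fderiv_apply (EuclideanSpace.single j 1))
    have hneg : ∀ (v : Space d × Space d) (g : PhaseFun d), ∂_{v} (-g) = -∂_{v} g := fun v g =>
      map_neg (LineDeriv.lineDerivOpCLM ℂ (PhaseFun d) v) g
    have hpos : ∀ ε, 0 < ε → ∀ f, ∀ j : Fin d,
        |energyDot m (∂_{posDir j} f) (∂_{posDir j} (wignerGen W ε f))| ≤
          (C + 1 + D j) * energy (m + 1) f := by
      intro ε hε f j
      have hc : ∂_{posDir j} (wignerGen W ε f) = wignerGen W ε (∂_{posDir j} f) +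
          wignerCLM (fun x => fderiv ℝ W x (EuclideanSpace.single j 1)) ε f := by
        have hz : ∂_{(((posDir j).2, 0) : Space d × Space d)} f = 0 := by
          ext w
          exact (fderiv ℝ f w).map_zero
        rw [wignerGen_apply, LineDeriv.lineDerivOp_add, hneg, lineDeriv_transportCLM, hz, add_zero,
          wignerGen_apply, add_assoc, posDir, lineDeriv_fst_wignerCLM hW.hasTemperateGrowth ε _
            (hW.fderiv_apply _).hasTemperateGrowth]
      rw [hc, energyDot_add_right]
      have h1 := hC ε hε (∂_{posDir j} f)
      have h2 := abs_energyDot_le m (∂_{posDir j} f)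
        (wignerCLM (fun x => fderiv ℝ W x (EuclideanSpace.single j 1)) ε f)
      have h3 : energy m (∂_{posDir j} f) ≤ energy (m + 1) f := energy_lineDeriv_le m (Sum.inl j) f
      have h4 := hD j ε hε f
      have h5 := abs_add_le (energyDot m (∂_{posDir j} f) (wignerGen W ε (∂_{posDir j} f)))
        (energyDot m (∂_{posDir j} f)
          (wignerCLM (fun x => fderiv ℝ W x (EuclideanSpace.single j 1)) ε f))
      have h6 := mul_le_mul_of_nonneg_left h3 hC0
      linarith
    have hmom : ∀ ε, 0 < ε → ∀ f, ∀ j : Fin d,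
        |energyDot m (∂_{momDir j} f) (∂_{momDir j} (wignerGen W ε f))| ≤
          (C + 2) * energy (m + 1) f := by
      intro ε hε f j
      have hc : ∂_{momDir j} (wignerGen W ε f) = wignerGen W ε (∂_{momDir j} f) +
          -∂_{posDir j} f := by
        have hz : ((momDir j).2, 0) = posDir j := rfl
        rw [wignerGen_apply, LineDeriv.lineDerivOp_add, hneg, lineDeriv_transportCLM, hz,
          wignerGen_apply, momDir, lineDeriv_snd_wignerCLM hW.hasTemperateGrowth]
        abel
      rw [hc, energyDot_add_right]
      have h1 := hC ε hε (∂_{momDir j} f)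
      have h2 := abs_energyDot_le m (∂_{momDir j} f) (-∂_{posDir j} f)
      have h3 : energy m (∂_{momDir j} f) ≤ energy (m + 1) f := energy_lineDeriv_le m (Sum.inr j) f
      have h4 : energy m (∂_{posDir j} f) ≤ energy (m + 1) f := energy_lineDeriv_le m (Sum.inl j) f
      rw [energy_neg] at h2
      have h5 := abs_add_le (energyDot m (∂_{momDir j} f) (wignerGen W ε (∂_{momDir j} f)))
        (energyDot m (∂_{momDir j} f) (-∂_{posDir j} f))
      have h6 := mul_le_mul_of_nonneg_left h3 hC0
      linarith
    refine ⟨∑ j : Fin d, (C + 1 + D j) + ∑ _j : Fin d, (C + 2), ?_, fun ε hε f => ?_⟩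
    · exact add_nonneg (Finset.sum_nonneg fun j _ => by linarith [hD0 j])
        (Finset.sum_nonneg fun _ _ => by linarith)
    · rw [energyDot, re_l2inner_wignerGen_self hV ε f, mul_zero, zero_add]
      refine (Finset.abs_sum_le_sum_abs _ _).trans ?_
      rw [Fintype.sum_sum_type, add_mul, Finset.sum_mul, Finset.sum_mul]
      exact add_le_add (Finset.sum_le_sum fun j _ => hpos ε hε f j)
        (Finset.sum_le_sum fun j _ => hmom ε hε f j)

/-! ### Differentiable curves of Schwartz functions -/

theorem continuous_eval_curve {f : ℝ → PhaseFun d} (hf : Continuous f) :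
    Continuous fun q : ℝ × (Space d × Space d) => f q.1 q.2 := by
  have h1 : Continuous fun q : ℝ × (Space d × Space d) =>
      (toBoundedContinuousFunctionCLM ℂ (Space d × Space d) ℂ (f q.1)) q.2 := by
    have h2 : Continuous fun q : ℝ × (Space d × Space d) =>
        (toBoundedContinuousFunctionCLM ℂ (Space d × Space d) ℂ (f q.1), q.2) :=
      (((toBoundedContinuousFunctionCLM ℂ (Space d × Space d) ℂ).continuous.comp hf).comp
        continuous_fst).prodMk continuous_snd
    exact continuous_eval.comp h2
  exact h1

/-- The weighted supremum norms control the `L²` norm. -/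
theorem exists_l2norm_le_of_weighted_bound (d : ℕ) : ∃ N : ℕ, ∃ K : ℝ, 0 ≤ K ∧
    ∀ (h : PhaseFun d) (M : ℝ), (∀ w, (1 + ‖w‖) ^ N * ‖h w‖ ≤ M) → l2norm h ≤ K * M := by
  obtain ⟨N, hN⟩ : ∃ N : ℕ, (Module.finrank ℝ (Space d × Space d) : ℝ) < N := exists_nat_gt _
  have hint : Integrable (fun w : Space d × Space d => (1 + ‖w‖) ^ (-(N : ℝ))) :=
    integrable_one_add_norm hN
  refine ⟨N, √(∫ w : Space d × Space d, (1 + ‖w‖) ^ (-(N : ℝ))), Real.sqrt_nonneg _,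
    fun h M hM => ?_⟩
  have hM0 : 0 ≤ M := le_trans (by positivity) (hM 0)
  refine abs_le_of_sq_le_sq' ?_ (by positivity) |>.2
  rw [mul_pow, Real.sq_sqrt (integral_nonneg fun w => by positivity), l2norm_sq, l2inner_eq,
    mul_comm, ← integral_const_mul]
  have h1 : ∀ w, (starRingEnd ℂ) (h w) * h w = ((‖h w‖ ^ 2 : ℝ) : ℂ) := fun w => by
    rw [mul_comm, Complex.mul_conj, Complex.normSq_eq_norm_sq]
  simp_rw [h1, integral_complex_ofReal, Complex.ofReal_re]
  refine integral_mono_of_nonneg (.of_forall fun w => by positivity) (hint.const_mul _)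
    (.of_forall fun w => ?_)
  have hw : (1 : ℝ) ≤ 1 + ‖w‖ := le_add_of_nonneg_right (norm_nonneg _)
  have h2 : ‖h w‖ ≤ M / (1 + ‖w‖) ^ N := by
    rw [le_div_iff₀ (by positivity), mul_comm]; exact hM w
  calc ‖h w‖ ^ 2 ≤ (M / (1 + ‖w‖) ^ N) ^ 2 := by gcongr
    _ = M ^ 2 * (1 / (1 + ‖w‖) ^ N) * (1 / (1 + ‖w‖) ^ N) := by ring
    _ ≤ M ^ 2 * (1 / (1 + ‖w‖) ^ N) * 1 := by
        gcongr
        rw [div_le_one (by positivity)]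
        exact one_le_pow₀ hw
    _ = _ := by
        simp only [Real.rpow_neg (by positivity : (0 : ℝ) ≤ 1 + ‖w‖), Real.rpow_natCast]; ring

/-- A continuous curve of Schwartz functions which has, at every point of phase space, the
time derivative `G` on `[0, T]`. -/
structure IsCurve (T : ℝ) (f G : ℝ → PhaseFun d) : Prop where
  continuous : Continuous f
  continuous_deriv : Continuous G
  hasDeriv : ∀ t ∈ Set.Icc 0 T, ∀ w, HasDerivWithinAt (fun s => f s w) (G t w) (Set.Icc 0 T) t

namespace IsCurve

variable {T : ℝ} {f G f' G' : ℝ → PhaseFun d}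

theorem sub (h : IsCurve T f G) (h' : IsCurve T f' G') :
    IsCurve T (fun t => f t - f' t) (fun t => G t - G' t) :=
  ⟨h.continuous.sub h'.continuous, h.continuous_deriv.sub h'.continuous_deriv,
    fun t ht w => (h.hasDeriv t ht w).sub (h'.hasDeriv t ht w)⟩

/-- The equation is only pointwise in phase space, but `G` is continuous into the Schwartz space.
The mean value inequality at each point therefore bounds the remainder in a weighted supremum norm,
which dominates the `L²` norm. -/
theorem hasDerivWithinAt_toLp (h : IsCurve T f G) {t : ℝ} (ht : t ∈ Set.Icc 0 T) :
    HasDerivWithinAt (fun s => (f s).toLp 2 volume) ((G t).toLp 2 volume) (Set.Icc 0 T) t := by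
  obtain ⟨N, K, hK0, hK⟩ := exists_l2norm_le_of_weighted_bound d
  set P : Seminorm ℂ (PhaseFun d) :=
    (Finset.Iic ((N, 0) : ℕ × ℕ)).sup fun m => SchwartzMap.seminorm ℂ m.1 m.2 with hP
  have hPle : ∀ (g : PhaseFun d) w, (1 + ‖w‖) ^ N * ‖g w‖ ≤ 2 ^ N * P g := by
    intro g w
    have := one_add_le_sup_seminorm_apply (𝕜 := ℂ) (m := (N, 0)) le_rfl le_rfl g w
    simpa using this
  have hPc : Continuous P := by
    exact Seminorm.continuous_finsetSup fun m _ =>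
      (schwartz_withSeminorms ℂ (Space d × Space d) ℂ).continuous_seminorm m
  rw [hasDerivWithinAt_iff_isLittleO, Asymptotics.isLittleO_iff]
  intro c hc
  obtain ⟨η, hη0, hη⟩ : ∃ η > 0, K * (2 ^ N * η) ≤ c := by
    -- The denominator has `K + 1` instead of `K` because `K` may vanish.
    refine ⟨c / ((K + 1) * 2 ^ N), by positivity, ?_⟩
    rw [show K * (2 ^ N * (c / ((K + 1) * 2 ^ N))) = (K / (K + 1)) * c by field_simp]
    refine mul_le_of_le_one_left hc.le ?_
    rw [div_le_one (by positivity)]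
    linarith
  have hev : ∀ᶠ τ in 𝓝 t, P (G τ - G t) < η := by
    have h1 : Continuous fun τ => P (G τ - G t) :=
      hPc.comp (h.continuous_deriv.sub continuous_const)
    have h2 := h1.tendsto t
    simp only [sub_self, map_zero] at h2
    exact h2.eventually (gt_mem_nhds hη0)
  obtain ⟨δ, hδ0, hδ⟩ := Metric.eventually_nhds_iff_ball.1 hev
  have hball : Metric.ball t δ ∩ Set.Icc 0 T ∈ 𝓝[Set.Icc 0 T] t :=
    Filter.inter_mem (mem_nhdsWithin_of_mem_nhds (Metric.ball_mem_nhds t hδ0))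
      self_mem_nhdsWithin
  filter_upwards [hball] with s hs
  have hpt : ∀ w, (1 + ‖w‖) ^ N * ‖(f s - f t - ((s - t : ℝ) : ℂ) • G t) w‖ ≤
      2 ^ N * η * |s - t| := by
    intro w
    -- Subtracting the linear function `τ • G t w` leaves the derivative `G τ w - G t w`, small near
    -- `t` with the weight in `w`.
    have h3 := (((convex_ball t δ).inter (convex_Icc 0 T)).norm_image_sub_le_of_norm_hasDerivWithin_le
      (f := fun τ => f τ w - τ • G t w) (f' := fun τ => G τ w - (1 : ℝ) • G t w)
      (C := 2 ^ N * η / (1 + ‖w‖) ^ N) (fun τ hτ => ?_) (fun τ hτ => ?_)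
      ⟨Metric.mem_ball_self hδ0, ht⟩ hs)
    · have h4 : (f s - f t - ((s - t : ℝ) : ℂ) • G t) w =
          f s w - s • G t w - (f t w - t • G t w) := by
        simp only [_root_.sub_apply, _root_.smul_apply, smul_eq_mul, Complex.real_smul]
        push_cast; ring
      rw [h4]
      rw [Real.norm_eq_abs] at h3
      calc _ ≤ (1 + ‖w‖) ^ N * (2 ^ N * η / (1 + ‖w‖) ^ N * |s - t|) := by gcongr
        _ = _ := by field_simp
    · exact ((h.hasDeriv τ hτ.2 w).mono Set.inter_subset_right).sub
        ((hasDerivWithinAt_id τ _).smul_const _)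
    · rw [one_smul, le_div_iff₀ (by positivity), mul_comm]
      exact (hPle (G τ - G t) w).trans (by gcongr; exact (hδ τ hτ.1).le)
  have h5 := hK _ _ hpt
  have h6 : ‖(f s).toLp 2 volume - (f t).toLp 2 volume - (s - t) • (G t).toLp 2 volume‖ =
      l2norm (f s - f t - ((s - t : ℝ) : ℂ) • G t) := by
    rw [l2norm]
    congr 1
  rw [h6, Real.norm_eq_abs]
  calc _ ≤ _ := h5
    _ = K * (2 ^ N * η) * |s - t| := by ring
    _ ≤ c * |s - t| := by gcongr

theorem eq_add_integral (h : IsCurve T f G) {s : ℝ} (hs : s ∈ Set.Icc 0 T) (w : Space d × Space d) :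
    f s w = f 0 w + ∫ τ in (0 : ℝ)..s, G τ w := by
  have hc : Continuous fun τ => f τ w :=
    (continuous_eval_curve h.continuous).comp (Continuous.prodMk_left w)
  have hG : Continuous fun τ => G τ w :=
    (continuous_eval_curve h.continuous_deriv).comp (Continuous.prodMk_left w)
  have := intervalIntegral.integral_eq_sub_of_hasDeriv_right_of_le hs.1 hc.continuousOn
    (f' := fun τ => G τ w) (fun τ hτ => ?_) (hG.intervalIntegrable _ _)
  · rw [this]; ring
  · have h1 := h.hasDeriv τ ⟨hτ.1.le, hτ.2.le.trans hs.2⟩ w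
    exact h1.mono_of_mem_nhdsWithin (mem_nhdsWithin_of_mem_nhds
      (Icc_mem_nhds hτ.1 (hτ.2.trans_le hs.2))) 

/-- A phase-space derivative cannot be interchanged directly with a pointwise time derivative. The
equation is put in integral form, differentiated under the time integral, and turned back into a
derivative by the fundamental theorem of calculus. -/
theorem lineDeriv (h : IsCurve T f G) (v : Space d × Space d) :
    IsCurve T (fun t => ∂_{v} (f t)) (fun t => ∂_{v} (G t)) := by
  have hL : Continuous fun g : PhaseFun d => (∂_{v} g : PhaseFun d) :=
    (LineDeriv.lineDerivOpCLM ℂ (PhaseFun d) v).continuous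
  have hvc : Continuous fun t => (∂_{v} (G t) : PhaseFun d) := hL.comp h.continuous_deriv
  refine ⟨hL.comp h.continuous, hvc, fun t ht w => ?_⟩
  have hGw : Continuous fun τ => (∂_{v} (G τ) : PhaseFun d) w :=
    (continuous_eval_curve hvc).comp (Continuous.prodMk_left w)
  have hline : ∀ (g : PhaseFun d) (r : ℝ),
      HasDerivAt (fun r : ℝ => g (w + r • v)) ((∂_{v} g : PhaseFun d) (w + r • v)) r := by
    intro g r
    have h1 : HasFDerivAt g (fderiv ℝ g (w + r • v)) (w + r • v) :=
      g.differentiableAt.hasFDerivAt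
    have h2 : HasDerivAt (fun r : ℝ => w + r • v) v r := by
      simpa using ((hasDerivAt_id r).smul_const v).const_add w
    have := h1.comp_hasDerivAt r h2
    exact this
  have key : ∀ s ∈ Set.Icc 0 T, (∂_{v} (f s) : PhaseFun d) w =
      (∂_{v} (f 0) : PhaseFun d) w + ∫ τ in (0 : ℝ)..s, (∂_{v} (G τ) : PhaseFun d) w := by
    intro s hs
    have hjc : Continuous fun q : ℝ × ℝ => (∂_{v} (G q.2) : PhaseFun d) (w + q.1 • v) :=
      (continuous_eval_curve hvc).comp (continuous_snd.prodMk
        (continuous_const.add (continuous_fst.smul continuous_const)))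
    obtain ⟨C, hC⟩ := (((isCompact_Icc (a := (-1 : ℝ)) (b := 1)).prod
      (isCompact_Icc (a := (0 : ℝ)) (b := s))).exists_bound_of_continuousOn hjc.continuousOn)
    have hGc : ∀ r : ℝ, Continuous fun τ => G τ (w + r • v) := fun r =>
      (continuous_eval_curve h.continuous_deriv).comp (Continuous.prodMk_left _)
    have h1 := (intervalIntegral.hasDerivAt_integral_of_dominated_loc_of_deriv_le
      (μ := volume) (a := 0) (b := s) (F := fun (r : ℝ) τ => G τ (w + r • v))
      (F' := fun (r : ℝ) τ => (∂_{v} (G τ) : PhaseFun d) (w + r • v)) (x₀ := 0)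
      (s := Set.Icc (-1) 1) (bound := fun _ => C) (Icc_mem_nhds (by norm_num) (by norm_num))
      (.of_forall fun r => (hGc r).aestronglyMeasurable) ((hGc 0).intervalIntegrable _ _)
      (hjc.comp (Continuous.prodMk_right 0)).aestronglyMeasurable
      (.of_forall fun τ hτ r hr => hC (r, τ) ⟨hr, by
        rw [Set.uIoc_of_le hs.1] at hτ; exact ⟨hτ.1.le, hτ.2⟩⟩)
      intervalIntegrable_const (.of_forall fun τ _ r _ => hline (G τ) r)).2
    have h2 := (hline (f 0) 0).add h1
    have h3 := hline (f s) 0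
    have h4 : (fun r : ℝ => f s (w + r • v)) =
        (fun r : ℝ => f 0 (w + r • v)) + fun r : ℝ => ∫ τ in (0 : ℝ)..s, G τ (w + r • v) := by
      ext r
      exact h.eq_add_integral hs _
    rw [h4] at h3
    simpa using h3.unique h2
  have h5 := ((hGw.integral_hasStrictDerivAt 0 t).hasDerivAt.const_add
    ((∂_{v} (f 0) : PhaseFun d) w)).hasDerivWithinAt (s := Set.Icc 0 T)
  exact h5.congr (fun s hs => key s hs) (key t ht)

theorem hasDerivWithinAt_energy (m : ℕ) : ∀ {f G : ℝ → PhaseFun d}, IsCurve T f G →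
    ∀ {t : ℝ}, t ∈ Set.Icc 0 T → HasDerivWithinAt (fun s => energy m (f s))
      (energyDot m (f t) (G t)) (Set.Icc 0 T) t := by
  have h0 : ∀ {f G : ℝ → PhaseFun d}, IsCurve T f G →
    ∀ {t : ℝ}, t ∈ Set.Icc 0 T → HasDerivWithinAt (fun s => l2norm (f s) ^ 2)
      (2 * (l2inner (f t) (G t)).re) (Set.Icc 0 T) t := by
    intro f G h t ht
    have h1 := h.hasDerivWithinAt_toLp ht
    have h2 := h1.inner ℂ h1
    have h3 := (Complex.reCLM.hasFDerivAt.comp_hasDerivWithinAt t h2)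
    have h4 : (fun s => l2norm (f s) ^ 2) = Complex.reCLM ∘ fun s =>
        ⟪(f s).toLp 2 volume, (f s).toLp 2 volume⟫_ℂ := by
      ext s; exact l2norm_sq _
    rw [h4]
    refine h3.congr_deriv ?_
    have h5 : ⟪(G t).toLp 2 volume, (f t).toLp 2 volume⟫_ℂ =
      (starRingEnd ℂ) ⟪(f t).toLp 2 volume, (G t).toLp 2 volume⟫_ℂ := (inner_conj_symm _ _).symm
    rw [h5]
    simp [l2inner]
    ring
  induction m with
  | zero => exact h0
  | succ m ih =>
    intro f G h t ht
    exact (h0 h ht).add (HasDerivWithinAt.fun_sum fun a _ => ih (h.lineDeriv (dir a)) ht)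

end IsCurve

/-! ### Grönwall's inequality and propagation of bounds -/

/-- Grönwall's inequality, forwards and backwards in time. -/
theorem gronwall_two_sided {T C η : ℝ} (hC : 0 ≤ C) {E E' : ℝ → ℝ}
    (hE : ∀ t ∈ Set.Icc 0 T, HasDerivWithinAt E (E' t) (Set.Icc 0 T) t)
    (hpos : ∀ t ∈ Set.Icc 0 T, 0 ≤ E t + η)
    (hb : ∀ t ∈ Set.Icc 0 T, |E' t| ≤ C * (E t + η)) {s t : ℝ} (hs : s ∈ Set.Icc 0 T)
    (ht : t ∈ Set.Icc 0 T) : E t + η ≤ Real.exp (C * T) * (E s + η) := by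
  -- The exponent is kept free: `c = -C` makes the weighted quantity decrease, for `s ≤ t`, and `c =
  -- C` makes it increase, for `t ≤ s`.
  have hder : ∀ c : ℝ, ∀ τ ∈ Set.Icc 0 T, HasDerivWithinAt (fun τ => Real.exp (c * τ) * (E τ + η))
      (Real.exp (c * τ) * (c * (E τ + η) + E' τ)) (Set.Icc 0 T) τ := by
    intro c τ hτ
    have h1 : HasDerivWithinAt (fun τ => Real.exp (c * τ)) (Real.exp (c * τ) * c)
        (Set.Icc 0 T) τ := by
      simpa using (((hasDerivAt_id τ).const_mul c).exp).hasDerivWithinAt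
    exact (h1.mul ((hE τ hτ).add_const η)).congr_deriv (by ring)
  have hcont : ∀ c : ℝ, ContinuousOn (fun τ => Real.exp (c * τ) * (E τ + η)) (Set.Icc 0 T) :=
    fun c τ hτ => (hder c τ hτ).continuousWithinAt
  rcases le_total s t with hst | hts
  · have h1 : AntitoneOn (fun τ => Real.exp (-C * τ) * (E τ + η)) (Set.Icc 0 T) :=
      antitoneOn_of_hasDerivWithinAt_nonpos (convex_Icc 0 T) (hcont (-C))
        (fun τ hτ => (hder (-C) τ (interior_subset hτ)).mono interior_subset)
        (fun τ hτ => mul_nonpos_of_nonneg_of_nonpos (Real.exp_nonneg _) (by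
          have := (abs_le.1 (hb τ (interior_subset hτ))).2
          linarith))
    have h2 := h1 hs ht hst
    have h3 : E t + η = Real.exp (C * t) * (Real.exp (-C * t) * (E t + η)) := by
      rw [← mul_assoc, ← Real.exp_add]; simp
    rw [h3]
    calc _ ≤ Real.exp (C * t) * (Real.exp (-C * s) * (E s + η)) := by gcongr
      _ = Real.exp (C * (t - s)) * (E s + η) := by
          rw [← mul_assoc, ← Real.exp_add]; ring_nf
      _ ≤ _ := by
          gcongr
          · exact hpos s hs
          · linarith [hs.1, ht.2]
  · have h1 : MonotoneOn (fun τ => Real.exp (C * τ) * (E τ + η)) (Set.Icc 0 T) :=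
      monotoneOn_of_hasDerivWithinAt_nonneg (convex_Icc 0 T) (hcont C)
        (fun τ hτ => (hder C τ (interior_subset hτ)).mono interior_subset)
        (fun τ hτ => mul_nonneg (Real.exp_nonneg _) (by
          have := (abs_le.1 (hb τ (interior_subset hτ))).1
          linarith))
    have h2 := h1 ht hs hts
    have h3 : E t + η = Real.exp (-C * t) * (Real.exp (C * t) * (E t + η)) := by
      rw [← mul_assoc, ← Real.exp_add]; simp
    rw [h3]
    calc _ ≤ Real.exp (-C * t) * (Real.exp (C * s) * (E s + η)) := by gcongr
      _ = Real.exp (C * (s - t)) * (E s + η) := by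
          rw [← mul_assoc, ← Real.exp_add]; ring_nf
      _ ≤ _ := by
          gcongr
          · exact hpos s hs
          · linarith [hs.2, ht.1]

/-- The reference time `s` is arbitrary, so the same bound serves the background equation with data
at `0` and the adjoint one with data at `T`. -/
theorem exists_energy_wigner_le {V : Space d → ℝ} (hV : IsAdmissiblePotential V) (T : ℝ) (m : ℕ) :
    ∃ C, 0 ≤ C ∧ ∀ ε, 0 < ε → ∀ f : ℝ → PhaseFun d,
      IsCurve T f (fun t => wignerGen (fun x => (V x : ℂ)) ε (f t)) →
      ∀ s ∈ Set.Icc 0 T, ∀ t ∈ Set.Icc 0 T, energy m (f t) ≤ C * energy m (f s) := by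
  obtain ⟨C, hC0, hC⟩ := exists_energyDot_wignerGen_le hV m
  refine ⟨Real.exp (C * T), Real.exp_nonneg _, fun ε hε f hf s hs t ht => ?_⟩
  have := gronwall_two_sided (η := 0) hC0 (fun t ht => hf.hasDerivWithinAt_energy m ht)
    (fun t _ => by rw [add_zero]; exact energy_nonneg _ _)
    (fun t _ => by rw [add_zero]; exact hC ε hε _) hs ht
  simpa using this

theorem exists_l2norm_le_of_continuous {f : ℝ → PhaseFun d} (hf : Continuous f) (T : ℝ) :
    ∃ K, 0 ≤ K ∧ ∀ t ∈ Set.Icc 0 T, l2norm (f t) ≤ K := by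
  have hc : Continuous fun t => (f t).toLp 2 (volume : Measure (Space d × Space d)) :=
    (toLpCLM ℂ ℂ 2 volume).continuous.comp hf
  obtain ⟨K, hK⟩ := (isCompact_Icc (a := (0 : ℝ)) (b := T)).exists_bound_of_continuousOn
    hc.continuousOn
  exact ⟨max K 0, le_max_right _ _, fun t ht => (hK t ht).trans (le_max_left _ _)⟩

/-- The difference evolves by the skew Wigner generator plus the defect of `wignerCLM` against
`forceCLM` on `f₀`. Only the defect contributes to the time derivative of the squared norm, and it
is `O(ε)` in `L²`. All momentum derivatives fall on the fixed curve `f₀`, so none of `f` are needed.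
-/
theorem exists_l2norm_wigner_sub_liouville_le {V : Space d → ℝ} (hV : IsAdmissiblePotential V)
    {T : ℝ} {f₀ : ℝ → PhaseFun d}
    (hf₀ : IsCurve T f₀ (fun t => liouvilleGen (fun x => (V x : ℂ)) (f₀ t))) :
    ∃ K, 0 ≤ K ∧ ∀ ε, 0 < ε → ∀ f : ℝ → PhaseFun d,
      IsCurve T f (fun t => wignerGen (fun x => (V x : ℂ)) ε (f t)) →
      ∀ s ∈ Set.Icc 0 T, ∀ t ∈ Set.Icc 0 T, l2norm (f t - f₀ t) ^ 2 ≤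
        Real.exp T * (l2norm (f s - f₀ s) ^ 2 + K * ε ^ 2) := by
  have hW := hV.isBoundedSmooth
  set W : Space d → ℂ := fun x => (V x : ℂ) with hWdef
  obtain ⟨C, hC0, hC⟩ := hW.exists_lipschitz_fderiv
  choose K hK0 hK using fun j : Fin d => exists_l2norm_le_of_continuous
    ((hf₀.lineDeriv (momDir j)).lineDeriv (momDir j)).continuous T
  refine ⟨(C * ∑ j : Fin d, K j) ^ 2, sq_nonneg _, fun ε hε f hf s hs t ht => ?_⟩
  have hdiff := hf.sub hf₀
  have hr : ∀ t ∈ Set.Icc 0 T, l2norm (wignerCLM W ε (f₀ t) - forceCLM W (f₀ t)) ^ 2 ≤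
      (C * ∑ j : Fin d, K j) ^ 2 * ε ^ 2 := by
    intro t ht
    rw [← mul_pow]
    gcongr
    · exact l2norm_nonneg _
    · refine (l2norm_wignerCLM_sub_forceCLM_le hW.hasTemperateGrowth
        (fun j => (hW.fderiv_apply _).hasTemperateGrowth) hC0 hC hε _).trans ?_
      rw [mul_right_comm]
      gcongr with j
      exact hK j t ht
  have hb : ∀ t ∈ Set.Icc 0 T, |energyDot 0 (f t - f₀ t)
      (wignerGen W ε (f t) - liouvilleGen W (f₀ t))| ≤
      1 * (energy 0 (f t - f₀ t) + (C * ∑ j : Fin d, K j) ^ 2 * ε ^ 2) := by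
    intro t ht
    have h1 : wignerGen W ε (f t) - liouvilleGen W (f₀ t) =
        wignerGen W ε (f t - f₀ t) + (wignerCLM W ε (f₀ t) - forceCLM W (f₀ t)) := by
      rw [map_sub, wignerGen_apply, wignerGen_apply, liouvilleGen_apply]
      abel
    have h2 := abs_energyDot_le 0 (f t - f₀ t) (wignerCLM W ε (f₀ t) - forceCLM W (f₀ t))
    have h3 : energyDot 0 (f t - f₀ t) (wignerGen W ε (f t - f₀ t)) = 0 := by
      simp only [energyDot, hWdef, re_l2inner_wignerGen_self hV ε, mul_zero]
    rw [h1, energyDot_add_right, h3, zero_add, one_mul]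
    exact h2.trans (by gcongr; exact hr t ht)
  have := gronwall_two_sided zero_le_one (fun t ht => hdiff.hasDerivWithinAt_energy 0 ht)
    (fun t _ => add_nonneg (energy_nonneg _ _) (by positivity)) hb hs ht
  rw [one_mul] at this
  have h4 : 0 ≤ (C * ∑ j : Fin d, K j) ^ 2 * ε ^ 2 := by positivity
  exact (le_add_of_nonneg_right h4).trans this

/-! ### Uniform energies and convergence of the data -/

theorem l2norm_eq_toReal (f : PhaseFun d) : l2norm f = (eLpNorm f 2 volume).toReal :=
  norm_toLp

/-- The `n` derivatives already taken are carried along because the recursion of `energy`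
differentiates its argument; the case of interest is `n = 0`. -/
theorem exists_energy_iterated_le (A : ℕ → ℝ≥0) (m : ℕ) : ∀ n : ℕ, ∃ c : ℝ, 0 ≤ c ∧
    ∀ f : PhaseFun d,
      (∀ j ≤ n + m, eLpNorm (fun w => iteratedFDeriv ℝ j f w) 2 volume ≤ A j) →
      ∀ v : Fin n → Space d × Space d, (∀ i, ‖v i‖ ≤ 1) → energy m (∂^{v} f) ≤ c := by
  have hbase : ∀ n : ℕ, ∀ f : PhaseFun d,
      eLpNorm (fun w => iteratedFDeriv ℝ n f w) 2 volume ≤ A n →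
      ∀ v : Fin n → Space d × Space d, (∀ i, ‖v i‖ ≤ 1) → l2norm (∂^{v} f) ^ 2 ≤ A n ^ 2 := by
    intro n f hf v hv
    have h1 : eLpNorm (∂^{v} f : PhaseFun d) 2 volume ≤ A n := by
      refine (eLpNorm_mono fun w => ?_).trans hf
      rw [iteratedLineDerivOp_eq_iteratedFDeriv]
      refine (ContinuousMultilinearMap.le_opNorm _ _).trans ?_
      exact mul_le_of_le_one_right (norm_nonneg _)
        (Finset.prod_le_one (fun i _ => norm_nonneg _) fun i _ => hv i)
    rw [l2norm_eq_toReal]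
    gcongr
    exact ENNReal.toReal_le_coe_of_le_coe h1
  induction m with
  | zero => exact fun n => ⟨A n ^ 2, by positivity, fun f hf v hv => hbase n f (hf n le_rfl) v hv⟩
  | succ m ih =>
    intro n
    obtain ⟨c, hc0, hc⟩ := ih (n + 1)
    refine ⟨A n ^ 2 + ∑ _a : Fin d ⊕ Fin d, c, by positivity, fun f hf v hv => ?_⟩
    rw [energy]
    refine add_le_add (hbase n f (hf n (by omega)) v hv) (Finset.sum_le_sum fun a _ => ?_)
    · have h1 : ∂_{dir a} (∂^{v} f) =
          ∂^{(Fin.cons (dir a) v : Fin (n + 1) → Space d × Space d)} f := by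
        rw [LineDeriv.iteratedLineDerivOp_succ_left]
        simp
      rw [h1]
      refine hc f (fun j hj => hf j (by omega)) _ fun i => ?_
      refine Fin.cases ?_ (fun i => ?_) i
      · rcases a with a | a <;> simp [dir, posDir, momDir, Prod.norm_def]
      · simpa using hv i

theorem ConvergesRegularly.exists_energy_le {u : ℝ → PhaseFun d} {u₀ : PhaseFun d}
    (h : ConvergesRegularly u u₀) (m : ℕ) :
    ∃ C, 0 ≤ C ∧ ∀ᶠ ε in 𝓝[>] (0 : ℝ), energy m (u ε) ≤ C := by
  choose A hA using h.bounded
  obtain ⟨c, hc0, hc⟩ := exists_energy_iterated_le (d := d) A m 0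
  refine ⟨c, hc0, ?_⟩
  have h1 : ∀ᶠ ε in 𝓝[>] (0 : ℝ), ∀ j ∈ Finset.range (m + 1),
      eLpNorm (fun w => iteratedFDeriv ℝ j (u ε) w) 2 volume ≤ A j :=
    (Finset.eventually_all _).2 fun j _ => hA j
  filter_upwards [h1] with ε hε
  have := hc (u ε) (fun j hj => hε j (Finset.mem_range.2 (by omega))) Fin.elim0
    (fun i => i.elim0)
  simpa using this

theorem ConvergesRegularly.tendsto_l2norm {u : ℝ → PhaseFun d} {u₀ : PhaseFun d}
    (h : ConvergesRegularly u u₀) : Tendsto (fun ε => l2norm (u ε - u₀)) (𝓝[>] 0) (𝓝 0) := by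
  have h1 : (fun ε => l2norm (u ε - u₀)) =
      fun ε => (eLpNorm (fun w => u ε w - u₀ w) 2 volume).toReal := by
    ext ε
    rw [l2norm_eq_toReal]
    rfl
  rw [h1]
  exact (ENNReal.tendsto_toReal ENNReal.zero_ne_top).comp h.tendsto_L2

/-! ### From solutions on `[0, T]` to globally continuous curves -/

theorem exists_continuous_extension {T : ℝ} (hT : 0 ≤ T) {f : ℝ → PhaseFun d}
    (hf : ContinuousOn f (Set.Icc 0 T)) :
    ∃ F : ℝ → PhaseFun d, Continuous F ∧ ∀ t ∈ Set.Icc 0 T, F t = f t := by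
  refine ⟨Set.IccExtend hT ((Set.Icc 0 T).domRestrict f),
    (continuousOn_iff_continuous_domRestrict.1 hf).Icc_extend', fun t ht => ?_⟩
  rw [Set.IccExtend_of_mem _ _ ht]
  rfl

/-- Outside `[0, T]` a solution is arbitrary. Freezing it at its end values makes it continuous on
`ℝ` without affecting the equation on `[0, T]`, one-sided derivatives included. -/
theorem SolvesWigner.exists_isCurve {V : Space d → ℝ} (hV : IsAdmissiblePotential V) {ε T : ℝ}
    (hT : 0 ≤ T) {f : ℝ → PhaseFun d} (hf : SolvesWigner V ε T f) :
    ∃ F : ℝ → PhaseFun d, IsCurve T F (fun t => wignerGen (fun x => (V x : ℂ)) ε (F t)) ∧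
      ∀ t ∈ Set.Icc 0 T, F t = f t := by
  obtain ⟨F, hF, hFf⟩ := exists_continuous_extension hT hf.continuousOn
  refine ⟨F, ⟨hF, (wignerGen _ ε).continuous.comp hF, fun t ht w => ?_⟩, hFf⟩
  have h1 := (hf.equation t ht w.1 w.2).congr (fun s hs => by rw [hFf s hs])
    (by rw [hFf t ht]) (f₁ := fun s => F s w)
  refine h1.congr_deriv ?_
  rw [hFf t ht, wignerGen_apply, wignerOp_eq_wignerCLM V hV.isBoundedSmooth.hasTemperateGrowth,
    ← transportCLM_apply]
  rfl

theorem forceCLM_ofReal_apply {V : Space d → ℝ} (hV : IsAdmissiblePotential V) (f : PhaseFun d)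
    (x k : Space d) :
    forceCLM (fun x => (V x : ℂ)) f (x, k) = fderiv ℝ f (x, k) (0, gradient V x) := by
  have hd : DifferentiableAt ℝ V x := hV.1.differentiable (by simp) x
  have h1 : ∀ j, fderiv ℝ (fun x => (V x : ℂ)) x (EuclideanSpace.single j 1) =
      ((gradient V x j : ℝ) : ℂ) := by
    intro j
    have h2 : HasFDerivAt (fun x => (V x : ℂ)) (Complex.ofRealCLM.comp (fderiv ℝ V x)) x :=
      Complex.ofRealCLM.hasFDerivAt.comp x hd.hasFDerivAt
    have h3 : fderiv ℝ V x (EuclideanSpace.single j 1) = gradient V x j := by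
      rw [gradient, ← InnerProductSpace.toDual_symm_apply, EuclideanSpace.inner_single_right]
      simp
    rw [h2.fderiv, ← h3]
    rfl
  have h : ((0, gradient V x) : Space d × Space d) = ∑ j, gradient V x j • momDir j := by
    refine Prod.ext ?_ ?_
    · simp [momDir, Prod.fst_sum]
    · simp only [momDir, Prod.snd_sum, Prod.smul_mk]
      exact (sum_smul_single _).symm
  rw [forceCLM_apply, _root_.sum_apply, h, map_sum]
  refine Finset.sum_congr rfl fun j _ => ?_
  rw [mulOp_apply (hasTemperateGrowth_comp_fst
    (hV.isBoundedSmooth.fderiv_apply _).hasTemperateGrowth), lineDerivOp_apply_eq_fderiv, map_smul,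
    Complex.real_smul, h1]

theorem SolvesLiouville.exists_isCurve {V : Space d → ℝ} (hV : IsAdmissiblePotential V) {T : ℝ}
    (hT : 0 ≤ T) {f : ℝ → PhaseFun d} (hf : SolvesLiouville V T f) :
    ∃ F : ℝ → PhaseFun d, IsCurve T F (fun t => liouvilleGen (fun x => (V x : ℂ)) (F t)) ∧
      ∀ t ∈ Set.Icc 0 T, F t = f t := by
  obtain ⟨F, hF, hFf⟩ := exists_continuous_extension hT hf.continuousOn
  refine ⟨F, ⟨hF, (liouvilleGen _).continuous.comp hF, fun t ht w => ?_⟩, hFf⟩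
  have h1 := (hf.equation t ht w.1 w.2).congr (fun s hs => by rw [hFf s hs])
    (by rw [hFf t ht]) (f₁ := fun s => F s w)
  refine h1.congr_deriv ?_
  rw [hFf t ht, liouvilleGen_apply, ← forceCLM_ofReal_apply hV, ← transportCLM_apply]
  rfl

/-! ### Plane waves as potentials -/

/-- The plane wave `x ↦ e^{i p · x}`. -/
def planeWave (p x : Space d) : ℂ := Complex.exp (Complex.I * (⟪p, x⟫_ℝ : ℂ))

theorem norm_planeWave (p x : Space d) : ‖planeWave p x‖ = 1 := by
  rw [planeWave, mul_comm]
  exact Complex.norm_exp_ofReal_mul_I _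

theorem planeWave_add (p x y : Space d) : planeWave p (x + y) = planeWave p x * planeWave p y := by
  rw [planeWave, planeWave, planeWave, ← Complex.exp_add, inner_add_right]
  push_cast
  ring_nf

theorem conj_planeWave (p x : Space d) : (starRingEnd ℂ) (planeWave p x) = planeWave (-p) x := by
  rw [planeWave, planeWave, ← Complex.exp_conj]
  simp

theorem contDiff_planeWave (p : Space d) : ContDiff ℝ ∞ (planeWave p) :=
  (contDiff_const.mul (Complex.ofRealCLM.contDiff.comp (innerSL ℝ p).contDiff)).cexp

/-- The derivative of a plane wave, up to the factor given by the plane wave itself. -/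
def planeWaveDeriv (p : Space d) : Space d →L[ℝ] ℂ := Complex.I • Complex.ofRealCLM.comp (innerSL ℝ p)

theorem planeWaveDeriv_apply (p v : Space d) :
    planeWaveDeriv p v = Complex.I * (⟪p, v⟫_ℝ : ℂ) := rfl

theorem norm_planeWaveDeriv_le (p : Space d) : ‖planeWaveDeriv p‖ ≤ ‖p‖ := by
  refine ContinuousLinearMap.opNorm_le_bound _ (norm_nonneg _) fun v => ?_
  rw [planeWaveDeriv_apply, norm_mul, Complex.norm_I, one_mul, Complex.norm_real]
  exact norm_inner_le_norm p v

theorem fderiv_planeWave (p x : Space d) :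
    fderiv ℝ (planeWave p) x = planeWave p x • planeWaveDeriv p := by
  have h1 : HasFDerivAt (fun x : Space d => planeWaveDeriv p x) (planeWaveDeriv p) x :=
    (planeWaveDeriv p).hasFDerivAt
  exact h1.cexp.fderiv

theorem norm_fderiv_planeWave_le (p x : Space d) : ‖fderiv ℝ (planeWave p) x‖ ≤ ‖p‖ := by
  rw [fderiv_planeWave, norm_smul, norm_planeWave, one_mul]
  exact norm_planeWaveDeriv_le p

theorem norm_fderiv_planeWave_sub_le (p x y : Space d) :
    ‖fderiv ℝ (planeWave p) x - fderiv ℝ (planeWave p) y‖ ≤ ‖p‖ ^ 2 * ‖x - y‖ := by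
  have h1 : ‖planeWave p x - planeWave p y‖ ≤ ‖p‖ * ‖x - y‖ :=
    convex_univ.norm_image_sub_le_of_norm_fderiv_le (𝕜 := ℝ)
      (fun x _ => (contDiff_planeWave p).differentiable (by simp) x)
      (fun x _ => norm_fderiv_planeWave_le p x) (Set.mem_univ y) (Set.mem_univ x)
  have h2 : planeWave p x • planeWaveDeriv p - planeWave p y • planeWaveDeriv p =
      (planeWave p x - planeWave p y) • planeWaveDeriv p := (sub_smul _ _ _).symm
  rw [fderiv_planeWave, fderiv_planeWave, h2, norm_smul]
  calc _ ≤ (‖p‖ * ‖x - y‖) * ‖p‖ := by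
        gcongr
        exact norm_planeWaveDeriv_le p
    _ = _ := by ring

theorem isBoundedSmooth_planeWave (p : Space d) : IsBoundedSmooth (planeWave p) := by
  refine ⟨contDiff_planeWave p, fun n => ?_⟩
  induction n with
  | zero => exact ⟨1, fun x => by rw [norm_iteratedFDeriv_zero, norm_planeWave]⟩
  | succ n ih =>
    obtain ⟨C, hC⟩ := ih
    let L : ℂ →L[ℝ] (Space d →L[ℝ] ℂ) :=
      (ContinuousLinearMap.toSpanSingleton ℂ (planeWaveDeriv p)).restrictScalars ℝ
    refine ⟨‖L‖ * C, fun x => ?_⟩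
    have h1 : fderiv ℝ (planeWave p) = L ∘ planeWave p := by
      ext1 x
      rw [fderiv_planeWave]
      rfl
    rw [← norm_iteratedFDeriv_fderiv, h1]
    refine (L.norm_iteratedFDeriv_comp_left (N := ∞) (contDiff_planeWave p).contDiffAt
      (mod_cast le_top)).trans ?_
    gcongr
    exact hC x

theorem hasTemperateGrowth_planeWave (p : Space d) : (planeWave p).HasTemperateGrowth :=
  (isBoundedSmooth_planeWave p).hasTemperateGrowth

theorem mulOp_const_mul {a : Space d × Space d → ℂ} (ha : a.HasTemperateGrowth) (c : ℂ)
    (f : PhaseFun d) : mulOp (fun w => c * a w) f = c • mulOp a f := by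
  have hc : (fun w => c * a w).HasTemperateGrowth := (Function.HasTemperateGrowth.const c).mul ha
  ext w
  rw [mulOp_apply hc, _root_.smul_apply,
    mulOp_apply ha, smul_eq_mul, mul_assoc]

theorem wignerCLM_const_mul {W : Space d → ℂ} (hW : W.HasTemperateGrowth) (c : ℂ) (ε : ℝ)
    (f : PhaseFun d) : wignerCLM (fun x => c * W x) ε f = c • wignerCLM W ε f := by
  have h1 : wignerSymbol (fun x => c * W x) ε = fun w => c * wignerSymbol W ε w := by
    ext w
    simp only [wignerSymbol]
    ring
  rw [wignerCLM_apply, wignerCLM_apply, h1, mulOp_const_mul (hW.wignerSymbol ε), map_smul,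
    smul_comm]

theorem fderiv_planeWave_coord (p : Space d) (j : Fin d) :
    (fun x => fderiv ℝ (planeWave p) x (EuclideanSpace.single j 1)) =
      fun x => (Complex.I * (p j : ℂ)) * planeWave p x := by
  ext x
  rw [fderiv_planeWave, _root_.smul_apply, planeWaveDeriv_apply, EuclideanSpace.inner_single_right]
  simp
  ring

/-- Shifting the plane wave by `±(ε/2) 2πη` multiplies it by the character `η ↦ e^{±2πi⟨η,
(ε/2)p⟩}`, and under the inverse Fourier transform this character shifts `k` by `±(ε/2)p`. The
finite difference in momentum thus becomes a Wigner operator. -/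
theorem wignerCLM_planeWave_apply (p : Space d) (ε : ℝ) (f : PhaseFun d) (x k : Space d) :
    wignerCLM (planeWave p) ε f (x, k) = Complex.I * (planeWave p x * momentumDiff ε f x k p) := by
  have hσ := (hasTemperateGrowth_planeWave p).wignerSymbol ε
  set F := fourierK f with hF
  have hint : ∀ k : Space d, Integrable fun y : Space d => Real.fourierChar ⟪y, k⟫_ℝ • F (x, y) := by
    intro k
    have h := (Real.fourierIntegral_convergent_iff (-k)).2 ((slice x F).integrable (μ := volume))
    simp only [inner_neg_right, neg_neg] at h
    exact h
  have hexp : ∀ (c : ℝ) (y : Space d), planeWave p (c • ((2 * Real.pi) • y)) =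
      (Real.fourierChar ⟪y, c • p⟫_ℝ : ℂ) := by
    intro c y
    rw [planeWave, Real.fourierChar_apply, inner_smul_right, inner_smul_right, inner_smul_right,
      real_inner_comm]
    push_cast
    ring_nf
  have hinv : ∀ k, f (x, k) = ∫ y : Space d, Real.fourierChar ⟪y, k⟫_ℝ • F (x, y) := by
    intro k
    rw [← fourierKInv_apply, hF, fourierKInv_fourierK]
  rw [wignerCLM_apply, _root_.smul_apply, fourierKInv_apply, momentumDiff, hinv, hinv,
    ← integral_sub (hint _) (hint _), div_eq_mul_inv, mul_comm _ (ε : ℂ)⁻¹, ← mul_assoc (planeWave p x),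
    ← integral_const_mul, smul_eq_mul]
  congr 2
  ext y
  rw [mulOp_apply hσ, wignerSymbol, sub_eq_add_neg x, planeWave_add, planeWave_add, ← neg_smul, hexp,
    hexp, sub_eq_add_neg k, ← neg_smul, inner_add_right, inner_add_right, AddChar.map_add_eq_mul,
    AddChar.map_add_eq_mul]
  simp only [Circle.smul_def, Circle.coe_mul, smul_eq_mul]
  ring

theorem hasTemperateGrowth_planeWave_fst (p : Space d) :
    (fun w : Space d × Space d => planeWave p w.1).HasTemperateGrowth :=
  hasTemperateGrowth_comp_fst (hasTemperateGrowth_planeWave p)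

theorem forceCLM_planeWave (p : Space d) (f : PhaseFun d) :
    forceCLM (planeWave p) f = ∑ j : Fin d, (Complex.I * (p j : ℂ)) •
      mulOp (fun w => planeWave p w.1) (∂_{momDir j} f) := by
  rw [forceCLM_apply]
  refine Finset.sum_congr rfl fun j _ => ?_
  rw [← mulOp_const_mul (hasTemperateGrowth_planeWave_fst p)]
  congr 2
  ext w
  exact congrFun (fderiv_planeWave_coord p j) w.1

/-! ### Decay in the frequency and the difference estimate -/

/-- Integration by parts against a plane wave gives decay in its frequency. -/
theorem one_add_norm_pow_mul_le (p : Space d) (H : PhaseFun d → PhaseFun d → ℂ)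
    (hH : ∀ (j : Fin d) f g, |p j| * ‖H g f‖ ≤ ‖H (∂_{posDir j} g) f‖ + ‖H g (∂_{posDir j} f)‖)
    {c : ℝ} (hb : ∀ f g B, energy 1 f ≤ B → energy 1 g ≤ B → ‖H g f‖ ≤ c * B) (n : ℕ) :
    ∀ f g B, energy (n + 1) f ≤ B → energy (n + 1) g ≤ B →
      (1 + ‖p‖) ^ n * ‖H g f‖ ≤ (1 + 2 * d) ^ n * c * B := by
  induction n with
  | zero => intro f g B hf hg; simpa using hb f g B hf hg
  | succ n ih =>
    intro f g B hf hg
    have hf' := (energy_le_succ _ f).trans hf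
    have hg' := (energy_le_succ _ g).trans hg
    -- Each coordinate of `p` costs one derivative on `g` or on `f`, hence two terms; summing over
    -- `d` coordinates and adding the undifferentiated term gives the factor `1 + 2d`.
    have h1 : ∀ j : Fin d, |p j| * ((1 + ‖p‖) ^ n * ‖H g f‖) ≤ 2 * ((1 + 2 * d) ^ n * c * B) := by
      intro j
      have h2 := ih f (∂_{posDir j} g) B hf' ((energy_lineDeriv_le _ (Sum.inl j) g).trans hg)
      have h3 := ih (∂_{posDir j} f) g B ((energy_lineDeriv_le _ (Sum.inl j) f).trans hf) hg'
      have h4 : 0 ≤ (1 + ‖p‖) ^ n := by positivity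
      have h5 := mul_le_mul_of_nonneg_left (hH j f g) h4
      linarith
    have h6 := Finset.sum_le_sum fun (j : Fin d) (_ : j ∈ Finset.univ) => h1 j
    rw [← Finset.sum_mul, Finset.sum_const, Finset.card_univ, Fintype.card_fin, nsmul_eq_mul] at h6
    have h7 : ‖p‖ * ((1 + ‖p‖) ^ n * ‖H g f‖) ≤ (∑ j, |p j|) * ((1 + ‖p‖) ^ n * ‖H g f‖) := by
      gcongr
      exact norm_le_sum_coord p
    have h8 := ih f g B hf' hg'
    calc (1 + ‖p‖) ^ (n + 1) * ‖H g f‖ =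
        (1 + ‖p‖) ^ n * ‖H g f‖ + ‖p‖ * ((1 + ‖p‖) ^ n * ‖H g f‖) := by ring
      _ ≤ (1 + 2 * d) ^ n * c * B + d * (2 * ((1 + 2 * d) ^ n * c * B)) := by linarith
      _ = _ := by ring

theorem l2norm_le_sqrt_of_energy {m : ℕ} {f : PhaseFun d} {B : ℝ} (h : energy m f ≤ B) :
    l2norm f ≤ √B :=
  Real.le_sqrt_of_sq_le ((l2norm_sq_le_energy m f).trans h)

theorem sum_l2norm_momDir_le_sqrt {f : PhaseFun d} {B : ℝ} (h : energy 1 f ≤ B) :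
    ∑ j : Fin d, l2norm (∂_{momDir j} f) ≤ √d * √B := by
  rw [← Real.sqrt_mul (Nat.cast_nonneg d)]
  exact Real.le_sqrt_of_sq_le ((sum_l2norm_momDir_sq_le f).trans (by gcongr))

/-- Since `∂ⱼ e_p = i pⱼ e_p`, the commutator of `∂_{xⱼ}` with the operator is `i pⱼ` times the
operator itself, which supplies the integration by parts. The factor `‖p‖` on the right is the
gradient bound of `e_p` and is later paid for by one more power of decay. -/
theorem one_add_norm_pow_mul_wignerCLM_le (p : Space d) {ε : ℝ} (hε : 0 < ε) (n : ℕ)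
    {f g : PhaseFun d} {B : ℝ} (hf : energy (n + 1) f ≤ B) (hg : energy (n + 1) g ≤ B) :
    (1 + ‖p‖) ^ n * ‖l2inner g (wignerCLM (planeWave p) ε f)‖ ≤
      (1 + 2 * d) ^ n * (‖p‖ * √d) * B := by
  refine one_add_norm_pow_mul_le p (fun g f => l2inner g (wignerCLM (planeWave p) ε f)) ?_ ?_ n
    f g B hf hg
  · intro j f g
    have ht : (fun x => fderiv ℝ (planeWave p) x (EuclideanSpace.single j 1)).HasTemperateGrowth :=
      ((isBoundedSmooth_planeWave p).fderiv_apply _).hasTemperateGrowth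
    have h1 := lineDeriv_fst_wignerCLM (hasTemperateGrowth_planeWave p) ε
      (EuclideanSpace.single j 1) ht f
    rw [fderiv_planeWave_coord, wignerCLM_const_mul (hasTemperateGrowth_planeWave p)] at h1
    have h2 : (Complex.I * (p j : ℂ)) * l2inner g (wignerCLM (planeWave p) ε f) =
        -l2inner (∂_{posDir j} g) (wignerCLM (planeWave p) ε f) -
          l2inner g (wignerCLM (planeWave p) ε (∂_{posDir j} f)) := by
      rw [← l2inner_lineDeriv_right, ← l2inner_sub_right, ← l2inner_smul_right]
      congr 1
      simp only [posDir]
      rw [h1]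
      abel
    have h3 : ‖(Complex.I * (p j : ℂ)) * l2inner g (wignerCLM (planeWave p) ε f)‖ =
        |p j| * ‖l2inner g (wignerCLM (planeWave p) ε f)‖ := by
      simp
    rw [← h3, h2]
    exact (norm_sub_le _ _).trans (by rw [norm_neg])
  · intro f g B hf hg
    have hB : 0 ≤ B := (energy_nonneg _ _).trans hf
    calc _ ≤ l2norm g * l2norm (wignerCLM (planeWave p) ε f) := norm_l2inner_le _ _
      _ ≤ √B * (‖p‖ * (√d * √B)) := by
          gcongr
          · exact l2norm_nonneg _
          · exact l2norm_le_sqrt_of_energy hg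
          · refine (l2norm_wignerCLM_le (hasTemperateGrowth_planeWave p)
              (norm_fderiv_planeWave_le p) hε f).trans ?_
            gcongr
            exact sum_l2norm_momDir_le_sqrt hf
      _ = ‖p‖ * √d * (√B * √B) := by ring
      _ = _ := by rw [Real.mul_self_sqrt hB]

theorem l2norm_mulOp_planeWave (p : Space d) (f : PhaseFun d) :
    l2norm (mulOp (fun w => planeWave p w.1) f) = l2norm f := by
  rw [l2norm_eq_toReal, l2norm_eq_toReal]
  congr 1
  refine eLpNorm_congr_norm_ae (.of_forall fun w => ?_)
  rw [mulOp_apply (hasTemperateGrowth_planeWave_fst p), norm_mul, norm_planeWave, one_mul]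

theorem one_add_norm_pow_mul_mulOp_le (p : Space d) (n : ℕ)
    {f g : PhaseFun d} {B : ℝ} (hf : energy (n + 1) f ≤ B) (hg : energy (n + 1) g ≤ B) :
    (1 + ‖p‖) ^ n * ‖l2inner g (mulOp (fun w => planeWave p w.1) f)‖ ≤ (1 + 2 * d) ^ n * 1 * B := by
  have ht := hasTemperateGrowth_planeWave_fst p
  refine one_add_norm_pow_mul_le p (fun g f => l2inner g (mulOp (fun w => planeWave p w.1) f))
    ?_ ?_ n f g B hf hg
  · intro j f g
    have h1 : ∂_{posDir j} (mulOp (fun w => planeWave p w.1) f) =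
        mulOp (fun w => planeWave p w.1) (∂_{posDir j} f) +
          (Complex.I * (p j : ℂ)) • mulOp (fun w => planeWave p w.1) f := by
      have hc : (fun w : Space d × Space d => (Complex.I * (p j : ℂ)) *
          planeWave p w.1).HasTemperateGrowth := (Function.HasTemperateGrowth.const _).mul ht
      rw [lineDeriv_mulOp ht hc, ← mulOp_const_mul ht]
      intro w
      have h2 : HasFDerivAt (fun w : Space d × Space d => planeWave p w.1)
          ((fderiv ℝ (planeWave p) w.1).comp (ContinuousLinearMap.fst ℝ _ _)) w :=
        HasFDerivAt.comp w ((contDiff_planeWave p).differentiable (by simp) w.1).hasFDerivAt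
          (hasFDerivAt_fst (𝕜 := ℝ) (p := w))
      rw [h2.fderiv]
      exact congrFun (fderiv_planeWave_coord p j) w.1
    have h2 : (Complex.I * (p j : ℂ)) * l2inner g (mulOp (fun w => planeWave p w.1) f) =
        -l2inner (∂_{posDir j} g) (mulOp (fun w => planeWave p w.1) f) -
          l2inner g (mulOp (fun w => planeWave p w.1) (∂_{posDir j} f)) := by
      rw [← l2inner_lineDeriv_right, ← l2inner_sub_right, ← l2inner_smul_right, h1]
      congr 1
      abel
    have h3 : ‖(Complex.I * (p j : ℂ)) * l2inner g (mulOp (fun w => planeWave p w.1) f)‖ =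
        |p j| * ‖l2inner g (mulOp (fun w => planeWave p w.1) f)‖ := by
      simp
    rw [← h3, h2]
    exact (norm_sub_le _ _).trans (by rw [norm_neg])
  · intro f g B hf hg
    have hB : 0 ≤ B := (energy_nonneg _ _).trans hf
    calc _ ≤ l2norm g * l2norm (mulOp (fun w => planeWave p w.1) f) := norm_l2inner_le _ _
      _ ≤ √B * √B := by
          rw [l2norm_mulOp_planeWave]
          gcongr
          · exact l2norm_nonneg _
          · exact l2norm_le_sqrt_of_energy hg
          · exact l2norm_le_sqrt_of_energy hf
      _ = 1 * B := by rw [Real.mul_self_sqrt hB, one_mul]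

/-- Telescoping changes `g`, then `f`, then the operator. In the second term the operator is moved
onto `g₀` by skewness, because `f - f₀` is known to be small only in `L²`, without derivatives. -/
theorem norm_l2inner_wignerCLM_sub_forceCLM_le (p : Space d) {ε : ℝ} (hε : 0 < ε)
    (f f₀ g g₀ : PhaseFun d) :
    ‖l2inner g (wignerCLM (planeWave p) ε f) - l2inner g₀ (forceCLM (planeWave p) f₀)‖ ≤
      l2norm (g - g₀) * (‖p‖ * ∑ j : Fin d, l2norm (∂_{momDir j} f)) +
      (‖p‖ * ∑ j : Fin d, l2norm (∂_{momDir j} g₀)) * l2norm (f - f₀) +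
      l2norm g₀ * (‖p‖ ^ 2 * ε * ∑ j : Fin d, l2norm (∂_{momDir j} (∂_{momDir j} f₀))) := by
  have ht := hasTemperateGrowth_planeWave p
  have hconj : (fun x => (starRingEnd ℂ) (planeWave p x)) = planeWave (-p) := by
    ext x; exact conj_planeWave p x
  have h0 : l2inner g (wignerCLM (planeWave p) ε f) - l2inner g₀ (forceCLM (planeWave p) f₀) =
      l2inner (g - g₀) (wignerCLM (planeWave p) ε f) +
      l2inner g₀ (wignerCLM (planeWave p) ε (f - f₀)) +
      l2inner g₀ (wignerCLM (planeWave p) ε f₀ - forceCLM (planeWave p) f₀) := by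
    rw [l2inner_sub_left, l2inner_sub_right, map_sub, l2inner_sub_right]
    ring
  rw [h0]
  refine (norm_add₃_le).trans (add_le_add (add_le_add ?_ ?_) ?_)
  · refine (norm_l2inner_le _ _).trans ?_
    gcongr
    · exact l2norm_nonneg _
    · exact l2norm_wignerCLM_le ht (norm_fderiv_planeWave_le p) hε f
  · have h1 := l2inner_wignerCLM_right ht ε (f - f₀) g₀
    rw [h1, norm_neg]
    refine (norm_l2inner_le _ _).trans ?_
    gcongr
    · exact l2norm_nonneg _
    · have h2 := l2norm_wignerCLM_le (hasTemperateGrowth_planeWave (-p))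
        (norm_fderiv_planeWave_le (-p)) hε g₀
      rw [norm_neg] at h2
      rw [← hconj] at h2
      exact h2
  · refine (norm_l2inner_le _ _).trans ?_
    gcongr
    · exact l2norm_nonneg _
    · exact l2norm_wignerCLM_sub_forceCLM_le ht
        (fun j => ((isBoundedSmooth_planeWave p).fderiv_apply _).hasTemperateGrowth) (sq_nonneg _)
        (norm_fderiv_planeWave_sub_le p) hε f₀

/-! ### Plancherel for functions in `L¹ ∩ L²` -/

/-- Plancherel's theorem for functions which are both integrable and square integrable. -/
theorem eLpNorm_fourier_eq {h : Space d → ℂ} (hint : Integrable h) (hL2 : MemLp h 2 volume) :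
    eLpNorm (𝓕 h) 2 volume = eLpNorm h 2 volume := by
  set H : Lp ℂ 2 (volume : Measure (Space d)) := hL2.toLp h with hH
  have hHh : (H : Space d → ℂ) =ᵐ[volume] h := hL2.coeFn_toLp
  have hcont : Continuous (𝓕 h) :=
    VectorFourier.fourierIntegral_continuous Real.continuous_fourierChar continuous_inner hint
  -- The `L²` transform and the integral transform are tested against smooth compactly supported
  -- functions: the first is the distributional transform, and the second obeys the exchange formula
  -- `∫ 𝓕Φ · h = ∫ Φ · 𝓕h`.
  have hae : ∀ᵐ x, (𝓕 H : Lp ℂ 2 (volume : Measure (Space d))) x = 𝓕 h x := by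
    refine ae_eq_of_integral_contDiff_smul_eq
      ((Lp.memLp (𝓕 H)).locallyIntegrable (by norm_num)) hcont.locallyIntegrable
      fun φ hφ hφc => ?_
    have hφ' : HasCompactSupport fun x => (φ x : ℂ) := hφc.comp_left Complex.ofReal_zero
    set Φ : 𝓢(Space d, ℂ) := hφ'.toSchwartzMap (Complex.ofRealCLM.contDiff.comp hφ) with hΦ
    have hΦφ : ∀ x, Φ x = (φ x : ℂ) := fun x => rfl
    have h1 : (𝓕 (H : 𝓢'(Space d, ℂ))) Φ = ((𝓕 H : Lp ℂ 2 (volume : Measure (Space d))) :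
        𝓢'(Space d, ℂ)) Φ := by
      rw [Lp.fourier_toTemperedDistribution_eq]
    rw [TemperedDistribution.fourier_apply, Lp.toTemperedDistribution_apply,
      Lp.toTemperedDistribution_apply] at h1
    have h2 : ∫ x, (𝓕 Φ) x • (H : Space d → ℂ) x = ∫ x, (𝓕 (Φ : Space d → ℂ)) x • h x :=
      integral_congr_ae (hHh.mono fun x hx => by simp only [hx]; rfl)
    have h3 : ∫ x, (𝓕 (Φ : Space d → ℂ)) x • h x = ∫ x, Φ x • 𝓕 h x := by
      simpa using! VectorFourier.integral_fourierIntegral_smul_eq_flip (L := innerₗ (Space d))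
        Real.continuous_fourierChar continuous_inner Φ.integrable hint
    rw [h2, h3] at h1
    simpa [hΦφ, Complex.real_smul] using h1.symm
  calc eLpNorm (𝓕 h) 2 volume =
        eLpNorm (𝓕 H : Lp ℂ 2 (volume : Measure (Space d))) 2 volume :=
        (eLpNorm_congr_ae hae).symm
    _ = ‖(𝓕 H : Lp ℂ 2 (volume : Measure (Space d)))‖ₑ := (Lp.enorm_def _).symm
    _ = ‖H‖ₑ := by rw [← ofReal_norm, Lp.norm_fourier_eq, ofReal_norm]
    _ = eLpNorm H 2 volume := Lp.enorm_def _
    _ = _ := eLpNorm_congr_ae hHh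

/-! ### Integrability and uniform bounds along curves -/

theorem ae_prod_restrict_Icc_mem {A : Type*} [MeasurableSpace A] (μ : Measure A) [SFinite μ]
    (T : ℝ) : ∀ᵐ q ∂μ.prod (volume.restrict (Set.Icc (0 : ℝ) T)), q.2 ∈ Set.Icc 0 T := by
  have h1 : μ.prod (volume.restrict (Set.Icc (0 : ℝ) T)) =
      (μ.prod volume).restrict (Set.univ ×ˢ Set.Icc 0 T) := by
    rw [← Measure.prod_restrict, Measure.restrict_univ]
  rw [h1]
  exact ae_restrict_of_forall_mem (MeasurableSet.univ.prod measurableSet_Icc) fun q hq => hq.2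

theorem integrable_prod_Icc_of_norm_le {A : Type*} [TopologicalSpace A]
    [SecondCountableTopology A] [MeasurableSpace A] [BorelSpace A] {μ : Measure A} [SFinite μ]
    {T : ℝ} {F : A × ℝ → ℂ} (hF : Continuous F) {b : A → ℝ} (hb : Integrable b μ)
    (h : ∀ a, ∀ t ∈ Set.Icc 0 T, ‖F (a, t)‖ ≤ b a) :
    Integrable F (μ.prod (volume.restrict (Set.Icc 0 T))) := by
  refine (hb.comp_fst (volume.restrict (Set.Icc 0 T))).mono' hF.aestronglyMeasurable ?_
  filter_upwards [ae_prod_restrict_Icc_mem μ T] with q hq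
  exact h q.1 q.2 hq

theorem exists_weighted_bound_of_continuous {f : ℝ → PhaseFun d} (hf : Continuous f) (T : ℝ)
    (N : ℕ) : ∃ C, 0 ≤ C ∧ ∀ t ∈ Set.Icc 0 T, ∀ w, (1 + ‖w‖) ^ N * ‖f t w‖ ≤ C := by
  set P : Seminorm ℂ (PhaseFun d) :=
    (Finset.Iic ((N, 0) : ℕ × ℕ)).sup fun m => SchwartzMap.seminorm ℂ m.1 m.2 with hP
  have hPc : Continuous P :=
    Seminorm.continuous_finsetSup fun m _ =>
      (schwartz_withSeminorms ℂ (Space d × Space d) ℂ).continuous_seminorm m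
  obtain ⟨C, hC⟩ := (isCompact_Icc (a := (0 : ℝ)) (b := T)).exists_bound_of_continuousOn
    (hPc.comp hf).continuousOn
  refine ⟨2 ^ N * max C 0, by positivity, fun t ht w => ?_⟩
  have h1 := one_add_le_sup_seminorm_apply (𝕜 := ℂ) (m := (N, 0)) le_rfl le_rfl (f t) w
  have h2 : P (f t) ≤ max C 0 := ((le_abs_self _).trans (hC t ht)).trans (le_max_left _ _)
  calc _ ≤ 2 ^ N * P (f t) := by simpa using h1
    _ ≤ _ := by gcongr

theorem exists_energy_le_of_continuous (m : ℕ) : ∀ {f : ℝ → PhaseFun d}, Continuous f →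
    ∀ T : ℝ, ∃ B, 0 ≤ B ∧ ∀ t ∈ Set.Icc 0 T, energy m (f t) ≤ B := by
  have h0 : ∀ {f : ℝ → PhaseFun d}, Continuous f →
      ∀ T : ℝ, ∃ B, 0 ≤ B ∧ ∀ t ∈ Set.Icc 0 T, l2norm (f t) ^ 2 ≤ B := by
    intro f hf T
    obtain ⟨K, hK0, hK⟩ := exists_l2norm_le_of_continuous hf T
    exact ⟨K ^ 2, sq_nonneg _, fun t ht => pow_le_pow_left₀ (l2norm_nonneg _) (hK t ht) 2⟩
  induction m with
  | zero => exact h0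
  | succ m ih =>
    intro f hf T
    obtain ⟨B₀, hB₀, h₀⟩ := h0 hf T
    choose B hB0 hB using fun a : Fin d ⊕ Fin d =>
      ih ((LineDeriv.lineDerivOpCLM ℂ (PhaseFun d) (dir a)).continuous.comp hf) T
    refine ⟨B₀ + ∑ a, B a, add_nonneg hB₀ (Finset.sum_nonneg fun a _ => hB0 a), fun t ht => ?_⟩
    exact add_le_add (h₀ t ht) (Finset.sum_le_sum fun a _ => hB a t ht)

theorem continuous_l2inner {f g : ℝ → PhaseFun d} (hf : Continuous f) (hg : Continuous g) :
    Continuous fun t => l2inner (g t) (f t) :=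
  Continuous.inner ((toLpCLM ℂ ℂ 2 volume).continuous.comp hg)
    ((toLpCLM ℂ ℂ 2 volume).continuous.comp hf)

theorem exists_integrable_weight (d : ℕ) : ∃ N : ℕ,
    Integrable (fun x : Space d => ((1 + ‖x‖) ^ N)⁻¹) ∧
    Integrable (fun x : Space d => (((1 + ‖x‖) ^ N)⁻¹) ^ 2) ∧
    Integrable (fun w : Space d × Space d => ((1 + ‖w‖) ^ N)⁻¹) := by
  obtain ⟨N, hN⟩ : ∃ N : ℕ, (Module.finrank ℝ (Space d × Space d) : ℝ) < N := exists_nat_gt _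
  have hN' : (Module.finrank ℝ (Space d) : ℝ) < N := by
    refine lt_of_le_of_lt ?_ hN
    rw [Module.finrank_prod]
    push_cast
    linarith [(Nat.cast_nonneg (Module.finrank ℝ (Space d)) : (0 : ℝ) ≤ _)]
  have h1 : Integrable (fun x : Space d => ((1 + ‖x‖) ^ N)⁻¹) := by
    have := integrable_one_add_norm (μ := (volume : Measure (Space d))) hN'
    refine this.congr (.of_forall fun x => ?_)
    simp only [Real.rpow_neg (by positivity : (0 : ℝ) ≤ 1 + ‖x‖), Real.rpow_natCast]
  refine ⟨N, h1, ?_, ?_⟩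
  · refine h1.mono' (by fun_prop) (.of_forall fun x => ?_)
    have h2 : ((1 + ‖x‖) ^ N)⁻¹ ≤ 1 :=
      inv_le_one_of_one_le₀ (one_le_pow₀ (le_add_of_nonneg_right (norm_nonneg x)))
    rw [Real.norm_of_nonneg (by positivity), sq]
    exact mul_le_of_le_one_left (by positivity) h2
  · have := integrable_one_add_norm (μ := (volume : Measure (Space d × Space d))) hN
    refine this.congr (.of_forall fun x => ?_)
    simp only [Real.rpow_neg (by positivity : (0 : ℝ) ≤ 1 + ‖x‖), Real.rpow_natCast]

/-! ### Position marginals and their Fourier transforms -/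

section Marginal

variable {T : ℝ} {h g : ℝ → PhaseFun d}

theorem continuous_curve_density (hh : Continuous h) (hg : Continuous g) :
    Continuous fun q : (Space d × Space d) × ℝ => (starRingEnd ℂ) (g q.2 q.1) * h q.2 q.1 := by
  have h1 : Continuous fun q : (Space d × Space d) × ℝ => h q.2 q.1 :=
    (continuous_eval_curve hh).comp continuous_swap
  have h2 : Continuous fun q : (Space d × Space d) × ℝ => g q.2 q.1 :=
    (continuous_eval_curve hg).comp continuous_swap
  exact (Complex.continuous_conj.comp h2).mul h1

theorem exists_curve_density_le (hh : Continuous h) (hg : Continuous g) (T : ℝ) (N : ℕ) :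
    ∃ C, 0 ≤ C ∧ ∀ t ∈ Set.Icc 0 T, ∀ w : Space d × Space d,
      ‖(starRingEnd ℂ) (g t w) * h t w‖ ≤ C * (((1 + ‖w‖) ^ N)⁻¹ * ((1 + ‖w‖) ^ N)⁻¹) := by
  obtain ⟨C₁, h10, h1⟩ := exists_weighted_bound_of_continuous hh T N
  obtain ⟨C₂, h20, h2⟩ := exists_weighted_bound_of_continuous hg T N
  refine ⟨C₂ * C₁, by positivity, fun t ht w => ?_⟩
  have h3 : ‖h t w‖ ≤ C₁ * ((1 + ‖w‖) ^ N)⁻¹ := by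
    rw [← div_eq_mul_inv, le_div_iff₀ (by positivity), mul_comm]; exact h1 t ht w
  have h4 : ‖g t w‖ ≤ C₂ * ((1 + ‖w‖) ^ N)⁻¹ := by
    rw [← div_eq_mul_inv, le_div_iff₀ (by positivity), mul_comm]; exact h2 t ht w
  rw [norm_mul, RCLike.norm_conj]
  calc _ ≤ (C₂ * ((1 + ‖w‖) ^ N)⁻¹) * (C₁ * ((1 + ‖w‖) ^ N)⁻¹) := by gcongr
    _ = _ := by ring

/-- Two copies of the phase-space weight are available because both `g` and `h` decay; one is spent
on `x` and one on `k`. -/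
theorem inv_one_add_norm_prod_le (x k : Space d) (N : ℕ) :
    ((1 + ‖((x, k) : Space d × Space d)‖) ^ N)⁻¹ * ((1 + ‖((x, k) : Space d × Space d)‖) ^ N)⁻¹ ≤
      ((1 + ‖x‖) ^ N)⁻¹ * ((1 + ‖k‖) ^ N)⁻¹ := by
  have h1 : ‖x‖ ≤ ‖((x, k) : Space d × Space d)‖ := le_max_left _ _
  have h2 : ‖k‖ ≤ ‖((x, k) : Space d × Space d)‖ := le_max_right _ _
  gcongr

/-- The marginal in position of the density `conj(g) h`, integrated over `[0, T]`. -/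
def marginal (T : ℝ) (h g : ℝ → PhaseFun d) (x : Space d) : ℂ :=
  ∫ q, (starRingEnd ℂ) (g q.2 (x, q.1)) * h q.2 (x, q.1) ∂(liouvilleMeasure d T)

/-- The inverse Fourier transform of `marginal`. -/
def marginalTransform (T : ℝ) (h g : ℝ → PhaseFun d) (q : Space d) : ℂ :=
  ∫ t in Set.Icc 0 T, l2inner (g t) (mulOp (fun w => planeWave ((2 * Real.pi) • q) w.1) (h t))

theorem integrable_marginal_integrand (T : ℝ) (hh : Continuous h) (hg : Continuous g) (x : Space d) :
    Integrable (fun q : Space d × ℝ => (starRingEnd ℂ) (g q.2 (x, q.1)) * h q.2 (x, q.1))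
      (liouvilleMeasure d T) := by
  obtain ⟨N, hN, -, -⟩ := exists_integrable_weight d
  obtain ⟨C, hC0, hC⟩ := exists_curve_density_le hh hg T N
  refine integrable_prod_Icc_of_norm_le ?_ (hN.const_mul C) fun k t ht => ?_
  · exact (continuous_curve_density hh hg).comp
      ((continuous_const.prodMk continuous_fst).prodMk continuous_snd)
  · refine (hC t ht (x, k)).trans ?_
    gcongr
    refine (inv_one_add_norm_prod_le x k N).trans (mul_le_of_le_one_left (by positivity) ?_)
    exact inv_le_one_of_one_le₀ (one_le_pow₀ (le_add_of_nonneg_right (norm_nonneg x)))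

theorem continuous_marginal (T : ℝ) (hh : Continuous h) (hg : Continuous g) :
    Continuous (marginal T h g) := by
  obtain ⟨N, hN, -, -⟩ := exists_integrable_weight d
  obtain ⟨C, hC0, hC⟩ := exists_curve_density_le hh hg T N
  refine continuous_of_dominated (bound := fun q : Space d × ℝ => C * ((1 + ‖q.1‖) ^ N)⁻¹)
    (fun x => (integrable_marginal_integrand T hh hg x).1) (fun x => ?_)
    ((hN.const_mul C).comp_fst _) (.of_forall fun q => ?_)
  · filter_upwards [ae_prod_restrict_Icc_mem (volume : Measure (Space d)) T] with q hq
    refine (hC q.2 hq (x, q.1)).trans ?_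
    gcongr
    refine (inv_one_add_norm_prod_le x q.1 N).trans (mul_le_of_le_one_left (by positivity) ?_)
    exact inv_le_one_of_one_le₀ (one_le_pow₀ (le_add_of_nonneg_right (norm_nonneg x)))
  · exact (continuous_curve_density hh hg).comp
      ((continuous_id.prodMk continuous_const).prodMk continuous_const)

theorem integrable_marginal (T : ℝ) (hh : Continuous h) (hg : Continuous g) :
    Integrable (marginal T h g) := by
  obtain ⟨N, hN, -, -⟩ := exists_integrable_weight d
  obtain ⟨C, hC0, hC⟩ := exists_curve_density_le hh hg T N
  have h1 : Integrable (fun q : Space d × ℝ => C * ((1 + ‖q.1‖) ^ N)⁻¹) (liouvilleMeasure d T) :=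
    (hN.const_mul C).comp_fst _
  refine (hN.mul_const (∫ q : Space d × ℝ, C * ((1 + ‖q.1‖) ^ N)⁻¹ ∂(liouvilleMeasure d T))).mono'
    (continuous_marginal T hh hg).aestronglyMeasurable (.of_forall fun x => ?_)
  rw [← integral_const_mul]
  refine norm_integral_le_of_norm_le (h1.const_mul _) ?_
  filter_upwards [ae_prod_restrict_Icc_mem (volume : Measure (Space d)) T] with q hq
  refine (hC q.2 hq (x, q.1)).trans ?_
  rw [mul_left_comm _ C]
  exact mul_le_mul_of_nonneg_left (inv_one_add_norm_prod_le x q.1 N) hC0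

theorem fourierChar_eq_planeWave (x q : Space d) :
    (Real.fourierChar ⟪x, q⟫_ℝ : ℂ) = planeWave ((2 * Real.pi) • q) x := by
  rw [planeWave, Real.fourierChar_apply, inner_smul_left, real_inner_comm]
  simp only [conj_trivial]
  push_cast
  ring_nf

/-- Fubini in `(x, k, t)`: the Fourier phase in `x` joins the density, and the integral over phase
space is the pairing with a plane-wave multiplication. -/
theorem fourierInv_marginal (T : ℝ) (hh : Continuous h) (hg : Continuous g) :
    𝓕⁻ (marginal T h g) = marginalTransform T h g := by
  obtain ⟨N, -, -, hN⟩ := exists_integrable_weight d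
  obtain ⟨C, hC0, hC⟩ := exists_curve_density_le hh hg T N
  ext q
  have ht := hasTemperateGrowth_planeWave_fst ((2 * Real.pi) • q)
  set Θ : (Space d × Space d) × ℝ → ℂ := fun y =>
    planeWave ((2 * Real.pi) • q) y.1.1 * ((starRingEnd ℂ) (g y.2 y.1) * h y.2 y.1) with hΘ
  have hI : Integrable Θ ((volume : Measure (Space d × Space d)).prod
      (volume.restrict (Set.Icc 0 T))) := by
    refine integrable_prod_Icc_of_norm_le ?_ (hN.const_mul C) fun w t ht => ?_
    · exact ((contDiff_planeWave _).continuous.comp (continuous_fst.comp continuous_fst)).mul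
        (continuous_curve_density hh hg)
    · rw [hΘ, norm_mul, norm_planeWave, one_mul]
      refine (hC t ht w).trans ?_
      gcongr
      refine mul_le_of_le_one_left (by positivity) ?_
      exact inv_le_one_of_one_le₀ (one_le_pow₀ (le_add_of_nonneg_right (norm_nonneg w)))
  calc 𝓕⁻ (marginal T h g) q = ∫ x, ∫ y : Space d × ℝ, Θ ((x, y.1), y.2) ∂(liouvilleMeasure d T) := by
        rw [Real.fourierInv_eq]
        congr 1 with x
        rw [Circle.smul_def, fourierChar_eq_planeWave, smul_eq_mul, marginal, ← integral_const_mul]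
    _ = ∫ x, ∫ k, ∫ t in Set.Icc 0 T, Θ ((x, k), t) := by
        congr 1 with x
        have h1 : Integrable (fun y : Space d × ℝ => Θ ((x, y.1), y.2)) (liouvilleMeasure d T) :=
          (integrable_marginal_integrand T hh hg x).const_mul (planeWave ((2 * Real.pi) • q) x)
        exact integral_prod _ h1
    _ = ∫ w : Space d × Space d, ∫ t in Set.Icc 0 T, Θ (w, t) :=
        (integral_prod _ hI.integral_prod_left).symm
    _ = ∫ t in Set.Icc 0 T, ∫ w : Space d × Space d, Θ (w, t) := integral_integral_swap hI
    _ = _ := by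
        rw [marginalTransform]
        congr 1 with t
        rw [l2inner_eq]
        congr 1 with w
        rw [mulOp_apply ht]
        simp only [hΘ]
        ring

theorem exists_marginalTransform_le (T : ℝ) (hh : Continuous h) (hg : Continuous g) (n : ℕ) :
    ∃ C, 0 ≤ C ∧ ∀ q, (1 + ‖q‖) ^ n * ‖marginalTransform T h g q‖ ≤ C := by
  obtain ⟨B₁, hB₁0, hB₁⟩ := exists_energy_le_of_continuous (n + 1) hh T
  obtain ⟨B₂, hB₂0, hB₂⟩ := exists_energy_le_of_continuous (n + 1) hg T
  refine ⟨(1 + 2 * d) ^ n * 1 * max B₁ B₂ * (volume.real (Set.Icc 0 T)), by positivity, fun q => ?_⟩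
  have h1 : ∀ t ∈ Set.Icc 0 T, ‖l2inner (g t) (mulOp (fun w => planeWave ((2 * Real.pi) • q) w.1)
      (h t))‖ ≤ ((1 + ‖q‖) ^ n)⁻¹ * ((1 + 2 * d) ^ n * 1 * max B₁ B₂) := by
    intro t ht
    rw [← div_eq_inv_mul, le_div_iff₀ (by positivity), mul_comm]
    refine le_trans ?_ (one_add_norm_pow_mul_mulOp_le ((2 * Real.pi) • q) n
      ((hB₁ t ht).trans (le_max_left _ _)) ((hB₂ t ht).trans (le_max_right _ _)))
    gcongr
    rw [norm_smul, Real.norm_of_nonneg (by positivity)]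
    exact le_mul_of_one_le_left (norm_nonneg _) (by linarith [Real.pi_gt_three])
  have h2 := norm_setIntegral_le_of_norm_le_const (μ := volume)
    (measure_Icc_lt_top (μ := volume) (a := (0 : ℝ)) (b := T)) h1
  calc _ ≤ (1 + ‖q‖) ^ n * (((1 + ‖q‖) ^ n)⁻¹ * ((1 + 2 * d) ^ n * 1 * max B₁ B₂) *
        volume.real (Set.Icc 0 T)) := by
        gcongr
        exact h2
    _ = _ := by field_simp

theorem continuous_marginalTransform (T : ℝ) (hh : Continuous h) (hg : Continuous g) :
    Continuous (marginalTransform T h g) := by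
  rw [← fourierInv_marginal T hh hg]
  have h1 : 𝓕⁻ (marginal T h g) = fun x => 𝓕 (marginal T h g) (-x) := by
    ext x; exact Real.fourierInv_eq_fourier_neg _ _
  rw [h1]
  exact (VectorFourier.fourierIntegral_continuous Real.continuous_fourierChar continuous_inner
    (integrable_marginal T hh hg)).comp continuous_neg

theorem integrable_norm_pow_mul_marginalTransform (T : ℝ) (hh : Continuous h) (hg : Continuous g)
    {a : Space d → ℂ} (ha : Continuous a) (ha' : ∀ q, ‖a q‖ ≤ 1 + ‖q‖) :
    Integrable fun q => a q * marginalTransform T h g q := by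
  obtain ⟨N, hN, -, -⟩ := exists_integrable_weight d
  obtain ⟨C, hC0, hC⟩ := exists_marginalTransform_le T hh hg (N + 1)
  refine (hN.const_mul C).mono'
    (ha.mul (continuous_marginalTransform T hh hg)).aestronglyMeasurable (.of_forall fun q => ?_)
  rw [norm_mul, ← div_eq_mul_inv, le_div_iff₀ (by positivity)]
  refine le_trans ?_ (hC q)
  calc _ ≤ (1 + ‖q‖) * ‖marginalTransform T h g q‖ * (1 + ‖q‖) ^ N := by gcongr; exact ha' q
    _ = _ := by ring

theorem integrable_marginalTransform (T : ℝ) (hh : Continuous h) (hg : Continuous g) :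
    Integrable (marginalTransform T h g) := by
  simpa using integrable_norm_pow_mul_marginalTransform T hh hg (a := fun _ => 1) continuous_const
    (fun q => by simp)

/-- Fourier inversion for a continuous integrable function whose transform decays rapidly.
Differentiability of the marginal is then read off from the decay on the frequency side. -/
theorem marginal_eq_fourier (T : ℝ) (hh : Continuous h) (hg : Continuous g) :
    marginal T h g = 𝓕 (marginalTransform T h g) := by
  have h1 := integrable_marginalTransform T hh hg
  rw [← fourierInv_marginal T hh hg] at h1 ⊢
  have h2 : Integrable (𝓕 (marginal T h g)) := by
    have := h1.comp_neg
    refine this.congr (.of_forall fun x => ?_)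
    simp only [Real.fourierInv_eq_fourier_neg, neg_neg]
  exact ((continuous_marginal T hh hg).fourier_fourierInv_eq (integrable_marginal T hh hg) h2).symm

theorem integrable_norm_mul_marginalTransform (T : ℝ) (hh : Continuous h) (hg : Continuous g) :
    Integrable fun q => ‖q‖ * ‖marginalTransform T h g q‖ := by
  have := (integrable_norm_pow_mul_marginalTransform T hh hg (a := fun q => (‖q‖ : ℂ))
    (by fun_prop) (fun q => by simp)).norm
  simpa using this

theorem differentiable_marginal (T : ℝ) (hh : Continuous h) (hg : Continuous g) :
    Differentiable ℝ (marginal T h g) := by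
  rw [marginal_eq_fourier T hh hg]
  exact Real.differentiable_fourier (integrable_marginalTransform T hh hg)
    (integrable_norm_mul_marginalTransform T hh hg)

theorem fderiv_marginal_single (T : ℝ) (hh : Continuous h) (hg : Continuous g) (x : Space d)
    (j : Fin d) : fderiv ℝ (marginal T h g) x (EuclideanSpace.single j 1) =
      𝓕 (fun q => -(2 * Real.pi * Complex.I * (q j : ℂ)) * marginalTransform T h g q) x := by
  have hi := integrable_marginalTransform T hh hg
  have hi' := integrable_norm_mul_marginalTransform T hh hg
  rw [marginal_eq_fourier T hh hg, Real.fderiv_fourier hi hi',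
    Real.fourier_continuousLinearMap_apply]
  · refine congrFun (congrArg 𝓕 (funext fun q => ?_)) x
    rw [VectorFourier.fourierSMulRight_apply]
    have h1 : innerSL ℝ q (EuclideanSpace.single j (1 : ℝ)) = q j := by
      rw [innerSL_apply_apply, EuclideanSpace.inner_single_right]
      simp
    rw [h1, Complex.real_smul, smul_eq_mul]
    ring
  · refine (hi'.const_mul (2 * Real.pi * ‖innerSL ℝ (E := Space d)‖)).mono' ?_
      (.of_forall fun q => ?_)
    · exact (continuous_marginalTransform T hh hg).aestronglyMeasurable.fourierSMulRight
    · refine (VectorFourier.norm_fourierSMulRight_le _ _ _).trans (le_of_eq ?_)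
      ring

end Marginal

/-! ### The Liouville representative as a Fourier transform -/

theorem liouvilleFlux_eq_marginal (T : ℝ) (f g : ℝ → PhaseFun d) (j : Fin d) :
    liouvilleFlux T f g j = marginal T (fun t => ∂_{momDir j} (f t)) g := rfl

/-- The inverse Fourier transform of the Liouville representative. -/
def liouvilleTransform (T : ℝ) (f g : ℝ → PhaseFun d) (q : Space d) : ℂ :=
  ∫ t in Set.Icc 0 T, l2inner (g t) (forceCLM (planeWave ((2 * Real.pi) • q)) (f t))

section Liouville

variable {f g : ℝ → PhaseFun d}

theorem continuous_lineDeriv_curve (hf : Continuous f) (v : Space d × Space d) :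
    Continuous fun t => (∂_{v} (f t) : PhaseFun d) :=
  (LineDeriv.lineDerivOpCLM ℂ (PhaseFun d) v).continuous.comp hf

theorem integrable_liouvilleIntegrand (T : ℝ) (hf : Continuous f) (hg : Continuous g) (j : Fin d)
    (x : Space d) : Integrable (liouvilleIntegrand f g j x) (liouvilleMeasure d T) :=
  integrable_marginal_integrand T (continuous_lineDeriv_curve hf (momDir j)) hg x

theorem differentiable_liouvilleFlux (T : ℝ) (hf : Continuous f) (hg : Continuous g) (j : Fin d) :
    Differentiable ℝ (liouvilleFlux T f g j) := by
  rw [liouvilleFlux_eq_marginal]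
  exact differentiable_marginal T (continuous_lineDeriv_curve hf (momDir j)) hg

theorem liouvilleTransform_eq_sum (T : ℝ) (hf : Continuous f) (hg : Continuous g) (q : Space d) :
    liouvilleTransform T f g q = ∑ j : Fin d, (2 * Real.pi * Complex.I * (q j : ℂ)) *
      marginalTransform T (fun t => ∂_{momDir j} (f t)) g q := by
  set p := (2 * Real.pi) • q with hp
  have h1 : ∀ t, l2inner (g t) (forceCLM (planeWave p) (f t)) =
      ∑ j : Fin d, (2 * Real.pi * Complex.I * (q j : ℂ)) *
        l2inner (g t) (mulOp (fun w => planeWave p w.1) (∂_{momDir j} (f t))) := by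
    intro t
    have h3 : ∀ g f : PhaseFun d, l2inner g f = innerSL ℂ (g.toLp 2 volume)
      (toLpCLM ℂ ℂ 2 volume f) := fun g f => rfl
    rw [forceCLM_planeWave, h3, map_sum, map_sum]
    refine Finset.sum_congr rfl fun j _ => ?_
    rw [map_smul, map_smul, ← h3, smul_eq_mul, hp]
    simp
    ring_nf
    simp
  have h2 : ∀ j : Fin d, Continuous fun t =>
      l2inner (g t) (mulOp (fun w => planeWave p w.1) (∂_{momDir j} (f t))) := fun j =>
    continuous_l2inner ((mulOp _).continuous.comp (continuous_lineDeriv_curve hf (momDir j))) hg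
  simp only [liouvilleTransform, marginalTransform, ← hp, h1]
  rw [integral_finsetSum _ fun j _ =>
    ((h2 j).continuousOn.integrableOn_compact isCompact_Icc).const_mul _]
  exact Finset.sum_congr rfl fun j _ => integral_const_mul _ _

theorem integrable_coord_mul_marginalTransform (T : ℝ) (hf : Continuous f) (hg : Continuous g)
    (j : Fin d) : Integrable fun q : Space d =>
      (2 * Real.pi * Complex.I * (q j : ℂ)) * marginalTransform T f g q := by
  have h1 := (integrable_norm_pow_mul_marginalTransform T hf hg (a := fun q => (q j : ℂ))
    (Complex.continuous_ofReal.comp (EuclideanSpace.proj (𝕜 := ℝ) j).continuous) fun q => by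
      rw [Complex.norm_real]
      exact (PiLp.norm_apply_le q j).trans (le_add_of_nonneg_left zero_le_one)).const_mul
    (2 * Real.pi * Complex.I)
  simpa [mul_assoc] using h1

theorem integrable_liouvilleTransform (T : ℝ) (hf : Continuous f) (hg : Continuous g) :
    Integrable (liouvilleTransform T f g) := by
  have h1 : liouvilleTransform T f g = fun q => ∑ j : Fin d, (2 * Real.pi * Complex.I * (q j : ℂ)) *
      marginalTransform T (fun t => ∂_{momDir j} (f t)) g q :=
    funext fun q => liouvilleTransform_eq_sum T hf hg q
  rw [h1]
  exact integrable_finsetSum _ fun j _ =>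
    integrable_coord_mul_marginalTransform T (continuous_lineDeriv_curve hf (momDir j)) hg j

/-- Under the forward transform each derivative `∂_{xⱼ}` of the flux becomes the factor `-2πi qⱼ`;
its sign cancels the one in front of the divergence, leaving the symbol of `∇e_p·∇ₖ` at `p = 2πq`.
-/
theorem liouvilleRep_eq_fourier (T : ℝ) (hf : Continuous f) (hg : Continuous g) :
    liouvilleRep T f g = 𝓕 (liouvilleTransform T f g) := by
  ext x
  have hi := fun j : Fin d => integrable_coord_mul_marginalTransform T
    (continuous_lineDeriv_curve hf (momDir j)) hg j
  have h1 : 𝓕 (liouvilleTransform T f g) x = ∑ j : Fin d,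
      𝓕 (fun q => (2 * Real.pi * Complex.I * (q j : ℂ)) *
        marginalTransform T (fun t => ∂_{momDir j} (f t)) g q) x := by
    simp only [Real.fourier_eq, liouvilleTransform_eq_sum T hf hg, Finset.smul_sum]
    exact integral_finsetSum _ fun j _ => (Real.fourierIntegral_convergent_iff x).2 (hi j)
  rw [liouvilleRep, h1, ← Finset.sum_neg_distrib]
  refine Finset.sum_congr rfl fun j _ => ?_
  rw [liouvilleFlux_eq_marginal, fderiv_marginal_single T
    (continuous_lineDeriv_curve hf (momDir j)) hg, Real.fourier_eq, Real.fourier_eq,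
    ← integral_neg]
  congr 1 with q
  rw [neg_mul, smul_neg, neg_neg]

end Liouville

/-! ### The Wigner representative as a Fourier transform -/

section Wigner

variable {f g : ℝ → PhaseFun d}

/-- A large shift `c` forces the original or the shifted point to be far from the origin,
quantitatively `1 + ‖c‖ ≤ (1 + ‖w‖)(1 + ‖(w.1, w.2 + c)‖)`. The decay of `g` is used with exponent
`N + N`: once for the shift and once for integrability in `w`. -/
theorem exists_shifted_density_le (hf : Continuous f) (hg : Continuous g) (T : ℝ) (N : ℕ) :
    ∃ C, 0 ≤ C ∧ ∀ t ∈ Set.Icc 0 T, ∀ (w : Space d × Space d) (c : Space d),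
      ‖g t w‖ * ‖f t (w.1, w.2 + c)‖ ≤ C * (((1 + ‖c‖) ^ N)⁻¹ * ((1 + ‖w‖) ^ N)⁻¹) := by
  obtain ⟨C₁, h10, h1⟩ := exists_weighted_bound_of_continuous hf T N
  obtain ⟨C₂, h20, h2⟩ := exists_weighted_bound_of_continuous hg T (N + N)
  refine ⟨C₂ * C₁, by positivity, fun t ht w c => ?_⟩
  rw [← mul_inv, ← div_eq_mul_inv, le_div_iff₀ (by positivity)]
  have h3 : 1 + ‖c‖ ≤ (1 + ‖w‖) * (1 + ‖(w.1, w.2 + c)‖) := by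
    have h4 : ‖w.2 + c‖ ≤ ‖(w.1, w.2 + c)‖ := le_max_right _ _
    have h5 : ‖w.2‖ ≤ ‖w‖ := le_max_right _ _
    have h6 : ‖c‖ ≤ ‖w.2 + c‖ + ‖w.2‖ := by
      simpa using norm_sub_le (w.2 + c) w.2
    nlinarith [norm_nonneg w, norm_nonneg (w.1, w.2 + c)]
  calc ‖g t w‖ * ‖f t (w.1, w.2 + c)‖ * ((1 + ‖c‖) ^ N * (1 + ‖w‖) ^ N)
      ≤ ‖g t w‖ * ‖f t (w.1, w.2 + c)‖ *
        (((1 + ‖w‖) * (1 + ‖(w.1, w.2 + c)‖)) ^ N * (1 + ‖w‖) ^ N) := by gcongr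
    _ = ((1 + ‖w‖) ^ (N + N) * ‖g t w‖) *
        ((1 + ‖(w.1, w.2 + c)‖) ^ N * ‖f t (w.1, w.2 + c)‖) := by rw [mul_pow, pow_add]; ring
    _ ≤ C₂ * C₁ := by
        gcongr
        · exact h2 t ht w
        · exact h1 t ht _

/-- The constant contains `1/ε`; this bound serves only absolute convergence and Fubini at fixed
`ε`, never the limit. -/
theorem exists_wigner_density_le (hf : Continuous f) (hg : Continuous g) (T : ℝ) {ε : ℝ}
    (hε : 0 < ε) (N : ℕ) :
    ∃ C, 0 ≤ C ∧ ∀ t ∈ Set.Icc 0 T, ∀ (w : Space d × Space d) (p : Space d),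
      ‖(starRingEnd ℂ) (g t w) * momentumDiff ε (f t) w.1 w.2 p‖ ≤
        C * (((1 + ‖(ε / 2) • p‖) ^ N)⁻¹ * ((1 + ‖w‖) ^ N)⁻¹) := by
  obtain ⟨C, hC0, hC⟩ := exists_shifted_density_le hf hg T N
  refine ⟨(C + C) / ε, by positivity, fun t ht w p => ?_⟩
  have h1 := hC t ht w ((ε / 2) • p)
  have h2 := hC t ht w (-((ε / 2) • p))
  rw [norm_neg, ← sub_eq_add_neg] at h2
  rw [norm_mul, RCLike.norm_conj, momentumDiff, norm_div, Complex.norm_real,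
    Real.norm_of_nonneg hε.le, ← mul_div_assoc, div_mul_eq_mul_div]
  refine div_le_div_of_nonneg_right ?_ hε.le
  calc _ ≤ ‖g t w‖ * (‖f t (w.1, w.2 + (ε / 2) • p)‖ + ‖f t (w.1, w.2 - (ε / 2) • p)‖) := by
        gcongr
        exact norm_sub_le _ _
    _ ≤ _ := by rw [mul_add, add_mul]; exact add_le_add h1 h2

theorem continuous_wignerIntegrand (hf : Continuous f) (hg : Continuous g) (ε : ℝ) (x : Space d) :
    Continuous (wignerIntegrand ε f g x) := by
  have hc : ∀ c : ℝ, Continuous fun q : (Space d × Space d × Space d) × ℝ =>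
      f q.2 (q.1.2.1, q.1.2.2 + c • q.1.1) := fun c =>
    (continuous_eval_curve hf).comp (continuous_snd.prodMk ((by fun_prop :
      Continuous fun q : (Space d × Space d × Space d) × ℝ => q.1.2.1).prodMk (by fun_prop)))
  have hgc : Continuous fun q : (Space d × Space d × Space d) × ℝ => g q.2 (q.1.2.1, q.1.2.2) :=
    (continuous_eval_curve hg).comp (continuous_snd.prodMk ((by fun_prop :
      Continuous fun q : (Space d × Space d × Space d) × ℝ => q.1.2.1).prodMk (by fun_prop)))
  have he : Continuous fun q : (Space d × Space d × Space d) × ℝ =>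
      Complex.exp (Complex.I * (⟪q.1.1, q.1.2.1 - x⟫_ℝ : ℂ)) :=
    (continuous_const.mul (Complex.continuous_ofReal.comp
      (Continuous.inner (by fun_prop) (by fun_prop)))).cexp
  have h1 := (he.mul (Complex.continuous_conj.comp hgc)).mul
    (((hc (ε / 2)).sub (hc (-(ε / 2)))).div_const (ε : ℂ))
  refine h1.congr fun q => ?_
  obtain ⟨⟨p, z, k⟩, t⟩ := q
  simp only [wignerIntegrand, momentumDiff, neg_smul, ← sub_eq_add_neg]
  rfl

theorem wignerIntegrand_eq (ε : ℝ) (x p : Space d) (w : Space d × Space d) (t : ℝ) :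
    wignerIntegrand ε f g x ((p, w), t) = planeWave p (-x) * (planeWave p w.1 *
      ((starRingEnd ℂ) (g t w) * momentumDiff ε (f t) w.1 w.2 p)) := by
  have h1 : wignerIntegrand ε f g x ((p, w), t) = planeWave p (w.1 - x) * (starRingEnd ℂ) (g t w) *
      momentumDiff ε (f t) w.1 w.2 p := rfl
  rw [h1, sub_eq_add_neg, planeWave_add]
  ring

theorem integrable_inv_one_add_norm_smul {N : ℕ}
    (hN : Integrable fun x : Space d => ((1 + ‖x‖) ^ N)⁻¹) {c : ℝ} (hc : c ≠ 0) :
    Integrable fun x : Space d => ((1 + ‖c • x‖) ^ N)⁻¹ := hN.comp_smul hc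

theorem integrable_wignerIntegrand (T : ℝ) (hf : Continuous f) (hg : Continuous g) {ε : ℝ}
    (hε : 0 < ε) (x : Space d) : Integrable (wignerIntegrand ε f g x) (wignerMeasure d T) := by
  obtain ⟨N, hN, -, hN2⟩ := exists_integrable_weight d
  obtain ⟨C, hC0, hC⟩ := exists_wigner_density_le hf hg T hε N
  have hb : Integrable (fun q : Space d × Space d × Space d =>
      C * (((1 + ‖(ε / 2) • q.1‖) ^ N)⁻¹ * ((1 + ‖q.2‖) ^ N)⁻¹)) :=
    ((integrable_inv_one_add_norm_smul hN (by positivity)).mul_prod hN2).const_mul C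
  refine integrable_prod_Icc_of_norm_le (continuous_wignerIntegrand hf hg ε x) hb fun a t ht => ?_
  obtain ⟨p, w⟩ := a
  rw [wignerIntegrand_eq, norm_mul, norm_mul, norm_planeWave, norm_planeWave, one_mul, one_mul]
  exact hC t ht w p

/-- The oscillatory pairing integrated over `[0, T]`, as a function of the frequency. -/
def wignerPairing (ε T : ℝ) (f g : ℝ → PhaseFun d) (p : Space d) : ℂ :=
  ∫ t in Set.Icc 0 T, l2inner (g t) (wignerCLM (planeWave p) ε (f t))

/-- The inverse Fourier transform of the Wigner representative. -/
def wignerTransform (ε T : ℝ) (f g : ℝ → PhaseFun d) (q : Space d) : ℂ :=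
  wignerPairing ε T f g ((2 * Real.pi) • q)

/-- At fixed `p` the factor `e^{ip·z} D^ε f` is, up to `i`, the plane-wave Wigner operator applied
to `f`, and the dependence on `x` separates as a phase. -/
theorem integral_wignerIntegrand_frequency (T : ℝ) (hf : Continuous f) (hg : Continuous g) {ε : ℝ}
    (hε : 0 < ε) (x p : Space d) :
    Complex.I * ∫ w : Space d × Space d, ∫ t in Set.Icc 0 T, wignerIntegrand ε f g x ((p, w), t) =
      planeWave p (-x) * wignerPairing ε T f g p := by
  obtain ⟨N, hN, -, hN2⟩ := exists_integrable_weight d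
  obtain ⟨C, hC0, hC⟩ := exists_wigner_density_le hf hg T hε N
  have hI : Integrable (fun y : (Space d × Space d) × ℝ =>
      wignerIntegrand ε f g x ((p, y.1), y.2))
      ((volume : Measure (Space d × Space d)).prod (volume.restrict (Set.Icc 0 T))) := by
    refine integrable_prod_Icc_of_norm_le ((continuous_wignerIntegrand hf hg ε x).comp
      ((continuous_const.prodMk continuous_fst).prodMk continuous_snd))
      (hN2.const_mul (C * ((1 + ‖(ε / 2) • p‖) ^ N)⁻¹)) fun w t ht => ?_
    rw [wignerIntegrand_eq, norm_mul, norm_mul, norm_planeWave, norm_planeWave,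
      one_mul, one_mul, mul_assoc]
    exact hC t ht w p
  rw [integral_integral_swap hI, ← integral_const_mul, wignerPairing, ← integral_const_mul]
  congr 1 with t
  rw [l2inner_eq, ← integral_const_mul, ← integral_const_mul]
  congr 1 with w
  rw [wignerIntegrand_eq, show w = (w.1, w.2) from rfl, wignerCLM_planeWave_apply]
  ring

theorem integrable_wignerPairing (T : ℝ) (hf : Continuous f) (hg : Continuous g) {ε : ℝ}
    (hε : 0 < ε) : Integrable (wignerPairing ε T f g) := by
  have h1 := (((integrable_wignerIntegrand T hf hg hε 0).integral_prod_left).integral_prod_left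
    ).const_mul Complex.I
  refine h1.congr (.of_forall fun p => ?_)
  have h2 := integral_wignerIntegrand_frequency T hf hg hε 0 p
  have h3 : planeWave p (-0) = 1 := by simp [planeWave]
  rw [h3, one_mul] at h2
  exact h2

theorem integrable_wignerTransform (T : ℝ) (hf : Continuous f) (hg : Continuous g) {ε : ℝ}
    (hε : 0 < ε) : Integrable (wignerTransform ε T f g) :=
  (integrable_wignerPairing T hf hg hε).comp_smul (by positivity)

theorem wignerRep_eq_fourier (T : ℝ) (hf : Continuous f) (hg : Continuous g) {ε : ℝ}
    (hε : 0 < ε) : wignerRep ε T f g = 𝓕 (wignerTransform ε T f g) := by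
  ext x
  have hI := integrable_wignerIntegrand T hf hg hε x
  have h1 : ∫ q, wignerIntegrand ε f g x q ∂(wignerMeasure d T) =
      ∫ p, ∫ w : Space d × Space d, ∫ t in Set.Icc 0 T, wignerIntegrand ε f g x ((p, w), t) :=
    (integral_prod _ hI).trans (integral_prod _ hI.integral_prod_left)
  have h2 : 𝓕 (wignerTransform ε T f g) x =
      ∫ q : Space d, (fun p => planeWave p (-x) * wignerPairing ε T f g p) ((2 * Real.pi) • q) := by
    rw [Real.fourier_eq]
    congr 1 with q
    have h3 : (Real.fourierChar (-⟪q, x⟫_ℝ) : ℂ) = planeWave ((2 * Real.pi) • q) (-x) := by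
      rw [← fourierChar_eq_planeWave, inner_neg_left, real_inner_comm]
    exact congrArg (· * wignerTransform ε T f g q) h3
  rw [h2]
  -- The change of variables `p = 2πq` has Jacobian `(2π)⁻ᵈ`, the normalisation in the
  -- representative.
  refine Eq.trans ?_ (Measure.integral_comp_smul volume
    (fun p : Space d => planeWave p (-x) * wignerPairing ε T f g p) (2 * Real.pi)).symm
  rw [wignerRep, h1, div_eq_mul_inv, mul_comm Complex.I, mul_assoc,
    ← integral_const_mul]
  simp_rw [integral_wignerIntegrand_frequency T hf hg hε]
  rw [abs_of_nonneg (by positivity), Complex.real_smul]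
  simp

end Wigner

/-! ### Independence of the values outside `[0, T]` -/

theorem wignerIntegrand_ae_eq {T : ℝ} {f g F G : ℝ → PhaseFun d}
    (hf : ∀ t ∈ Set.Icc 0 T, F t = f t) (hg : ∀ t ∈ Set.Icc 0 T, G t = g t) (ε : ℝ) (x : Space d) :
    wignerIntegrand ε F G x =ᵐ[wignerMeasure d T] wignerIntegrand ε f g x := by
  filter_upwards [ae_prod_restrict_Icc_mem (volume : Measure (Space d × Space d × Space d)) T]
    with q hq
  obtain ⟨⟨p, w⟩, t⟩ := q
  rw [wignerIntegrand_eq, wignerIntegrand_eq, hf t hq, hg t hq]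

theorem wignerRep_congr {T : ℝ} {f g F G : ℝ → PhaseFun d}
    (hf : ∀ t ∈ Set.Icc 0 T, F t = f t) (hg : ∀ t ∈ Set.Icc 0 T, G t = g t) (ε : ℝ) :
    wignerRep ε T F G = wignerRep ε T f g := by
  ext x
  rw [wignerRep, wignerRep, integral_congr_ae (wignerIntegrand_ae_eq hf hg ε x)]

theorem liouvilleIntegrand_ae_eq {T : ℝ} {f g F G : ℝ → PhaseFun d}
    (hf : ∀ t ∈ Set.Icc 0 T, F t = f t) (hg : ∀ t ∈ Set.Icc 0 T, G t = g t) (j : Fin d)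
    (x : Space d) :
    liouvilleIntegrand F G j x =ᵐ[liouvilleMeasure d T] liouvilleIntegrand f g j x := by
  filter_upwards [ae_prod_restrict_Icc_mem (volume : Measure (Space d)) T] with q hq
  obtain ⟨k, t⟩ := q
  simp only [liouvilleIntegrand, hf t hq, hg t hq]

theorem liouvilleFlux_congr {T : ℝ} {f g F G : ℝ → PhaseFun d}
    (hf : ∀ t ∈ Set.Icc 0 T, F t = f t) (hg : ∀ t ∈ Set.Icc 0 T, G t = g t) (j : Fin d) :
    liouvilleFlux T F G j = liouvilleFlux T f g j := by
  ext x
  exact integral_congr_ae (liouvilleIntegrand_ae_eq hf hg j x)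

theorem liouvilleRep_congr {T : ℝ} {f g F G : ℝ → PhaseFun d}
    (hf : ∀ t ∈ Set.Icc 0 T, F t = f t) (hg : ∀ t ∈ Set.Icc 0 T, G t = g t) :
    liouvilleRep T F G = liouvilleRep T f g := by
  ext x
  simp only [liouvilleRep, liouvilleFlux_congr hf hg]

/-! ### Uniform convergence of the solutions in time -/

/-- A family of curves of Schwartz functions which on `[0, T]` converges in `L²` uniformly in time,
with uniform bounds on the `L²` norms of all derivatives. -/
structure ConvergesOnInterval (T : ℝ) (F : ℝ → ℝ → PhaseFun d) (F₀ : ℝ → PhaseFun d) : Prop where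
  continuous : ∀ ε, 0 < ε → Continuous (F ε)
  continuous_limit : Continuous F₀
  bounded : ∀ m, ∃ B, 0 ≤ B ∧ ∀ᶠ ε in 𝓝[>] (0 : ℝ), ∀ t ∈ Set.Icc 0 T, energy m (F ε t) ≤ B
  tendsto : ∃ a : ℝ → ℝ, Tendsto a (𝓝[>] 0) (𝓝 0) ∧
    ∀ᶠ ε in 𝓝[>] (0 : ℝ), ∀ t ∈ Set.Icc 0 T, l2norm (F ε t - F₀ t) ≤ a ε

theorem convergesOnInterval_of_isCurve {V : Space d → ℝ} (hV : IsAdmissiblePotential V)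
    {T : ℝ} {F : ℝ → ℝ → PhaseFun d} {F₀ : ℝ → PhaseFun d}
    (hF : ∀ ε, 0 < ε → IsCurve T (F ε) (fun t => wignerGen (fun x => (V x : ℂ)) ε (F ε t)))
    (hF₀ : IsCurve T F₀ (fun t => liouvilleGen (fun x => (V x : ℂ)) (F₀ t)))
    {u : ℝ → PhaseFun d} {u₀ : PhaseFun d} (hu : ConvergesRegularly u u₀) {s : ℝ}
    (hs : s ∈ Set.Icc 0 T) (hFs : ∀ ε, 0 < ε → F ε s = u ε) (hF₀s : F₀ s = u₀) :
    ConvergesOnInterval T F F₀ := by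
  refine ⟨fun ε hε => (hF ε hε).continuous, hF₀.continuous, fun m => ?_, ?_⟩
  · obtain ⟨C, hC0, hC⟩ := exists_energy_wigner_le hV T m
    obtain ⟨B, hB0, hB⟩ := hu.exists_energy_le m
    refine ⟨C * B, by positivity, ?_⟩
    filter_upwards [hB, self_mem_nhdsWithin] with ε hε (hε0 : 0 < ε) t ht
    refine (hC ε hε0 _ (hF ε hε0) s hs t ht).trans ?_
    rw [hFs ε hε0]
    gcongr
  · obtain ⟨K, hK0, hK⟩ := exists_l2norm_wigner_sub_liouville_le hV hF₀
    refine ⟨fun ε => √(Real.exp T * (l2norm (u ε - u₀) ^ 2 + K * ε ^ 2)), ?_, ?_⟩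
    · have h1 : Tendsto (fun ε : ℝ => ε) (𝓝[>] 0) (𝓝 0) := tendsto_id'.2 nhdsWithin_le_nhds
      have h2 := ((((hu.tendsto_l2norm).pow 2).add ((h1.pow 2).const_mul K)).const_mul
        (Real.exp T)).sqrt
      simpa using h2
    · filter_upwards [self_mem_nhdsWithin] with ε (hε0 : 0 < ε) t ht
      have h3 := hK ε hε0 _ (hF ε hε0) s hs t ht
      rw [hFs ε hε0, hF₀s] at h3
      exact Real.le_sqrt_of_sq_le h3

theorem norm_le_norm_two_pi_smul (q : Space d) : ‖q‖ ≤ ‖(2 * Real.pi) • q‖ := by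
  rw [norm_smul, Real.norm_of_nonneg (by positivity)]
  exact le_mul_of_one_le_left (norm_nonneg _) (by linarith [Real.pi_gt_three])

theorem exists_liouvilleTransform_le (T : ℝ) {f g : ℝ → PhaseFun d} (hf : Continuous f)
    (hg : Continuous g) (n : ℕ) :
    ∃ C, 0 ≤ C ∧ ∀ q, (1 + ‖q‖) ^ n * ‖liouvilleTransform T f g q‖ ≤ C := by
  choose C hC0 hC using fun j : Fin d =>
    exists_marginalTransform_le T (continuous_lineDeriv_curve hf (momDir j)) hg (n + 1)
  refine ⟨∑ j, 2 * Real.pi * C j, Finset.sum_nonneg fun j _ => mul_nonneg (by positivity) (hC0 j),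
    fun q => ?_⟩
  rw [liouvilleTransform_eq_sum T hf hg]
  calc _ ≤ (1 + ‖q‖) ^ n * ∑ j : Fin d, ‖(2 * Real.pi * Complex.I * (q j : ℂ)) *
        marginalTransform T (fun t => ∂_{momDir j} (f t)) g q‖ := by
        gcongr
        exact norm_sum_le _ _
    _ ≤ _ := by
        rw [Finset.mul_sum]
        refine Finset.sum_le_sum fun j _ => ?_
        have h1 : ‖(2 * Real.pi * Complex.I * (q j : ℂ))‖ ≤ 2 * Real.pi * (1 + ‖q‖) := by
          rw [norm_mul, norm_mul, norm_mul, Complex.norm_I, Complex.norm_real, Complex.norm_real,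
            Real.norm_of_nonneg Real.pi_pos.le, mul_one, Complex.norm_two]
          gcongr
          exact (PiLp.norm_apply_le q j).trans (le_add_of_nonneg_left zero_le_one)
        rw [norm_mul]
        calc _ ≤ (1 + ‖q‖) ^ n * ((2 * Real.pi * (1 + ‖q‖)) *
              ‖marginalTransform T (fun t => ∂_{momDir j} (f t)) g q‖) := by gcongr
          _ = 2 * Real.pi * ((1 + ‖q‖) ^ (n + 1) *
              ‖marginalTransform T (fun t => ∂_{momDir j} (f t)) g q‖) := by ring
          _ ≤ _ := by gcongr; exact hC j q

/-! ### Passage to the limit on the frequency side -/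

section Limit

variable {T : ℝ} {F G : ℝ → ℝ → PhaseFun d} {F₀ G₀ : ℝ → PhaseFun d}

theorem ConvergesOnInterval.exists_wignerTransform_le (hF : ConvergesOnInterval T F F₀)
    (hG : ConvergesOnInterval T G G₀) (n : ℕ) :
    ∃ C, 0 ≤ C ∧ ∀ᶠ ε in 𝓝[>] (0 : ℝ), ∀ q,
      (1 + ‖q‖) ^ n * ‖wignerTransform ε T (F ε) (G ε) q‖ ≤ C := by
  -- Decay of order `n` is extracted from the estimate with `n + 1` powers of `1 + ‖p‖`, which uses
  -- energies of order `n + 2`; the spare power cancels the factor `‖p‖` on its right-hand side.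
  obtain ⟨B₁, hB₁0, hB₁⟩ := hF.bounded (n + 1 + 1)
  obtain ⟨B₂, hB₂0, hB₂⟩ := hG.bounded (n + 1 + 1)
  refine ⟨(1 + 2 * d) ^ (n + 1) * √d * max B₁ B₂ * volume.real (Set.Icc 0 T), by positivity, ?_⟩
  filter_upwards [hB₁, hB₂, self_mem_nhdsWithin] with ε h1 h2 (hε : 0 < ε) q
  set p := (2 * Real.pi) • q with hp
  have h3 : ∀ t ∈ Set.Icc 0 T, ‖l2inner (G ε t) (wignerCLM (planeWave p) ε (F ε t))‖ ≤
      ((1 + ‖q‖) ^ n)⁻¹ * ((1 + 2 * d) ^ (n + 1) * √d * max B₁ B₂) := by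
    intro t ht
    rw [← div_eq_inv_mul, le_div_iff₀ (by positivity), mul_comm]
    have h4 := one_add_norm_pow_mul_wignerCLM_le p hε (n + 1)
      ((h1 t ht).trans (le_max_left B₁ B₂)) ((h2 t ht).trans (le_max_right B₁ B₂))
    have h5 : (1 + ‖q‖) ^ n ≤ (1 + ‖p‖) ^ n := by
      gcongr
      exact norm_le_norm_two_pi_smul q
    refine (mul_le_mul_of_nonneg_right h5 (norm_nonneg _)).trans ?_
    refine le_of_mul_le_mul_left ?_ (by positivity : 0 < 1 + ‖p‖)
    calc _ = (1 + ‖p‖) ^ (n + 1) * ‖l2inner (G ε t) (wignerCLM (planeWave p) ε (F ε t))‖ := by ring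
      _ ≤ (1 + 2 * d) ^ (n + 1) * (‖p‖ * √d) * max B₁ B₂ := h4
      _ = ‖p‖ * ((1 + 2 * d) ^ (n + 1) * √d * max B₁ B₂) := by ring
      _ ≤ _ := by
        gcongr
        linarith
  have h6 := norm_setIntegral_le_of_norm_le_const (μ := volume)
    (measure_Icc_lt_top (μ := volume) (a := (0 : ℝ)) (b := T)) h3
  calc _ ≤ (1 + ‖q‖) ^ n * (((1 + ‖q‖) ^ n)⁻¹ * ((1 + 2 * d) ^ (n + 1) * √d * max B₁ B₂) *
        volume.real (Set.Icc 0 T)) := by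
        gcongr
        exact h6
    _ = _ := by field_simp

/-- At a fixed frequency the constants may depend on `p`. First-order energies of the family are
bounded, second derivatives are needed only of the limit, and the two `L²` distances and `ε` tend to
zero. -/
theorem ConvergesOnInterval.tendsto_wignerTransform (hF : ConvergesOnInterval T F F₀)
    (hG : ConvergesOnInterval T G G₀) (q : Space d) :
    Tendsto (fun ε => wignerTransform ε T (F ε) (G ε) q) (𝓝[>] 0)
      (𝓝 (liouvilleTransform T F₀ G₀ q)) := by
  set p := (2 * Real.pi) • q with hp
  obtain ⟨B, hB0, hB⟩ := hF.bounded 1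
  obtain ⟨a, ha, hFa⟩ := hF.tendsto
  obtain ⟨b, hb, hGb⟩ := hG.tendsto
  obtain ⟨K, hK0, hK⟩ := exists_energy_le_of_continuous 1 hG.continuous_limit T
  choose M hM0 hM using fun j : Fin d => exists_l2norm_le_of_continuous
    (continuous_lineDeriv_curve (continuous_lineDeriv_curve hF.continuous_limit (momDir j))
      (momDir j)) T
  have hlim : Tendsto (fun ε => (b ε * (‖p‖ * (√d * √B)) + (‖p‖ * (√d * √K)) * a ε +
      √K * (‖p‖ ^ 2 * ε * ∑ j, M j)) * volume.real (Set.Icc 0 T)) (𝓝[>] 0) (𝓝 0) := by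
    have h1 : Tendsto (fun ε : ℝ => ε) (𝓝[>] 0) (𝓝 0) := tendsto_id'.2 nhdsWithin_le_nhds
    have h2 := (((hb.mul_const (‖p‖ * (√d * √B))).add (ha.const_mul (‖p‖ * (√d * √K)))).add
      (((h1.const_mul (‖p‖ ^ 2)).mul_const (∑ j, M j)).const_mul √K)).mul_const
        (volume.real (Set.Icc 0 T))
    simpa using h2
  rw [tendsto_iff_norm_sub_tendsto_zero]
  refine squeeze_zero' (.of_forall fun ε => norm_nonneg _) ?_ hlim
  filter_upwards [hB, hFa, hGb, self_mem_nhdsWithin] with ε h1 h2 h3 (hε : 0 < ε)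
  have hc1 : Continuous fun t => l2inner (G ε t) (wignerCLM (planeWave p) ε (F ε t)) :=
    continuous_l2inner ((wignerCLM _ ε).continuous.comp (hF.continuous ε hε)) (hG.continuous ε hε)
  have hc2 : Continuous fun t => l2inner (G₀ t) (forceCLM (planeWave p) (F₀ t)) :=
    continuous_l2inner ((forceCLM _).continuous.comp hF.continuous_limit) hG.continuous_limit
  have h4 : wignerTransform ε T (F ε) (G ε) q - liouvilleTransform T F₀ G₀ q =
      ∫ t in Set.Icc 0 T, (l2inner (G ε t) (wignerCLM (planeWave p) ε (F ε t)) -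
        l2inner (G₀ t) (forceCLM (planeWave p) (F₀ t))) :=
    (integral_sub (hc1.continuousOn.integrableOn_compact isCompact_Icc)
      (hc2.continuousOn.integrableOn_compact isCompact_Icc)).symm
  rw [h4]
  refine norm_setIntegral_le_of_norm_le_const
    (measure_Icc_lt_top (μ := volume) (a := (0 : ℝ)) (b := T)) fun t ht => ?_
  refine (norm_l2inner_wignerCLM_sub_forceCLM_le p hε (F ε t) (F₀ t) (G ε t) (G₀ t)).trans ?_
  have hb0 : 0 ≤ b ε := (l2norm_nonneg _).trans (h3 t ht)
  have hs1 : 0 ≤ ∑ j : Fin d, l2norm (∂_{momDir j} (F ε t)) :=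
    Finset.sum_nonneg fun j _ => l2norm_nonneg _
  have hs2 : 0 ≤ ∑ j : Fin d, l2norm (∂_{momDir j} (∂_{momDir j} (F₀ t))) :=
    Finset.sum_nonneg fun j _ => l2norm_nonneg _
  refine add_le_add (add_le_add ?_ ?_) ?_
  · exact mul_le_mul (h3 t ht) (mul_le_mul_of_nonneg_left (sum_l2norm_momDir_le_sqrt (h1 t ht))
      (norm_nonneg _)) (by positivity) hb0
  · exact mul_le_mul (mul_le_mul_of_nonneg_left (sum_l2norm_momDir_le_sqrt (hK t ht))
      (norm_nonneg _)) (h2 t ht) (l2norm_nonneg _) (by positivity)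
  · exact mul_le_mul (l2norm_le_sqrt_of_energy (hK t ht)) (mul_le_mul_of_nonneg_left
      (Finset.sum_le_sum fun j _ => hM j t ht) (by positivity)) (by positivity) (by positivity)

theorem fourier_sub_apply {h₁ h₂ : Space d → ℂ} (h1 : Integrable h₁) (h2 : Integrable h₂)
    (x : Space d) : 𝓕 (fun q => h₁ q - h₂ q) x = 𝓕 h₁ x - 𝓕 h₂ x := by
  simp only [Real.fourier_eq, smul_sub]
  exact integral_sub ((Real.fourierIntegral_convergent_iff x).2 h1)
    ((Real.fourierIntegral_convergent_iff x).2 h2)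

/-- Dominated convergence for Fourier transforms, uniformly and in `L²`. -/
theorem tendsto_fourier_of_dominated {A : ℝ → Space d → ℂ} {A₀ : Space d → ℂ} {N : ℕ} {C : ℝ}
    (hN : Integrable fun x : Space d => ((1 + ‖x‖) ^ N)⁻¹)
    (hN2 : Integrable fun x : Space d => (((1 + ‖x‖) ^ N)⁻¹) ^ 2)
    (hA : ∀ ε, 0 < ε → Integrable (A ε)) (hA₀ : Integrable A₀)
    (hb : ∀ᶠ ε in 𝓝[>] (0 : ℝ), ∀ q, ‖A ε q - A₀ q‖ ≤ C * ((1 + ‖q‖) ^ N)⁻¹)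
    (hlim : ∀ q, Tendsto (fun ε => A ε q) (𝓝[>] 0) (𝓝 (A₀ q))) :
    TendstoUniformly (fun ε => 𝓕 (A ε)) (𝓕 A₀) (𝓝[>] (0 : ℝ)) ∧
      Tendsto (fun ε => eLpNorm (fun x => 𝓕 (A ε) x - 𝓕 A₀ x) 2 volume) (𝓝[>] (0 : ℝ)) (𝓝 0) := by
  have hpos : ∀ᶠ ε in 𝓝[>] (0 : ℝ), 0 < ε := self_mem_nhdsWithin
  have hD : ∀ ε, 0 < ε → Integrable (fun q => A ε q - A₀ q) := fun ε hε => (hA ε hε).sub hA₀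
  have hlim' : ∀ q, Tendsto (fun ε => ‖A ε q - A₀ q‖) (𝓝[>] 0) (𝓝 0) := fun q =>
    tendsto_iff_norm_sub_tendsto_zero.1 (hlim q)
  -- The supremum of a Fourier transform is at most the `L¹` norm, so this controls uniform
  -- convergence.
  have hL1 : Tendsto (fun ε => ∫ q, ‖A ε q - A₀ q‖) (𝓝[>] (0 : ℝ)) (𝓝 0) := by
    have := tendsto_integral_filter_of_dominated_convergence (μ := volume)
      (F := fun ε q => ‖A ε q - A₀ q‖) (f := fun _ => 0) (l := 𝓝[>] (0 : ℝ))
      (fun q => C * ((1 + ‖q‖) ^ N)⁻¹) (hpos.mono fun ε hε => (hD ε hε).norm.1)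
      (hb.mono fun ε hε => .of_forall fun q => by rw [norm_norm]; exact hε q)
      (hN.const_mul C) (.of_forall hlim')
    simpa using this
  -- The square of the dominating weight is integrable too; through Plancherel this controls `L²`
  -- convergence.
  have hL2 : Tendsto (fun ε => ∫ q, ‖A ε q - A₀ q‖ ^ (2 : ℝ)) (𝓝[>] (0 : ℝ)) (𝓝 0) := by
    have := tendsto_integral_filter_of_dominated_convergence (μ := volume)
      (F := fun ε q => ‖A ε q - A₀ q‖ ^ (2 : ℝ)) (f := fun _ => 0) (l := 𝓝[>] (0 : ℝ))
      (fun q => C ^ 2 * (((1 + ‖q‖) ^ N)⁻¹) ^ 2)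
      (hpos.mono fun ε hε => by
        simp only [Real.rpow_two]
        exact (hD ε hε).norm.1.pow 2)
      (hb.mono fun ε hε => .of_forall fun q => by
        rw [Real.rpow_two, norm_pow, norm_norm, ← mul_pow]
        exact pow_le_pow_left₀ (norm_nonneg _) (hε q) 2)
      (hN2.const_mul _) (.of_forall fun q => by
        simp only [Real.rpow_two]
        simpa using (hlim' q).pow 2)
    simpa using this
  refine ⟨?_, ?_⟩
  · rw [Metric.tendstoUniformly_iff]
    intro δ hδ
    filter_upwards [hL1.eventually (gt_mem_nhds hδ), hpos] with ε h1 hε x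
    rw [dist_comm, dist_eq_norm, ← fourier_sub_apply (hA ε hε) hA₀]
    exact (VectorFourier.norm_fourierIntegral_le_integral_norm _ _ _ _ _).trans_lt h1
  · have h3 : ∀ᶠ ε in 𝓝[>] (0 : ℝ), ENNReal.ofReal ((∫ q, ‖A ε q - A₀ q‖ ^ (2 : ℝ)) ^ (2 : ℝ)⁻¹) =
        eLpNorm (fun x => 𝓕 (A ε) x - 𝓕 A₀ x) 2 volume := by
      filter_upwards [hb, hpos] with ε h1 hε
      have h4 : MemLp (fun q => A ε q - A₀ q) 2 volume := by
        rw [memLp_two_iff_integrable_sq_norm (hD ε hε).1]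
        refine (hN2.const_mul (C ^ 2)).mono' ((hD ε hε).norm.1.pow 2) (.of_forall fun q => ?_)
        rw [norm_pow, norm_norm, ← mul_pow]
        exact pow_le_pow_left₀ (norm_nonneg _) (h1 q) 2
      have h5 : (fun x => 𝓕 (A ε) x - 𝓕 A₀ x) = 𝓕 (fun q => A ε q - A₀ q) :=
        funext fun x => (fourier_sub_apply (hA ε hε) hA₀ x).symm
      rw [h5, eLpNorm_fourier_eq (hD ε hε) h4,
        h4.eLpNorm_eq_integral_rpow_norm two_ne_zero ENNReal.ofNat_ne_top]
      simp
    refine Tendsto.congr' h3 ?_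
    have h6 := ENNReal.tendsto_ofReal (hL2.rpow_const (p := (2 : ℝ)⁻¹) (.inr (by norm_num)))
    simpa using h6

theorem ConvergesOnInterval.tendsto_wignerRep (hF : ConvergesOnInterval T F F₀)
    (hG : ConvergesOnInterval T G G₀) :
    TendstoUniformly (fun ε => wignerRep ε T (F ε) (G ε)) (liouvilleRep T F₀ G₀) (𝓝[>] (0 : ℝ)) ∧
      Tendsto (fun ε => eLpNorm (fun x => wignerRep ε T (F ε) (G ε) x - liouvilleRep T F₀ G₀ x)
        2 volume) (𝓝[>] (0 : ℝ)) (𝓝 0) := by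
  obtain ⟨N, hN, hN2, -⟩ := exists_integrable_weight d
  obtain ⟨C₁, -, hC₁⟩ := hF.exists_wignerTransform_le hG N
  obtain ⟨C₀, -, hC₀⟩ := exists_liouvilleTransform_le T hF.continuous_limit hG.continuous_limit N
  have hb : ∀ᶠ ε in 𝓝[>] (0 : ℝ), ∀ q, ‖wignerTransform ε T (F ε) (G ε) q -
      liouvilleTransform T F₀ G₀ q‖ ≤ (C₁ + C₀) * ((1 + ‖q‖) ^ N)⁻¹ := by
    filter_upwards [hC₁] with ε hε q
    rw [← div_eq_mul_inv, le_div_iff₀ (by positivity)]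
    calc _ ≤ (‖wignerTransform ε T (F ε) (G ε) q‖ + ‖liouvilleTransform T F₀ G₀ q‖) *
          (1 + ‖q‖) ^ N := by gcongr; exact norm_sub_le _ _
      _ = (1 + ‖q‖) ^ N * ‖wignerTransform ε T (F ε) (G ε) q‖ +
          (1 + ‖q‖) ^ N * ‖liouvilleTransform T F₀ G₀ q‖ := by ring
      _ ≤ _ := add_le_add (hε q) (hC₀ q)
  have hpos : ∀ᶠ ε in 𝓝[>] (0 : ℝ), 0 < ε := self_mem_nhdsWithin
  have hrep : ∀ ε, 0 < ε → wignerRep ε T (F ε) (G ε) = 𝓕 (wignerTransform ε T (F ε) (G ε)) :=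
    fun ε hε => wignerRep_eq_fourier T (hF.continuous ε hε) (hG.continuous ε hε) hε
  obtain ⟨h1, h2⟩ := tendsto_fourier_of_dominated hN hN2
    (fun ε hε => integrable_wignerTransform T (hF.continuous ε hε) (hG.continuous ε hε) hε)
    (integrable_liouvilleTransform T hF.continuous_limit hG.continuous_limit) hb
    (hF.tendsto_wignerTransform hG)
  rw [liouvilleRep_eq_fourier T hF.continuous_limit hG.continuous_limit]
  refine ⟨fun u hu => ((h1 u hu).and hpos).mono fun ε hε => by
      simp only [hrep ε hε.2]; exact hε.1,
    h2.congr' (hpos.mono fun ε hε => by simp only [hrep ε hε])⟩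

end Limit

end WignerLiouville

end

/-! ### The semiclassical limit for the given solutions -/

theorem mainTheorem2 (d : ℕ) (V : WignerLiouville.Space d → ℝ)
    (hV : WignerLiouville.IsAdmissiblePotential V) (T : ℝ) (hT : 0 < T)
    (fI gT : ℝ → WignerLiouville.PhaseFun d) (fI₀ gT₀ : WignerLiouville.PhaseFun d)
    (hfI : WignerLiouville.ConvergesRegularly fI fI₀)
    (hgT : WignerLiouville.ConvergesRegularly gT gT₀)
    (fb g : ℝ → ℝ → WignerLiouville.PhaseFun d) (fb₀ g₀ : ℝ → WignerLiouville.PhaseFun d)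
    (hfb : ∀ ε : ℝ, 0 < ε → WignerLiouville.SolvesWigner V ε T (fb ε) ∧ fb ε 0 = fI ε)
    (hg : ∀ ε : ℝ, 0 < ε → WignerLiouville.SolvesWigner V ε T (g ε) ∧ g ε T = gT ε)
    (hfb₀ : WignerLiouville.SolvesLiouville V T fb₀ ∧ fb₀ 0 = fI₀)
    (hg₀ : WignerLiouville.SolvesLiouville V T g₀ ∧ g₀ T = gT₀) :
    (∀ ε : ℝ, 0 < ε → ∀ x : WignerLiouville.Space d,
      Integrable (WignerLiouville.wignerIntegrand ε (fb ε) (g ε) x)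
        (WignerLiouville.wignerMeasure d T)) ∧
    (∀ (j : Fin d) (x : WignerLiouville.Space d),
      Integrable (WignerLiouville.liouvilleIntegrand fb₀ g₀ j x)
        (WignerLiouville.liouvilleMeasure d T)) ∧
    (∀ j : Fin d, Differentiable ℝ (WignerLiouville.liouvilleFlux T fb₀ g₀ j)) ∧
    TendstoUniformly
      (fun (ε : ℝ) (x : WignerLiouville.Space d) =>
        WignerLiouville.wignerRep ε T (fb ε) (g ε) x)
      (WignerLiouville.liouvilleRep T fb₀ g₀) (𝓝[>] (0 : ℝ)) ∧
    Tendsto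
      (fun ε : ℝ => eLpNorm (fun x : WignerLiouville.Space d =>
        WignerLiouville.wignerRep ε T (fb ε) (g ε) x - WignerLiouville.liouvilleRep T fb₀ g₀ x)
        2 volume) (𝓝[>] (0 : ℝ)) (𝓝 0) := by
  choose F hF hFeq using fun ε (hε : 0 < ε) => (hfb ε hε).1.exists_isCurve hV hT.le
  choose G hG hGeq using fun ε (hε : 0 < ε) => (hg ε hε).1.exists_isCurve hV hT.le
  obtain ⟨F₀, hF₀, hF₀eq⟩ := hfb₀.1.exists_isCurve hV hT.le
  obtain ⟨G₀, hG₀, hG₀eq⟩ := hg₀.1.exists_isCurve hV hT.le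
  have h0 : (0 : ℝ) ∈ Set.Icc 0 T := ⟨le_rfl, hT.le⟩
  have h1 : T ∈ Set.Icc 0 T := ⟨hT.le, le_rfl⟩
  set F' : ℝ → ℝ → WignerLiouville.PhaseFun d := fun ε => if hε : 0 < ε then F ε hε else 0 with hF'
  set G' : ℝ → ℝ → WignerLiouville.PhaseFun d := fun ε => if hε : 0 < ε then G ε hε else 0 with hG'
  have hF'eq : ∀ ε (hε : 0 < ε), F' ε = F ε hε := fun ε hε => dif_pos hε
  have hG'eq : ∀ ε (hε : 0 < ε), G' ε = G ε hε := fun ε hε => dif_pos hε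
  have hFconv : WignerLiouville.ConvergesOnInterval T F' F₀ :=
    WignerLiouville.convergesOnInterval_of_isCurve hV
      (fun ε hε => by rw [hF'eq ε hε]; exact hF ε hε) hF₀ hfI h0
      (fun ε hε => by rw [hF'eq ε hε, hFeq ε hε 0 h0]; exact (hfb ε hε).2)
      (by rw [hF₀eq 0 h0]; exact hfb₀.2)
  have hGconv : WignerLiouville.ConvergesOnInterval T G' G₀ :=
    WignerLiouville.convergesOnInterval_of_isCurve hV
      (fun ε hε => by rw [hG'eq ε hε]; exact hG ε hε) hG₀ hgT h1
      (fun ε hε => by rw [hG'eq ε hε, hGeq ε hε T h1]; exact (hg ε hε).2)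
      (by rw [hG₀eq T h1]; exact hg₀.2)
  have hrep : ∀ ε, 0 < ε → WignerLiouville.wignerRep ε T (F' ε) (G' ε) =
      WignerLiouville.wignerRep ε T (fb ε) (g ε) := fun ε hε => by
    rw [hF'eq ε hε, hG'eq ε hε]
    exact WignerLiouville.wignerRep_congr (hFeq ε hε) (hGeq ε hε) ε
  have hpos : ∀ᶠ ε in 𝓝[>] (0 : ℝ), 0 < ε := self_mem_nhdsWithin
  obtain ⟨hu, hL⟩ := hFconv.tendsto_wignerRep hGconv
  rw [WignerLiouville.liouvilleRep_congr hF₀eq hG₀eq] at hu hL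
  refine ⟨fun ε hε x => ?_, fun j x => ?_, fun j => ?_, fun u hu' => ?_, ?_⟩
  · exact (WignerLiouville.integrable_wignerIntegrand T (hF ε hε).continuous (hG ε hε).continuous
      hε x).congr (WignerLiouville.wignerIntegrand_ae_eq (hFeq ε hε) (hGeq ε hε) ε x)
  · exact (WignerLiouville.integrable_liouvilleIntegrand T hF₀.continuous hG₀.continuous j x).congr
      (WignerLiouville.liouvilleIntegrand_ae_eq hF₀eq hG₀eq j x)
  · rw [← WignerLiouville.liouvilleFlux_congr hF₀eq hG₀eq j]
    exact WignerLiouville.differentiable_liouvilleFlux T hF₀.continuous hG₀.continuous j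
  · exact ((hu u hu').and hpos).mono fun ε hε => by simp only [← hrep ε hε.2]; exact hε.1
  · exact hL.congr' (hpos.mono fun ε hε => by simp only [hrep ε hε])
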